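/- Let $E \to M$ be a smooth real vector bundle of finite rank over a finite-dimensional smooth manifold (Hausdorff, second countable, without boundary), and let $E^*\to M$ be its dual bundle. For $t\in\mathbb R$ let $h_t$ denote fibrewise multiplication by $t$ (on $E$ or on $E^*$). **Definitions.** For $q\ge 0$ let $DO_q(E)$ be the space of (scalar) differential operators of order $\le q$ on $E$, i.e. of $\mathbb R$-linear maps $\Delta : C^\infty(E)\to C^\infty(E)$ with $[\cdots[[\Delta,f_0],f_1],\dots,f_q]=0$ for all $f_0,\dots,f_q\in C^\infty(E)$, and let $DO(E)=\bigcup_q DO_q(E)$. An operator $\Delta$ has degree $k\in\mathbb Z$ if $h_t^*\circ\Delta\circ (h_t^*)^{-1}=t^k\Delta$ for all $t\ne 0$. Core operators of order $q$ are the elements of $DO_q(E)$ of degree $-q$, and fibrewise linear (FWL) operators of order $q$ are the elements of $DO_q(E)$ of degree $-q+1$; $DO_{\mathrm{core}}(E)$ and $DO_{\mathrm{lin}}(E)$ denote the spaces of finite sums, over all $q \geq 0$, of core, respectively FWL, operators of order $q$. In particular $DO_{\mathrm{core}}(E)$ contains the multiplications by pull-backs $\pi^*f$ of functions $f\in C^\infty(M)$,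 and the vertical lifts $e^\uparrow$ of sections $e\in\Gamma(E)$, $(e^\uparrow g)(p)=\frac{d}{ds}\big|_{s=0}\,g(p+s\,e_{\pi(p)})$. One has $DO_{\mathrm{core}}(E)\subseteq DO_{\mathrm{lin}}(E)$, $DO_{\mathrm{core}}(E)$ is closed under composition, and $DO_{\mathrm{lin}}(E)$ is closed under commutators and under composition from the left with core operators. A function $f$ on $E^*$ has degree $k$ if $h_t^*f=t^kf$ for all $t \in \mathbb{R}$; $C^\infty_{\mathrm{poly}}(E^*)$ is the algebra of finite sums of smooth functions of degrees $0,1,2,\dots$, and $\mathfrak X_{\mathrm{poly}}(E^*)$ is the Lie algebra of vector fields on $E^*$ (derivations of $C^\infty(E^*)$) that map $C^\infty_{\mathrm{poly}}(E^*)$ into itself. For $e\in\Gamma(E)$, $\ell_e$ denotes the fibrewise linear function $\varphi\mapsto\varphi(e)$ on $E^*$. A Lie–Rinehart algebra over a commutative $\mathbb R$-algebra $A$ is an $A$-module $L$ with an $\mathbb R$-Lie bracket and an anchor, i.e. an $A$-linear Lie algebra map $\rho:L\to\mathrm{Der}(A)$, such that $[x,ay]=\rho(x)(a)\,y+a[x,y]$.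 The Lie algebra $\mathfrak X_{\mathrm{poly}}(E^*)$ is one over $C^\infty_{\mathrm{poly}}(E^*)$, with the action of vector fields on functions as anchor. **Theorem.** 1. FWL operators are exactly the stabilizer of the core operators: a differential operator $\Delta\in DO(E)$ lies in $DO_{\mathrm{lin}}(E)$ if and only if $[\Delta,G]\in DO_{\mathrm{core}}(E)$ for all $G\in DO_{\mathrm{core}}(E)$. 2. $DO_{\mathrm{core}}(E)$ is its own centralizer: a differential operator $\Delta\in DO(E)$ lies in $DO_{\mathrm{core}}(E)$ if and only if $[\Delta,G]=0$ for all $G\in DO_{\mathrm{core}}(E)$. In particular, $DO_{\mathrm{core}}(E)$ is a commutative algebra. 3. Over the commutative algebra $DO_{\mathrm{core}}(E)$, acting by composition from the left, $DO_{\mathrm{lin}}(E)$ with the commutator is a Lie–Rinehart algebra with anchor $\Delta\mapsto[\Delta,-]$; so is $DO_{\mathrm{core}}(E)$ itself, with the commutator (which is zero) as bracket and with zero anchor. 4. There is exactly one homomorphism of algebras $\Phi: DO_{\mathrm{core}}(E)\to C^\infty_{\mathrm{poly}}(E^*)$ that maps (multiplication by) $\pi^*f$ to the pull-back of $f$ to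 $E^*$ and $e^\uparrow$ to $\ell_e$, for all $f\in C^\infty(M)$ and $e\in\Gamma(E)$, and $\Phi$ is an isomorphism. 5. For every $\Delta\in DO_{\mathrm{lin}}(E)$ there is exactly one polynomial vector field $ad(\Delta)\in\mathfrak X_{\mathrm{poly}}(E^*)$ with $ad(\Delta)(\Phi(G))=\Phi([\Delta,G])$ for all $G\in DO_{\mathrm{core}}(E)$. The inclusion $DO_{\mathrm{core}}(E)\to DO_{\mathrm{lin}}(E)$ is a homomorphism of Lie–Rinehart algebras over $DO_{\mathrm{core}}(E)$, $ad: DO_{\mathrm{lin}}(E)\to\mathfrak X_{\mathrm{poly}}(E^*)$ is a homomorphism of Lie–Rinehart algebras over $\Phi$, and the sequence $$0\longrightarrow DO_{\mathrm{core}}(E)\longrightarrow DO_{\mathrm{lin}}(E)\overset{ad}{\longrightarrow}\mathfrak X_{\mathrm{poly}}(E^*)\longrightarrow 0$$ is exact; in particular $ad$ is surjective. -/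

import Mathlib

open Bundle Manifold
open scoped ContDiff

set_option linter.unusedVariables false

namespace FWL

section Algebra

attribute [local instance] LieRing.ofAssociativeRing

variable {A : Type*} [CommRing A] [Algebra ℝ A]

/-- The order zero operator `g ↦ f * g`. -/
def mulOp (f : A) : Module.End ℝ A := LinearMap.mulLeft ℝ f

/-- `order A q` is the space of differential operators of order (at most) `q` on the
commutative algebra `A`: the `ℝ`-linear maps `Δ : A → A` such that
`[⋯[[Δ, f₀], f₁], ⋯, f_q] = 0` for all `f₀, …, f_q` in `A`. -/
def order (A : Type*) [CommRing A] [Algebra ℝ A] : ℕ → Submodule ℝ (Module.End ℝ A)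
  | 0 =>
    { carrier := {Δ | ∀ f : A, ⁅Δ, mulOp f⁆ = 0}
      zero_mem' := fun f => zero_lie (mulOp f)
      add_mem' := fun {a b} ha hb f =>
        (add_lie a b (mulOp f)).trans (by rw [ha f, hb f, add_zero])
      smul_mem' := fun c a ha f =>
        (smul_lie c a (mulOp f)).trans (by rw [ha f, smul_zero]) }
  | q + 1 =>
    { carrier := {Δ | ∀ f : A, ⁅Δ, mulOp f⁆ ∈ order A q}
      zero_mem' := fun f => by
        rw [show ⁅(0 : Module.End ℝ A), mulOp f⁆ = 0 from zero_lie (mulOp f)]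
        exact Submodule.zero_mem _
      add_mem' := fun {a b} ha hb f =>
        add_lie a b (mulOp f) ▸ Submodule.add_mem _ (ha f) (hb f)
      smul_mem' := fun c a ha f =>
        smul_lie c a (mulOp f) ▸ Submodule.smul_mem _ c (ha f) }

theorem mem_order_zero {Δ : Module.End ℝ A} : Δ ∈ order A 0 ↔ ∀ f : A, ⁅Δ, mulOp f⁆ = 0 :=
  Iff.rfl

theorem mem_order_succ {q : ℕ} {Δ : Module.End ℝ A} :
    Δ ∈ order A (q + 1) ↔ ∀ f : A, ⁅Δ, mulOp f⁆ ∈ order A q :=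
  Iff.rfl

theorem order_le_succ (q : ℕ) : order A q ≤ order A (q + 1) := by
  induction q with
  | zero => intro Δ h f; rw [h f]; exact Submodule.zero_mem _
  | succ q ih => intro Δ h f; exact ih (h f)

theorem order_mono : Monotone (order A) := monotone_nat_of_le_succ order_le_succ

theorem mulOp_lie (f g : A) : ⁅mulOp f, mulOp g⁆ = 0 := by
  ext h
  simp [mulOp, Ring.lie_def, mul_left_comm]

theorem mulOp_mem_order (f : A) : mulOp f ∈ order A 0 := fun g => mulOp_lie f g

theorem one_mem_order : (1 : Module.End ℝ A) ∈ order A 0 := fun g => by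
  simp [Ring.lie_def]

theorem order_mul {q r : ℕ} {Δ Δ' : Module.End ℝ A} (h : Δ ∈ order A q) (h' : Δ' ∈ order A r) :
    Δ * Δ' ∈ order A (q + r) := by
  have key : ∀ f : A, ⁅Δ * Δ', mulOp f⁆ = Δ * ⁅Δ', mulOp f⁆ + ⁅Δ, mulOp f⁆ * Δ' := fun f => by
    simp only [Ring.lie_def, mul_sub, sub_mul, mul_assoc]; abel
  induction hn : q + r generalizing q r Δ Δ' with
  | zero =>
    obtain ⟨rfl, rfl⟩ : q = 0 ∧ r = 0 := by omega
    intro f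
    rw [key, h f, h' f, mul_zero, zero_mul, add_zero]
  | succ n ih =>
    have key' : ∀ {Δ Δ' : Module.End ℝ A} (f : A),
        ⁅Δ * Δ', mulOp f⁆ = Δ * ⁅Δ', mulOp f⁆ + ⁅Δ, mulOp f⁆ * Δ' := fun f => by
      simp only [Ring.lie_def, mul_sub, sub_mul, mul_assoc]; abel
    intro f
    rw [key]
    refine Submodule.add_mem _ ?_ ?_
    · cases r with
      | zero => rw [h' f, mul_zero]; exact Submodule.zero_mem _
      | succ r => exact ih h (h' f) (fun f => key' f) (by omega)
    · cases q with
      | zero => rw [h f, zero_mul]; exact Submodule.zero_mem _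
      | succ q => exact ih (h f) h' (fun f => key' f) (by omega)

theorem order_lie_zero {Δ Δ' : Module.End ℝ A} (h : Δ ∈ order A 0) (h' : Δ' ∈ order A 0) :
    ⁅Δ, Δ'⁆ = 0 := by
  have e : ∀ {D : Module.End ℝ A}, D ∈ order A 0 → D = mulOp (D 1) := fun {D} hD => by
    ext f
    have := LinearMap.congr_fun (hD f) 1
    simp [Ring.lie_def, mulOp, sub_eq_zero] at this
    simpa [mulOp, mul_comm] using this
  rw [e h, e h', mulOp_lie]

theorem order_lie {q r n : ℕ} {Δ Δ' : Module.End ℝ A} (h : Δ ∈ order A q) (h' : Δ' ∈ order A r)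
    (hn : q + r = n + 1) : ⁅Δ, Δ'⁆ ∈ order A n := by
  induction n generalizing q r Δ Δ' with
  | zero =>
    intro f
    rw [lie_lie]
    obtain ⟨rfl, rfl⟩ | ⟨rfl, rfl⟩ : (q = 1 ∧ r = 0) ∨ (q = 0 ∧ r = 1) := by omega
    · rw [h' f, lie_zero, order_lie_zero h' (h f), sub_zero]
    · rw [h f, lie_zero, order_lie_zero h (h' f), sub_zero]
  | succ n ih =>
    intro f
    rw [lie_lie]
    refine Submodule.sub_mem _ ?_ ?_
    · cases r with
      | zero => rw [h' f, lie_zero]; exact Submodule.zero_mem _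
      | succ r => exact ih h (h' f) (by omega)
    · cases q with
      | zero => rw [h f, lie_zero]; exact Submodule.zero_mem _
      | succ q => exact ih h' (h f) (by omega)

/-- The algebra `DO` of all differential operators on `A`, of any finite order. -/
def diffOps (A : Type*) [CommRing A] [Algebra ℝ A] : Subalgebra ℝ (Module.End ℝ A) where
  carrier := {Δ | ∃ q, Δ ∈ order A q}
  mul_mem' := fun ⟨q, h⟩ ⟨r, h'⟩ => ⟨q + r, order_mul h h'⟩
  add_mem' := fun ⟨q, h⟩ ⟨r, h'⟩ => ⟨max q r, Submodule.add_mem _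
    (order_mono (le_max_left q r) h) (order_mono (le_max_right q r) h')⟩
  algebraMap_mem' := fun c => ⟨0, by
    rw [Algebra.algebraMap_eq_smul_one]; exact Submodule.smul_mem _ c one_mem_order⟩

/-! Throughout, `h` is an action of the multiplicative monoid of the reals on the algebra `A`
(for a vector bundle: `h t` is the pull-back of functions along fibrewise multiplication by `t`). -/

/-- The elements of degree `k` in `A`: those `f` with `h_t f = t ^ k f` for all `t`. -/
def funDegree (h : ℝ →* (A →ₐ[ℝ] A)) (k : ℕ) : Submodule ℝ A where
  carrier := {f | ∀ t : ℝ, h t f = t ^ k • f}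
  zero_mem' := fun t => by simp
  add_mem' := fun {a b} ha hb t => by rw [map_add, ha t, hb t, smul_add]
  smul_mem' := fun c a ha t => by rw [map_smul, ha t, smul_comm]

/-- The polynomial elements of `A`: finite sums of elements of degree `0, 1, 2, …`. -/
def polyFun (h : ℝ →* (A →ₐ[ℝ] A)) : Subalgebra ℝ A :=
  (⨆ k, funDegree h k).toSubalgebra
    (Submodule.mem_iSup_of_mem 0 fun t => by simp)
    (by
      have key : ∀ (k l : ℕ) (x y : A), x ∈ funDegree h k → y ∈ funDegree h l →
          x * y ∈ ⨆ k, funDegree h k := fun k l x y hx hy =>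
        Submodule.mem_iSup_of_mem (k + l) fun t => by
          rw [map_mul, hx t, hy t, smul_mul_smul_comm, pow_add]
      intro x y hx hy
      induction hx using Submodule.iSup_induction' with
      | mem k x hx =>
        induction hy using Submodule.iSup_induction' with
        | mem l y hy => exact key k l x y hx hy
        | zero => rw [mul_zero]; exact Submodule.zero_mem _
        | add a b _ _ ha hb => rw [mul_add]; exact Submodule.add_mem _ ha hb
      | zero => rw [zero_mul]; exact Submodule.zero_mem _
      | add a b _ _ ha hb => rw [add_mul]; exact Submodule.add_mem _ ha hb)

/-- The pull-back `h_t^* Δ = h_t^* ∘ Δ ∘ (h_t^*)⁻¹` of an operator (for `t ≠ 0`). -/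
noncomputable def pullOp (h : ℝ →* (A →ₐ[ℝ] A)) (t : ℝ) (Δ : Module.End ℝ A) : Module.End ℝ A :=
  (h t).toLinearMap ∘ₗ Δ ∘ₗ (h t⁻¹).toLinearMap

theorem pullOp_mul (h : ℝ →* (A →ₐ[ℝ] A)) {t : ℝ} (ht : t ≠ 0) (Δ Δ' : Module.End ℝ A) :
    pullOp h t (Δ * Δ') = pullOp h t Δ * pullOp h t Δ' := by
  ext f
  have : ∀ g, h t⁻¹ (h t g) = g := fun g => by
    rw [← AlgHom.mul_apply, ← map_mul, inv_mul_cancel₀ ht, map_one, AlgHom.one_apply]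
  simp [pullOp, this]

/-- An operator has degree `k` if `h_t^* Δ = t ^ k Δ` for all `t ≠ 0`. -/
structure HasOpDegree (h : ℝ →* (A →ₐ[ℝ] A)) (k : ℤ) (Δ : Module.End ℝ A) : Prop where
  pullOp_eq : ∀ t : ℝ, t ≠ 0 → pullOp h t Δ = t ^ k • Δ

/-- The space of operators of degree `k`. -/
def opDegree (h : ℝ →* (A →ₐ[ℝ] A)) (k : ℤ) : Submodule ℝ (Module.End ℝ A) where
  carrier := {Δ | HasOpDegree h k Δ}
  zero_mem' := ⟨fun t _ => by ext; simp [pullOp]⟩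
  add_mem' := fun {a b} ha hb => ⟨fun t ht => by
    rw [smul_add, ← ha.1 t ht, ← hb.1 t ht]; ext; simp [pullOp]⟩
  smul_mem' := fun c a ha => ⟨fun t ht => by
    rw [smul_comm, ← ha.1 t ht]; ext; simp [pullOp]⟩

theorem opDegree_mul (h : ℝ →* (A →ₐ[ℝ] A)) {k l : ℤ} {Δ Δ' : Module.End ℝ A}
    (hΔ : Δ ∈ opDegree h k) (hΔ' : Δ' ∈ opDegree h l) : Δ * Δ' ∈ opDegree h (k + l) := by
  refine ⟨fun t ht => ?_⟩
  rw [pullOp_mul h ht, hΔ.1 t ht, hΔ'.1 t ht, smul_mul_smul_comm, zpow_add₀ ht]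

theorem opDegree_lie (h : ℝ →* (A →ₐ[ℝ] A)) {k l : ℤ} {Δ Δ' : Module.End ℝ A}
    (hΔ : Δ ∈ opDegree h k) (hΔ' : Δ' ∈ opDegree h l) : ⁅Δ, Δ'⁆ ∈ opDegree h (k + l) := by
  rw [Ring.lie_def]
  refine Submodule.sub_mem _ (opDegree_mul h hΔ hΔ') ?_
  rw [add_comm]
  exact opDegree_mul h hΔ' hΔ

/-- Core operators of order `q`: the operators of order `q` and degree `-q`. -/
def coreOrder (h : ℝ →* (A →ₐ[ℝ] A)) (q : ℕ) : Submodule ℝ (Module.End ℝ A) :=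
  order A q ⊓ opDegree h (-(q : ℤ))

/-- Fibre-wise linear operators of order `q`: the operators of order `q` and degree `-q + 1`. -/
def linOrder (h : ℝ →* (A →ₐ[ℝ] A)) (q : ℕ) : Submodule ℝ (Module.End ℝ A) :=
  order A q ⊓ opDegree h (-(q : ℤ) + 1)

theorem iSup_bilin {ι κ : Type*} {W : Submodule ℝ (Module.End ℝ A)}
    (b : Module.End ℝ A →ₗ[ℝ] Module.End ℝ A →ₗ[ℝ] Module.End ℝ A)
    (S : ι → Submodule ℝ (Module.End ℝ A)) (T : κ → Submodule ℝ (Module.End ℝ A))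
    (hST : ∀ i j, ∀ x ∈ S i, ∀ y ∈ T j, b x y ∈ W) {x y : Module.End ℝ A}
    (hx : x ∈ ⨆ i, S i) (hy : y ∈ ⨆ j, T j) : b x y ∈ W := by
  induction hx using Submodule.iSup_induction' with
  | mem i x hx =>
    induction hy using Submodule.iSup_induction' with
    | mem j y hy => exact hST i j x hx y hy
    | zero => rw [map_zero]; exact Submodule.zero_mem _
    | add c d _ _ hc hd => rw [map_add]; exact Submodule.add_mem _ hc hd
  | zero => rw [map_zero, LinearMap.zero_apply]; exact Submodule.zero_mem _
  | add c d _ _ hc hd => rw [map_add, LinearMap.add_apply]; exact Submodule.add_mem _ hc hd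

/-- `Δ` is a core operator: a finite sum of core operators of orders `q = 0, 1, 2, …`. -/
structure IsCore (h : ℝ →* (A →ₐ[ℝ] A)) (Δ : Module.End ℝ A) : Prop where
  mem : Δ ∈ ⨆ q, coreOrder h q

/-- `Δ` is a fibre-wise linear operator: a finite sum of fibre-wise linear operators of orders
`q = 0, 1, 2, …`. -/
structure IsLin (h : ℝ →* (A →ₐ[ℝ] A)) (Δ : Module.End ℝ A) : Prop where
  mem : Δ ∈ ⨆ q, linOrder h q

theorem IsCore.of_order {h : ℝ →* (A →ₐ[ℝ] A)} (q : ℕ) {Δ : Module.End ℝ A}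
    (hΔ : Δ ∈ coreOrder h q) : IsCore h Δ :=
  ⟨Submodule.mem_iSup_of_mem (p := coreOrder h) q hΔ⟩

/-- The algebra of core operators (under composition). -/
def coreDO (h : ℝ →* (A →ₐ[ℝ] A)) : Subalgebra ℝ (Module.End ℝ A) where
  carrier := {Δ | IsCore h Δ}
  add_mem' := fun hx hy => ⟨Submodule.add_mem _ hx.mem hy.mem⟩
  mul_mem' := fun {x y} hx hy => ⟨iSup_bilin (LinearMap.mul ℝ _) (coreOrder h) (coreOrder h)
    (fun q r x hx y hy => Submodule.mem_iSup_of_mem (p := coreOrder h) (q + r)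
      ⟨order_mul hx.1 hy.1, by
        have := opDegree_mul h hx.2 hy.2
        rwa [show -(q : ℤ) + -(r : ℤ) = -((q + r : ℕ) : ℤ) by push_cast; ring] at this⟩)
      hx.mem hy.mem⟩
  algebraMap_mem' := fun c => by
    rw [Algebra.algebraMap_eq_smul_one]
    refine ⟨Submodule.smul_mem _ c (IsCore.of_order 0 ⟨one_mem_order, ⟨fun t ht => ?_⟩⟩).mem⟩
    ext f
    simp only [pullOp, LinearMap.comp_apply, Module.End.one_apply, AlgHom.toLinearMap_apply]
    rw [← AlgHom.mul_apply, ← map_mul, mul_inv_cancel₀ ht]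
    simp

theorem lie_zero_order {q : ℕ} {Δ Δ' : Module.End ℝ A} (hq : Δ ∈ order A q)
    {r : ℕ} (hr : Δ' ∈ order A r) (h0 : q = 0 ∧ r = 0) : ⁅Δ, Δ'⁆ = 0 := by
  obtain ⟨rfl, rfl⟩ := h0
  exact order_lie_zero hq hr

/-- The Lie algebra of fibre-wise linear operators (with the commutator). -/
def linDO (h : ℝ →* (A →ₐ[ℝ] A)) : LieSubalgebra ℝ (Module.End ℝ A) where
  carrier := {Δ | IsLin h Δ}
  zero_mem' := ⟨Submodule.zero_mem _⟩
  add_mem' := fun hx hy => ⟨Submodule.add_mem _ hx.mem hy.mem⟩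
  smul_mem' := fun c _ hx => ⟨Submodule.smul_mem _ c hx.mem⟩
  lie_mem' := fun {x y} hx hy => ⟨
    iSup_bilin (LieModule.toEnd ℝ (Module.End ℝ A) (Module.End ℝ A)).toLinearMap
      (linOrder h) (linOrder h) (fun q r x hx y hy => by
        change ⁅x, y⁆ ∈ ⨆ q, linOrder h q
        obtain h0 | ⟨n, hn⟩ : (q = 0 ∧ r = 0) ∨ ∃ n, q + r = n + 1 := by
          rcases Nat.eq_zero_or_pos (q + r) with h | h
          · left; omega
          · exact Or.inr ⟨q + r - 1, by omega⟩
        · rw [lie_zero_order hx.1 hy.1 h0]; exact Submodule.zero_mem _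
        · refine Submodule.mem_iSup_of_mem n ⟨order_lie hx.1 hy.1 hn, ?_⟩
          have := opDegree_lie h hx.2 hy.2
          rwa [show -(q : ℤ) + 1 + (-(r : ℤ) + 1) = -(n : ℤ) + 1 by omega] at this)
      hx.mem hy.mem⟩

theorem coreDO_le_linDO (h : ℝ →* (A →ₐ[ℝ] A)) {F : Module.End ℝ A} (hF : F ∈ coreDO h) :
    F ∈ linDO h := by
  have : (⨆ q, coreOrder h q) ≤ ⨆ q, linOrder h q :=
    iSup_le fun q => le_iSup_of_le (q + 1) fun x hx =>
      ⟨order_le_succ q hx.1, by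
        rw [show -((q + 1 : ℕ) : ℤ) + 1 = -(q : ℤ) by push_cast; ring]; exact hx.2⟩
  exact ⟨this hF.mem⟩

theorem core_mul_lin (h : ℝ →* (A →ₐ[ℝ] A)) {F Δ : Module.End ℝ A} (hF : F ∈ coreDO h)
    (hΔ : Δ ∈ linDO h) : F * Δ ∈ linDO h :=
  ⟨iSup_bilin (LinearMap.mul ℝ _) (coreOrder h) (linOrder h)
    (fun q r x hx y hy => Submodule.mem_iSup_of_mem (p := linOrder h) (q + r)
      ⟨order_mul hx.1 hy.1, by
        have := opDegree_mul h hx.2 hy.2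
        rwa [show -(q : ℤ) + (-(r : ℤ) + 1) = -((q + r : ℕ) : ℤ) + 1 by push_cast; ring] at this⟩)
    hF.mem hΔ.mem⟩

theorem lin_lie_core (h : ℝ →* (A →ₐ[ℝ] A)) {Δ F : Module.End ℝ A} (hΔ : Δ ∈ linDO h)
    (hF : F ∈ coreDO h) : ⁅Δ, F⁆ ∈ coreDO h :=
  ⟨iSup_bilin
    (LieModule.toEnd ℝ (Module.End ℝ A) (Module.End ℝ A)).toLinearMap
    (linOrder h) (coreOrder h) (fun q r x hx y hy => by
      change ⁅x, y⁆ ∈ ⨆ q, coreOrder h q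
      obtain h0 | ⟨n, hn⟩ : (q = 0 ∧ r = 0) ∨ ∃ n, q + r = n + 1 := by
        rcases Nat.eq_zero_or_pos (q + r) with h | h
        · left; omega
        · exact Or.inr ⟨q + r - 1, by omega⟩
      · rw [lie_zero_order hx.1 hy.1 h0]; exact Submodule.zero_mem _
      · refine Submodule.mem_iSup_of_mem n ⟨order_lie hx.1 hy.1 hn, ?_⟩
        have := opDegree_lie h hx.2 hy.2
        rwa [show -(q : ℤ) + 1 + -(r : ℤ) = -(n : ℤ) by omega] at this)
    hΔ.mem hF.mem⟩

/-- Core operators act on fibre-wise linear operators by composition from the left. -/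
instance (h : ℝ →* (A →ₐ[ℝ] A)) : Module (coreDO h) (linDO h) where
  smul F Δ := ⟨F.1 * Δ.1, core_mul_lin h F.2 Δ.2⟩
  one_smul Δ := Subtype.ext (one_mul _)
  mul_smul F G Δ := Subtype.ext (mul_assoc _ _ _)
  smul_zero F := Subtype.ext (mul_zero _)
  smul_add F Δ Δ' := Subtype.ext (mul_add _ _ _)
  add_smul F G Δ := Subtype.ext (add_mul _ _ _)
  zero_smul Δ := Subtype.ext (zero_mul _)

instance (h : ℝ →* (A →ₐ[ℝ] A)) : SMul (coreDO h) (linDO h) := inferInstance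

/-- Fibre-wise linear operators act on core operators by the adjoint action
`ad Δ = [Δ, -]`. -/
instance (h : ℝ →* (A →ₐ[ℝ] A)) : LieRingModule (linDO h) (coreDO h) where
  bracket Δ F := ⟨⁅Δ.1, F.1⁆, lin_lie_core h Δ.2 F.2⟩
  add_lie Δ Δ' F := Subtype.ext (add_lie Δ.1 Δ'.1 F.1)
  lie_add Δ F G := Subtype.ext (lie_add Δ.1 F.1 G.1)
  leibniz_lie Δ Δ' F := Subtype.ext (leibniz_lie Δ.1 Δ'.1 F.1)

/-- The commutative ring structure on the algebra of core operators, once it is known that core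
operators commute with each other. -/
@[reducible]
def coreCommRing (h : ℝ →* (A →ₐ[ℝ] A)) (hc : ∀ F G : coreDO h, F * G = G * F) :
    CommRing (coreDO h) :=
  { (inferInstance : Ring (coreDO h)) with mul_comm := hc }

/-- The commutator bracket on core operators. -/
instance (h : ℝ →* (A →ₐ[ℝ] A)) : LieRing (coreDO h) := LieRing.ofAssociativeRing

instance (h : ℝ →* (A →ₐ[ℝ] A)) : LieAlgebra ℝ (coreDO h) := LieAlgebra.ofAssociativeAlgebra

/-- Polynomial vector fields: the derivations of `A` that map polynomial elements of `A`
to polynomial elements. -/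
def polyVF (h : ℝ →* (A →ₐ[ℝ] A)) : LieSubalgebra ℝ (Derivation ℝ A A) where
  carrier := {X | ∀ f ∈ polyFun h, X f ∈ polyFun h}
  zero_mem' := fun f _ => Subalgebra.zero_mem _
  add_mem' := fun ha hb f hf => Subalgebra.add_mem _ (ha f hf) (hb f hf)
  smul_mem' := fun c _ ha f hf => Subalgebra.smul_mem _ (ha f hf) c
  lie_mem' := fun {X Y} hX hY f hf => by
    rw [Derivation.commutator_apply]
    exact Subalgebra.sub_mem _ (hX _ (hY f hf)) (hY _ (hX f hf))

instance (h : ℝ →* (A →ₐ[ℝ] A)) : Module (polyFun h) (polyVF h) where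
  smul a X := ⟨(a : A) • X.1, fun f hf => Subalgebra.mul_mem _ a.2 (X.2 f hf)⟩
  one_smul X := Subtype.ext (one_smul A X.1)
  mul_smul a b X := Subtype.ext (mul_smul (a : A) (b : A) X.1)
  smul_zero a := Subtype.ext (smul_zero (a : A))
  smul_add a X Y := Subtype.ext (smul_add (a : A) X.1 Y.1)
  add_smul a b X := Subtype.ext (add_smul (a : A) (b : A) X.1)
  zero_smul X := Subtype.ext (zero_smul A X.1)

/-- Polynomial vector fields act on polynomial functions by derivations. -/
instance (h : ℝ →* (A →ₐ[ℝ] A)) : LieRingModule (polyVF h) (polyFun h) where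
  bracket X a := ⟨X.1 a, X.2 a a.2⟩
  add_lie X Y a := Subtype.ext rfl
  lie_add X a b := Subtype.ext (map_add X.1 (a : A) (b : A))
  leibniz_lie X Y a := Subtype.ext (by
    change X.1 (Y.1 a) = ⁅X.1, Y.1⁆ (a : A) + Y.1 (X.1 a)
    rw [Derivation.commutator_apply]; ring)

instance (h : ℝ →* (A →ₐ[ℝ] A)) : LieRinehartRing (polyFun h) (polyVF h) where
  lie_smul_eq_mul' _ _ _ := rfl
  leibniz_mul_right' X a b := Subtype.ext (by
    change X.1 ((a : A) * b) = a * X.1 b + X.1 a * b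
    rw [Derivation.leibniz, smul_eq_mul, smul_eq_mul, mul_comm (b : A)])
  leibniz_smul_right' X Y a := Subtype.ext (by
    change ⁅X.1, (a : A) • Y.1⁆ = (a : A) • ⁅X.1, Y.1⁆ + (X.1 a) • Y.1
    ext f
    simp only [Derivation.commutator_apply, Derivation.smul_apply, Derivation.add_apply,
      Derivation.leibniz, smul_eq_mul]
    ring)

instance (h : ℝ →* (A →ₐ[ℝ] A)) : LieRinehartAlgebra ℝ (polyFun h) (polyVF h) where
  smul_assoc c a X := Subtype.ext (smul_assoc c (a : A) X.1)
  smul_lie c X a := Subtype.ext rfl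
  lie_smul c X a := Subtype.ext (X.1.map_smul c (a : A))

end Algebra

section Geometry

attribute [local instance] LieRing.ofAssociativeRing

variable (EB : Type*) [NormedAddCommGroup EB] [NormedSpace ℝ EB]
  {M : Type*} [TopologicalSpace M] [ChartedSpace EB M]
  (F : Type*) [NormedAddCommGroup F] [NormedSpace ℝ F]
  (E : M → Type*) [∀ x, AddCommGroup (E x)] [∀ x, Module ℝ (E x)] [∀ x, TopologicalSpace (E x)]
  [TopologicalSpace (TotalSpace F E)] [FiberBundle F E] [VectorBundle ℝ F E]

/-- The algebra `C^∞(E)` of smooth real functions on the total space of the bundle `E`. -/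
abbrev SmoothFun : Type _ := C^∞⟮𝓘(ℝ, EB).prod 𝓘(ℝ, F), TotalSpace F E; 𝓘(ℝ, ℝ), ℝ⟯

variable {E} in
theorem contMDiff_scale (t : ℝ) : ContMDiff (𝓘(ℝ, EB).prod 𝓘(ℝ, F)) (𝓘(ℝ, EB).prod 𝓘(ℝ, F)) ∞
    (fun p : TotalSpace F E => (⟨p.proj, t • p.2⟩ : TotalSpace F E)) := by
  intro p
  have hid : ContMDiffAt (𝓘(ℝ, EB).prod 𝓘(ℝ, F)) (𝓘(ℝ, EB).prod 𝓘(ℝ, F)) ∞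
    (fun p : TotalSpace F E => p) p := contMDiffAt_id
  rw [contMDiffAt_totalSpace] at hid ⊢
  refine ⟨hid.1, ((contMDiffAt_const (I' := 𝓘(ℝ, ℝ)) (c := t)).smul hid.2).congr_of_eventuallyEq ?_⟩
  have hmem : ∀ᶠ p' : TotalSpace F E in nhds p,
      p'.proj ∈ (trivializationAt F E p.proj).baseSet :=
    (FiberBundle.continuous_proj F E).continuousAt.eventually
      ((trivializationAt F E p.proj).open_baseSet.mem_nhds
        (mem_baseSet_trivializationAt F E p.proj))
  filter_upwards [hmem] with p' hp'
  exact ((trivializationAt F E p.proj).linear ℝ hp').map_smul t p'.2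

/-- The action of the multiplicative monoid `ℝ` on `C^∞(E)` by pull-back along the fibrewise
multiplications `p ↦ t • p`. -/
noncomputable def scaleHom : ℝ →* (SmoothFun EB F E →ₐ[ℝ] SmoothFun EB F E) where
  toFun t :=
    { toFun := fun f => f.comp ⟨_, contMDiff_scale EB F t⟩
      map_one' := rfl
      map_mul' := fun _ _ => rfl
      map_zero' := rfl
      map_add' := fun _ _ => rfl
      commutes' := fun _ => rfl }
  map_one' := by
    ext f p
    change f ⟨p.proj, (1 : ℝ) • p.2⟩ = f p
    rw [one_smul]
  map_mul' s t := by
    ext f p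
    change f ⟨p.proj, (s * t) • p.2⟩ = f ⟨p.proj, t • s • p.2⟩
    rw [mul_comm, mul_smul]

/-- The pull-back to `E` of a smooth function on `M`. -/
noncomputable def corePull (f : C^∞⟮𝓘(ℝ, EB), M; 𝓘(ℝ, ℝ), ℝ⟯) : SmoothFun EB F E :=
  f.comp ⟨_, contMDiff_proj E⟩

variable {E} in
theorem contMDiff_translate (e : Cₛ^∞⟮𝓘(ℝ, EB); F, E⟯) :
    ContMDiff ((𝓘(ℝ, EB).prod 𝓘(ℝ, F)).prod 𝓘(ℝ, ℝ)) (𝓘(ℝ, EB).prod 𝓘(ℝ, F)) ∞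
    (fun q : TotalSpace F E × ℝ =>
      (⟨q.1.proj, q.1.2 + q.2 • e q.1.proj⟩ : TotalSpace F E)) := by
  intro q
  have hid : ContMDiffAt ((𝓘(ℝ, EB).prod 𝓘(ℝ, F)).prod 𝓘(ℝ, ℝ)) (𝓘(ℝ, EB).prod 𝓘(ℝ, F)) ∞
    (fun q : TotalSpace F E × ℝ => q.1) q := contMDiffAt_fst
  have he : ContMDiffAt ((𝓘(ℝ, EB).prod 𝓘(ℝ, F)).prod 𝓘(ℝ, ℝ)) (𝓘(ℝ, EB).prod 𝓘(ℝ, F)) ∞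
      (fun q : TotalSpace F E × ℝ => (⟨q.1.proj, e q.1.proj⟩ : TotalSpace F E)) q :=
    (e.contMDiff.comp ((contMDiff_proj E).comp contMDiff_fst)).contMDiffAt
  rw [contMDiffAt_totalSpace] at hid he ⊢
  refine ⟨hid.1, (hid.2.add (contMDiffAt_snd.smul he.2)).congr_of_eventuallyEq ?_⟩
  have hmem : ∀ᶠ q' : TotalSpace F E × ℝ in nhds q,
      q'.1.proj ∈ (trivializationAt F E q.1.proj).baseSet :=
    ((FiberBundle.continuous_proj F E).comp continuous_fst).continuousAt.eventually
      ((trivializationAt F E q.1.proj).open_baseSet.mem_nhds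
        (mem_baseSet_trivializationAt F E q.1.proj))
  filter_upwards [hmem] with q' hq'
  have hl := (trivializationAt F E q.1.proj).linear ℝ hq'
  have h1 := hl.map_add q'.1.2 (q'.2 • e q'.1.proj)
  have h2 := hl.map_smul q'.2 (e q'.1.proj)
  simp only [Pi.add_apply, Pi.smul_apply'] at *
  rw [h1, h2]

variable {E} in
theorem contMDiff_along (e : Cₛ^∞⟮𝓘(ℝ, EB); F, E⟯) (f : SmoothFun EB F E) :
    ContMDiff ((𝓘(ℝ, EB).prod 𝓘(ℝ, F)).prod 𝓘(ℝ, ℝ)) 𝓘(ℝ, ℝ) ∞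
    (fun q : TotalSpace F E × ℝ => f ⟨q.1.proj, q.1.2 + q.2 • e q.1.proj⟩) :=
  f.contMDiff.comp (contMDiff_translate EB F e)

variable {E} in
theorem differentiable_along (e : Cₛ^∞⟮𝓘(ℝ, EB); F, E⟯) (f : SmoothFun EB F E)
    (p : TotalSpace F E) :
    Differentiable ℝ (fun s : ℝ => f ⟨p.proj, p.2 + s • e p.proj⟩) := by
  have h : ContMDiff 𝓘(ℝ, ℝ) 𝓘(ℝ, ℝ) ∞ (fun s : ℝ => f ⟨p.proj, p.2 + s • e p.proj⟩) :=
    (contMDiff_along EB F e f).comp (contMDiff_const (c := p).prodMk contMDiff_id)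
  exact h.contDiff.differentiable (by simp)

variable {E} [IsManifold 𝓘(ℝ, EB) ∞ M] [ContMDiffVectorBundle ∞ F E 𝓘(ℝ, EB)]

theorem contMDiff_deriv_along (e : Cₛ^∞⟮𝓘(ℝ, EB); F, E⟯) (f : SmoothFun EB F E) :
    ContMDiff (𝓘(ℝ, EB).prod 𝓘(ℝ, F)) 𝓘(ℝ, ℝ) ∞
    (fun p : TotalSpace F E => deriv (fun s : ℝ => f ⟨p.proj, p.2 + s • e p.proj⟩) 0) := by
  intro p
  have := ContMDiffAt.mfderiv (I := 𝓘(ℝ, ℝ)) (I' := 𝓘(ℝ, ℝ)) (x₀ := p) (m := ∞) (n := ∞)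
    (fun (p : TotalSpace F E) (s : ℝ) => f ⟨p.proj, p.2 + s • e p.proj⟩) (fun _ => (0 : ℝ))
    (contMDiff_along EB F e f (p, 0)) contMDiffAt_const (by simp)
  have h2 : ContMDiffAt (𝓘(ℝ, EB).prod 𝓘(ℝ, F)) 𝓘(ℝ, ℝ →L[ℝ] ℝ) ∞
      (fun p : TotalSpace F E => fderiv ℝ (fun s : ℝ => f ⟨p.proj, p.2 + s • e p.proj⟩) 0) p := by
    refine this.congr_of_eventuallyEq (Filter.Eventually.of_forall fun x => ?_)
    simp only [← mfderiv_eq_fderiv]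
    exact (congrFun (inTangentCoordinates_model_space (I := 𝓘(ℝ, ℝ)) (I' := 𝓘(ℝ, ℝ))
      (fun _ : TotalSpace F E => (0 : ℝ))
      (fun x : TotalSpace F E => f ⟨x.proj, x.2 + (0 : ℝ) • e x.proj⟩)
      (fun x => mfderiv 𝓘(ℝ, ℝ) 𝓘(ℝ, ℝ) (fun s : ℝ => f ⟨x.proj, x.2 + s • e x.proj⟩) 0)
      p) x).symm
  exact h2.clm_apply (contMDiffAt_const (c := (1 : ℝ)))

/-- The vertical lift `e↑` of a section `e` of `E`, as a derivation of `C^∞(E)`: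
`(e↑ f)(p)` is the derivative at `s = 0` of `f (p + s e)`. -/
noncomputable def verticalLift (e : Cₛ^∞⟮𝓘(ℝ, EB); F, E⟯) :
    Derivation ℝ (SmoothFun EB F E) (SmoothFun EB F E) :=
  Derivation.mk'
    { toFun := fun f =>
        ⟨fun p => deriv (fun s : ℝ => f ⟨p.proj, p.2 + s • e p.proj⟩) 0,
          contMDiff_deriv_along EB F e f⟩
      map_add' := fun f g => by
        ext p
        exact deriv_fun_add (differentiable_along EB F e f p 0) (differentiable_along EB F e g p 0)
      map_smul' := fun c f => by
        ext p
        exact deriv_fun_const_smul c (differentiable_along EB F e f p 0) }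
    (fun f g => by
      ext p
      have := deriv_fun_mul (differentiable_along EB F e f p 0)
        (differentiable_along EB F e g p 0)
      simp only [zero_smul, add_zero] at this
      change deriv (fun s : ℝ => f ⟨p.proj, p.2 + s • e p.proj⟩ *
        g ⟨p.proj, p.2 + s • e p.proj⟩) 0 = f p * deriv _ 0 + g p * deriv _ 0
      rw [this]
      ring)

/-- The fibres of the dual bundle `E^*`. -/
abbrev Dual {M : Type*} (E : M → Type*) [∀ x, AddCommGroup (E x)] [∀ x, Module ℝ (E x)]
    [∀ x, TopologicalSpace (E x)] (x : M) : Type _ :=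
  E x →L[ℝ] Trivial M ℝ x

/-- The fibrewise linear function `ℓ_e` on `E^*` determined by a section `e` of `E`. -/
noncomputable def linFun (e : Cₛ^∞⟮𝓘(ℝ, EB); F, E⟯) : SmoothFun EB (F →L[ℝ] ℝ) (Dual E) :=
  ⟨fun φ => φ.2 (e φ.proj), by
    have h : ContMDiff (𝓘(ℝ, EB).prod 𝓘(ℝ, F →L[ℝ] ℝ)) (𝓘(ℝ, EB).prod 𝓘(ℝ, ℝ)) ∞
        (fun φ : TotalSpace (F →L[ℝ] ℝ) (Dual E) =>
          TotalSpace.mk' ℝ (E := Trivial M ℝ) φ.proj (φ.2 (e φ.proj))) :=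
      ContMDiff.clm_bundle_apply (F₁ := F) (F₂ := ℝ) (E₁ := E) (E₂ := Trivial M ℝ)
        (b := fun φ : TotalSpace (F →L[ℝ] ℝ) (Dual E) => φ.proj) (ϕ := fun φ => φ.2)
        (v := fun φ => e φ.proj) contMDiff_id (e.contMDiff.comp (contMDiff_proj (Dual E)))
    exact fun x => (contMDiffAt_totalSpace.1 (h x)).2⟩

variable (E) in
/-- The algebra of scalar differential operators on the total space of `E`. -/
noncomputable abbrev DO : Subalgebra ℝ (Module.End ℝ (SmoothFun EB F E)) := diffOps (SmoothFun EB F E)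

variable (E) in
/-- The algebra of core differential operators on the total space of `E`. -/
noncomputable abbrev DOcore : Subalgebra ℝ (Module.End ℝ (SmoothFun EB F E)) := coreDO (scaleHom EB F E)

variable (E) in
/-- The Lie algebra of fibre-wise linear differential operators on the total space of `E`. -/
noncomputable abbrev DOlin : LieSubalgebra ℝ (Module.End ℝ (SmoothFun EB F E)) := linDO (scaleHom EB F E)

variable (E) in
/-- The algebra of fibre-wise polynomial functions on the dual bundle `E^*`. -/
noncomputable abbrev PolyFunDual : Subalgebra ℝ (SmoothFun EB (F →L[ℝ] ℝ) (Dual E)) :=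
  polyFun (scaleHom EB (F →L[ℝ] ℝ) (Dual E))

variable (E) in
/-- The Lie algebra of fibre-wise polynomial vector fields on the dual bundle `E^*`. -/
noncomputable abbrev PolyVFDual : LieSubalgebra ℝ
    (Derivation ℝ (SmoothFun EB (F →L[ℝ] ℝ) (Dual E)) (SmoothFun EB (F →L[ℝ] ℝ) (Dual E))) :=
  polyVF (scaleHom EB (F →L[ℝ] ℝ) (Dual E))

variable (E) in
/-- A smooth function on `M`, as a core operator on `E` (of order zero). -/
noncomputable def coreFun (f : C^∞⟮𝓘(ℝ, EB), M; 𝓘(ℝ, ℝ), ℝ⟯) : DOcore EB F E :=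
  ⟨mulOp (corePull EB F E f), IsCore.of_order 0
    ⟨mulOp_mem_order _, ⟨fun t ht => by
      ext g p
      change f p.proj * g ⟨p.proj, t⁻¹ • t • p.2⟩ = t ^ (-((0 : ℕ) : ℤ)) * (f p.proj * g p)
      rw [inv_smul_smul₀ ht]
      simp⟩⟩⟩

/-- The vertical lift of a section of `E`, as a core operator on `E` (of order one). -/
noncomputable def coreField (e : Cₛ^∞⟮𝓘(ℝ, EB); F, E⟯) : DOcore EB F E :=
  ⟨(verticalLift EB F e).toLinearMap,
    IsCore.of_order 1
    ⟨fun f => by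
      have : ⁅(verticalLift EB F e).toLinearMap, mulOp f⁆ = mulOp (verticalLift EB F e f) := by
        ext1 g
        change verticalLift EB F e (f * g) - f * verticalLift EB F e g = verticalLift EB F e f * g
        rw [Derivation.leibniz, smul_eq_mul, smul_eq_mul]
        ring
      rw [this]
      exact mulOp_mem_order _, ⟨fun t ht => by
      ext g p
      change deriv (fun s : ℝ => g ⟨p.proj, t⁻¹ • (t • p.2 + s • e p.proj)⟩) 0 =
        t ^ (-((1 : ℕ) : ℤ)) * deriv (fun s : ℝ => g ⟨p.proj, p.2 + s • e p.proj⟩) 0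
      have h1 : (fun s : ℝ => g ⟨p.proj, t⁻¹ • (t • p.2 + s • e p.proj)⟩) =
          fun s : ℝ => (fun s : ℝ => g ⟨p.proj, p.2 + s • e p.proj⟩) (t⁻¹ * s) := by
        funext s
        simp only [smul_add, inv_smul_smul₀ ht, mul_smul]
      rw [h1]
      refine (deriv_comp_mul_left t⁻¹ (fun s : ℝ => g ⟨p.proj, p.2 + s • e p.proj⟩) 0).trans ?_
      simp⟩⟩⟩

variable (E) in
/-- The pull-back of a smooth function on `M` to `E^*`, as a polynomial function. -/
noncomputable def polyPull (f : C^∞⟮𝓘(ℝ, EB), M; 𝓘(ℝ, ℝ), ℝ⟯) :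
    PolyFunDual EB F E :=
  ⟨corePull EB (F →L[ℝ] ℝ) (Dual E) f,
    Submodule.mem_iSup_of_mem (p := funDegree (scaleHom EB (F →L[ℝ] ℝ) (Dual E))) 0 fun t => by
      ext φ
      change f φ.proj = t ^ 0 * f φ.proj
      simp⟩

/-- The fibrewise linear function `ℓ_e` on `E^*`, as a polynomial function. -/
noncomputable def polyLin (e : Cₛ^∞⟮𝓘(ℝ, EB); F, E⟯) :
    PolyFunDual EB F E :=
  ⟨linFun EB F e,
    Submodule.mem_iSup_of_mem (p := funDegree (scaleHom EB (F →L[ℝ] ℝ) (Dual E))) 1 fun t => by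
      ext φ
      change t • φ.2 (e φ.proj) = t ^ 1 * φ.2 (e φ.proj)
      rw [pow_one]
      rfl⟩

end Geometry

end FWL

set_option linter.unusedSectionVars false

namespace FWL

section AbstractAlgebra

attribute [local instance] LieRing.ofAssociativeRing

variable {A : Type*} [CommRing A] [Algebra ℝ A]

/-! ### Differential operators on a commutative algebra -/

/-! The algebraic half of the theorem uses the functions on `E` only through `IsFibrewise`:
functions of fibre degree 0 and 1 detect derivations, negative degrees do not occur, and core
operators recognise the functions of degree 0 and the sums of functions of degrees 0 and 1. The
order of a differential operator can then be tested on commutators with functions of degree 0 and 1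
(`IsFibrewise.mem_order_succ`), and an operator of order q and degree below -q is zero
(`IsFibrewise.eq_zero_of_degree`). Two core operators of orders q and r have a commutator of order q
+ r - 1 and degree -(q + r), so they commute.

For stabilizer and centralizer the obstacle is that a general differential operator is not a finite
sum of homogeneous ones. But a central (stable) operator of order q is annihilated by a finite
product `killer` of factors `pull h 2 - 2 ^ m`, with m from 0 (from 1) down to -q: commutators with
functions of degree 1 lower the order and remain central (stable), and the only part they miss is
the value at 1, whose degree is 0 (at most 1). Hence such an operator splits into eigenvectors of
`pull h 2`. The same induction shows that each eigenvector is homogeneous for all t and that its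
order is bounded by its degree in the required way.

The isomorphism Φ is a symbol: on order q it sends G to the function φ ↦ G(l^q)(0) / q!, where l is
any function of degree 1 that restricts to φ on the fibre (`symbolValue`). Multiplicativity is the
formula for G(l^(q+m)) in `coreOrder_apply_pow`, injectivity is polarization
(`eq_zero_of_forall_apply_pow`), and surjectivity is Euler's identity on the dual bundle combined
with a partition of unity (`symbolMap_surjective`). Φ is unique because Euler's identity determines
a character of polynomial functions from its values on base functions and fibre coordinates.

A derivation of the polynomial functions extends to exactly one vector field, which gives `ad`; its
kernel is the centralizer of the core operators. For surjectivity, let D be the derivation of the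
core algebra that corresponds to a polynomial vector field. In coordinates x, u with frame
derivations T dual to u and base derivations H dual to x, the operator Σ D(x_j) H_j - Σ u_a D(T_a)
induces D (`DualCoordinates.innerOp`), and these local operators are patched together. The result is
a finite sum of homogeneous operators only if the orders are uniformly bounded. This is
`exists_degree_bound`: if the vector field produced unbounded fibre degrees from functions of one
fixed degree, a locally finite sum of such functions would be mapped to a non-polynomial function.
-/

theorem mulOp_apply (f g : A) : mulOp f g = f * g := rfl

theorem lie_mulOp_apply (Δ : Module.End ℝ A) (f g : A) :
    ⁅Δ, mulOp f⁆ g = Δ (f * g) - f * Δ g := rfl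

theorem eq_mulOp_of_mem_order_zero {Δ : Module.End ℝ A} (h : Δ ∈ order A 0) :
    Δ = mulOp (Δ 1) := by
  ext f
  have := LinearMap.congr_fun (h f) 1
  rw [lie_mulOp_apply, mul_one, LinearMap.zero_apply, sub_eq_zero] at this
  rw [mulOp_apply, this, mul_comm]

/-- Jacobi identity and commuting multiplications. This symmetry lets a hypothesis about commutators
with special functions f pass from Δ to its commutator with an arbitrary g. -/
theorem lie_lie_mulOp_comm (Δ : Module.End ℝ A) (f g : A) :
    ⁅⁅Δ, mulOp f⁆, mulOp g⁆ = ⁅⁅Δ, mulOp g⁆, mulOp f⁆ := by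
  rw [lie_lie, mulOp_lie, lie_zero, zero_sub, ← lie_skew, neg_neg]

theorem derivation_mem_order (X : Derivation ℝ A A) : (X : A →ₗ[ℝ] A) ∈ order A 1 := fun f => by
  have : ⁅(X : Module.End ℝ A), mulOp f⁆ = mulOp (X f) := by
    ext g
    rw [lie_mulOp_apply, mulOp_apply]
    simp only [Derivation.coeFn_coe, Derivation.leibniz, smul_eq_mul]
    ring
  rw [this]
  exact mulOp_mem_order _

/-- An operator of order one defines a derivation after subtracting its value at `1`. -/
def symbolDerivation (Δ : Module.End ℝ A) (hΔ : Δ ∈ order A 1) : Derivation ℝ A A :=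
  Derivation.mk' (Δ - mulOp (Δ 1)) fun f g => by
    have := LinearMap.congr_fun (eq_mulOp_of_mem_order_zero (hΔ f)) g
    rw [mulOp_apply, lie_mulOp_apply, lie_mulOp_apply, mul_one] at this
    simp only [LinearMap.sub_apply, mulOp_apply, smul_eq_mul]
    linear_combination this

/-! ### Homogeneous operators -/

variable (h : ℝ →* (A →ₐ[ℝ] A))

theorem scale_inv_scale {t : ℝ} (ht : t ≠ 0) (g : A) : h t⁻¹ (h t g) = g := by
  rw [← AlgHom.mul_apply, ← map_mul, inv_mul_cancel₀ ht, map_one, AlgHom.one_apply]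

theorem scale_scale_inv {t : ℝ} (ht : t ≠ 0) (g : A) : h t (h t⁻¹ g) = g := by
  rw [← AlgHom.mul_apply, ← map_mul, mul_inv_cancel₀ ht, map_one, AlgHom.one_apply]

/-- The pull-back of operators along `h t`, as a linear map. -/
noncomputable def pull (t : ℝ) : Module.End ℝ (Module.End ℝ A) where
  toFun := pullOp h t
  map_add' _ _ := by ext; simp [pullOp]
  map_smul' _ _ := by ext; simp [pullOp]

theorem pull_apply_apply (t : ℝ) (Δ : Module.End ℝ A) (g : A) :
    pull h t Δ g = h t (Δ (h t⁻¹ g)) := rfl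

theorem pull_mul {t : ℝ} (ht : t ≠ 0) (Δ Δ' : Module.End ℝ A) :
    pull h t (Δ * Δ') = pull h t Δ * pull h t Δ' := pullOp_mul h ht Δ Δ'

theorem pull_lie {t : ℝ} (ht : t ≠ 0) (Δ Δ' : Module.End ℝ A) :
    pull h t ⁅Δ, Δ'⁆ = ⁅pull h t Δ, pull h t Δ'⁆ := by
  rw [Ring.lie_def, Ring.lie_def, map_sub, pull_mul h ht, pull_mul h ht]

theorem pull_mulOp {t : ℝ} (ht : t ≠ 0) (f : A) : pull h t (mulOp f) = mulOp (h t f) := by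
  ext g
  rw [pull_apply_apply, mulOp_apply, mulOp_apply, map_mul, scale_scale_inv h ht]

theorem pull_apply_one (t : ℝ) (Δ : Module.End ℝ A) : pull h t Δ 1 = h t (Δ 1) := by
  rw [pull_apply_apply, map_one]

theorem pull_pull_inv {t : ℝ} (ht : t ≠ 0) (Δ : Module.End ℝ A) :
    pull h t (pull h t⁻¹ Δ) = Δ := by
  ext g
  rw [pull_apply_apply, pull_apply_apply, inv_inv, scale_scale_inv h ht, scale_scale_inv h ht]

theorem pull_mem_order {t : ℝ} (ht : t ≠ 0) {q : ℕ} {Δ : Module.End ℝ A} (hΔ : Δ ∈ order A q) :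
    pull h t Δ ∈ order A q := by
  have key : ∀ (Δ : Module.End ℝ A) (f : A),
      ⁅pull h t Δ, mulOp f⁆ = pull h t ⁅Δ, mulOp (h t⁻¹ f)⁆ := fun Δ f => by
    rw [pull_lie h ht, pull_mulOp h ht, scale_scale_inv h ht]
  induction q generalizing Δ with
  | zero => intro f; rw [key, hΔ, map_zero]
  | succ q ih => intro f; rw [key]; exact ih (hΔ _)

theorem mem_opDegree {k : ℤ} {Δ : Module.End ℝ A} :
    Δ ∈ opDegree h k ↔ ∀ t : ℝ, t ≠ 0 → pull h t Δ = t ^ k • Δ :=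
  ⟨fun H => H.1, fun H => ⟨H⟩⟩

theorem scale_apply_of_mem_opDegree {k m : ℤ} {Δ : Module.End ℝ A} (hΔ : Δ ∈ opDegree h k) {f : A}
    {t : ℝ} (ht : t ≠ 0) (hf : h t f = t ^ m • f) : h t (Δ f) = t ^ (k + m) • Δ f := by
  have h1 := LinearMap.congr_fun ((mem_opDegree h).1 hΔ t ht) (h t f)
  rw [pull_apply_apply, scale_inv_scale h ht, LinearMap.smul_apply] at h1
  rw [h1, hf, map_smul, smul_smul, zpow_add₀ ht]

theorem mulOp_mem_opDegree {k : ℕ} {f : A} (hf : f ∈ funDegree h k) :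
    mulOp f ∈ opDegree h k := (mem_opDegree h).2 fun t ht => by
  rw [pull_mulOp h ht, hf t]
  ext g
  simp [mulOp]

theorem mulOp_mem_coreDO {f : A} (hf : f ∈ funDegree h 0) : mulOp f ∈ coreDO h :=
  IsCore.of_order 0 ⟨mulOp_mem_order f, mulOp_mem_opDegree h hf⟩

theorem mulOp_mem_linDO {f : A} (hf : f ∈ funDegree h 1) : mulOp f ∈ linDO h :=
  ⟨Submodule.mem_iSup_of_mem (p := linOrder h) 0 ⟨mulOp_mem_order f, by
    simpa using mulOp_mem_opDegree h hf⟩⟩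

theorem exists_order_of_mem_coreDO {Δ : Module.End ℝ A} (hΔ : Δ ∈ coreDO h) :
    Δ ∈ diffOps A := by
  have : (⨆ q, coreOrder h q) ≤ Subalgebra.toSubmodule (diffOps A) :=
    iSup_le fun q x hx => ⟨q, hx.1⟩
  exact this hΔ.mem

theorem exists_order_of_mem_linDO {Δ : Module.End ℝ A} (hΔ : Δ ∈ linDO h) :
    Δ ∈ diffOps A := by
  have : (⨆ q, linOrder h q) ≤ Subalgebra.toSubmodule (diffOps A) :=
    iSup_le fun q x hx => ⟨q, hx.1⟩
  exact this hΔ.mem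

/-- The properties of the algebra of functions on the total space of a vector bundle that the
description of core and fibre-wise linear operators depends on. -/
structure IsFibrewise : Prop where
  derivation_eq_zero : ∀ X : Derivation ℝ A A, (∀ f ∈ funDegree h 0, X f = 0) →
    (∀ f ∈ funDegree h 1, X f = 0) → X = 0
  eq_zero_of_neg : ∀ (k : ℤ) (f : A), k < 0 → (∀ t : ℝ, t ≠ 0 → h t f = t ^ k • f) → f = 0
  mem_funDegree : ∀ (k : ℕ) (f : A), (∀ t : ℝ, t ≠ 0 → h t f = t ^ k • f) → f ∈ funDegree h k
  mem_zero : ∀ f : A, (∀ G ∈ coreDO h, G f = G 1 * f) → f ∈ funDegree h 0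
  mem_sup : ∀ f : A, (∀ G ∈ coreDO h, G f - G 1 * f ∈ funDegree h 0) →
    f ∈ funDegree h 0 ⊔ funDegree h 1

variable {h}

/-- By induction, the commutators with arbitrary functions have order zero, so Δ has order one. Its
derivation part kills the functions of degree 0 and 1, hence is zero. -/
theorem IsFibrewise.mem_order_zero (H : IsFibrewise h) {q : ℕ} {Δ : Module.End ℝ A}
    (hΔ : Δ ∈ order A q) (h0 : ∀ f ∈ funDegree h 0, ⁅Δ, mulOp f⁆ = 0)
    (h1 : ∀ f ∈ funDegree h 1, ⁅Δ, mulOp f⁆ = 0) : Δ ∈ order A 0 := by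
  induction q generalizing Δ with
  | zero => exact hΔ
  | succ q ih =>
    have hX : Δ ∈ order A 1 := fun g => ih (hΔ g)
      (fun f hf => by rw [lie_lie_mulOp_comm, h0 f hf, zero_lie])
      (fun f hf => by rw [lie_lie_mulOp_comm, h1 f hf, zero_lie])
    have key : ∀ f : A, ⁅Δ, mulOp f⁆ = 0 → symbolDerivation Δ hX f = 0 := fun f hf => by
      have := LinearMap.congr_fun hf 1
      rw [lie_mulOp_apply, mul_one, LinearMap.zero_apply] at this
      change Δ f - Δ 1 * f = 0
      rw [mul_comm, this]
    have := H.derivation_eq_zero (symbolDerivation Δ hX) (fun f hf => key f (h0 f hf))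
      (fun f hf => key f (h1 f hf))
    have e : Δ = mulOp (Δ 1) := by
      ext f
      have := DFunLike.congr_fun this f
      exact sub_eq_zero.1 this
    rw [e]
    exact mulOp_mem_order _

/-- The bound q is only needed to know that Δ is a differential operator at all; the order is then
sharpened to n + 1 by testing on generators. -/
theorem IsFibrewise.mem_order_succ (H : IsFibrewise h) {q n : ℕ} {Δ : Module.End ℝ A}
    (hΔ : Δ ∈ order A q) (h0 : ∀ f ∈ funDegree h 0, ⁅Δ, mulOp f⁆ ∈ order A n)
    (h1 : ∀ f ∈ funDegree h 1, ⁅Δ, mulOp f⁆ ∈ order A n) : Δ ∈ order A (n + 1) := by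
  induction n generalizing Δ with
  | zero =>
    intro g
    refine H.mem_order_zero (q := q) (order_le_succ q hΔ g) (fun f hf => ?_) fun f hf => ?_
    · rw [lie_lie_mulOp_comm, h0 f hf g]
    · rw [lie_lie_mulOp_comm, h1 f hf g]
  | succ n ih =>
    intro g
    refine ih (order_le_succ q hΔ g) (fun f hf => ?_) fun f hf => ?_
    · rw [lie_lie_mulOp_comm]; exact h0 f hf g
    · rw [lie_lie_mulOp_comm]; exact h1 f hf g

/-- A commutator with a function of degree 0 or 1 lowers the order by one and raises the degree by
at most one, so the strict inequality survives the induction. What remains is multiplication by a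
function of negative degree. -/
theorem IsFibrewise.eq_zero_of_degree (H : IsFibrewise h) {q : ℕ} {k : ℤ} {Δ : Module.End ℝ A}
    (hΔ : Δ ∈ order A q) (hk : Δ ∈ opDegree h k) (hkq : k < -(q : ℤ)) : Δ = 0 := by
  have key : ∀ {k : ℤ} {Δ : Module.End ℝ A}, Δ ∈ order A 0 → Δ ∈ opDegree h k → k < 0 → Δ = 0 := by
    intro k Δ hΔ hk hk0
    rw [eq_mulOp_of_mem_order_zero hΔ, H.eq_zero_of_neg k (Δ 1) hk0]
    · ext; simp [mulOp]
    · intro t ht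
      simpa using scale_apply_of_mem_opDegree h hk (f := 1) (m := 0) ht (by simp)
  induction q generalizing k Δ with
  | zero => exact key hΔ hk (by simpa using hkq)
  | succ q ih =>
    refine key (k := k) (H.mem_order_zero hΔ (fun f hf => ?_) fun f hf => ?_) hk
      (hkq.trans_le (by omega))
    · exact ih (hΔ f) (opDegree_lie h hk (mulOp_mem_opDegree h hf)) (by push_cast at hkq ⊢; omega)
    · exact ih (hΔ f) (opDegree_lie h hk (mulOp_mem_opDegree h hf)) (by push_cast at hkq ⊢; omega)

theorem IsFibrewise.core_lie_core (H : IsFibrewise h) {G G' : Module.End ℝ A} (hG : G ∈ coreDO h)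
    (hG' : G' ∈ coreDO h) : ⁅G, G'⁆ = 0 := by
  have := iSup_bilin (W := ⊥)
    (LieModule.toEnd ℝ (Module.End ℝ A) (Module.End ℝ A)).toLinearMap
    (coreOrder h) (coreOrder h) (fun q r x hx y hy => by
      change ⁅x, y⁆ ∈ (⊥ : Submodule ℝ (Module.End ℝ A))
      rw [Submodule.mem_bot]
      obtain h0 | ⟨n, hn⟩ : (q = 0 ∧ r = 0) ∨ ∃ n, q + r = n + 1 := by
        rcases Nat.eq_zero_or_pos (q + r) with h | h
        · left; omega
        · exact Or.inr ⟨q + r - 1, by omega⟩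
      · exact lie_zero_order hx.1 hy.1 h0
      · exact H.eq_zero_of_degree (order_lie hx.1 hy.1 hn) (opDegree_lie h hx.2 hy.2) (by omega))
    hG.mem hG'.mem
  exact (Submodule.mem_bot ℝ).1 this

theorem IsFibrewise.core_mul_comm (H : IsFibrewise h) (G G' : coreDO h) : G * G' = G' * G :=
  Subtype.ext (sub_eq_zero.1 (H.core_lie_core G.2 G'.2))

/-- The component of order q sends 1 to a function of degree -q, so only the component of order zero
contributes. -/
theorem IsFibrewise.core_apply_one (H : IsFibrewise h) {G : Module.End ℝ A} (hG : G ∈ coreDO h) :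
    G 1 ∈ funDegree h 0 := by
  have : (⨆ q, coreOrder h q) ≤
      (funDegree h 0).comap (LinearMap.applyₗ (1 : A) : Module.End ℝ A →ₗ[ℝ] A) := by
    refine iSup_le fun q x hx => ?_
    change x 1 ∈ funDegree h 0
    have e : ∀ t : ℝ, t ≠ 0 → h t (x 1) = t ^ (-(q : ℤ)) • x 1 := fun t ht => by
      simpa using scale_apply_of_mem_opDegree h hx.2 (f := 1) (m := 0) ht (by simp)
    rcases Nat.eq_zero_or_pos q with rfl | hq
    · exact H.mem_funDegree 0 _ (by simpa using e)
    · rw [H.eq_zero_of_neg _ _ (by omega) e]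
      exact Submodule.zero_mem _
  exact this hG.mem

/-! ### Decomposition of operators into homogeneous components -/

variable (h) in
/-- The product of the maps `pull 2 - 2 ^ (a - k)` for `k < n`. -/
noncomputable def killer (a : ℤ) : ℕ → Module.End ℝ (Module.End ℝ A)
  | 0 => 1
  | n + 1 => killer a n * (pull h 2 - algebraMap ℝ _ ((2 : ℝ) ^ (a - n)))

theorem killer_succ (a : ℤ) (n : ℕ) (Δ : Module.End ℝ A) :
    killer h a (n + 1) Δ = killer h a n (pull h 2 Δ - (2 : ℝ) ^ (a - n) • Δ) := by
  simp [killer, Module.algebraMap_end_apply]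

theorem killer_commute (a : ℤ) (n : ℕ) :
    Commute (killer h a n) (pull h 2) := by
  induction n with
  | zero => exact Commute.one_left _
  | succ n ih =>
    exact ih.mul_left ((Commute.refl _).sub_left (Algebra.commutes _ _))

/-- The recursive definition splits off the lowest exponent; here the highest one is split off. This
is what allows the range of exponents to be enlarged upwards. -/
theorem killer_succ' (a : ℤ) (n : ℕ) (Δ : Module.End ℝ A) :
    killer h (a + 1) (n + 1) Δ = killer h a n (pull h 2 Δ - (2 : ℝ) ^ (a + 1) • Δ) := by
  induction n generalizing Δ with
  | zero => simp [killer, Module.algebraMap_end_apply]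
  | succ n ih =>
    rw [killer_succ, ih, killer_succ]
    congr 1
    rw [show a + 1 - ((n + 1 : ℕ) : ℤ) = a - n by push_cast; ring]
    simp only [map_sub, map_smul, smul_sub]
    rw [smul_comm]
    abel

theorem killer_mulOp_one (a : ℤ) (n : ℕ) {Δ : Module.End ℝ A} (hΔ : Δ 1 = 0) :
    killer h a n Δ 1 = 0 := by
  induction n generalizing Δ with
  | zero => exact hΔ
  | succ n ih =>
    rw [killer_succ]
    exact ih (by simp [pull_apply_one, hΔ])

theorem killer_mem {W : Submodule ℝ (Module.End ℝ A)} (hW : ∀ x ∈ W, pull h 2 x ∈ W) (a : ℤ) (n : ℕ)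
    {Δ : Module.End ℝ A} (hΔ : Δ ∈ W) : killer h a n Δ ∈ W := by
  induction n generalizing Δ with
  | zero => exact hΔ
  | succ n ih =>
    rw [killer_succ]
    exact ih (W.sub_mem (hW _ hΔ) (W.smul_mem _ hΔ))

/-- Multiplication by f is an eigenvector of `pull h 2` with eigenvalue 2^m, so bracketing with it
shifts every exponent by m, at the cost of a factor 2^(-m) for each of the n factors. -/
theorem killer_lie (a : ℤ) (n : ℕ) (Δ : Module.End ℝ A) (m : ℕ) {f : A} (hf : f ∈ funDegree h m) :
    ⁅killer h a n Δ, mulOp f⁆ = ((2 : ℝ) ^ m)⁻¹ ^ n • killer h (a + m) n ⁅Δ, mulOp f⁆ := by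
  have h2 : (2 : ℝ) ≠ 0 := two_ne_zero
  have e : mulOp f = ((2 : ℝ) ^ m)⁻¹ • pull h 2 (mulOp f) := by
    rw [(mem_opDegree h).1 (mulOp_mem_opDegree h hf) 2 h2, smul_smul, zpow_natCast,
      inv_mul_cancel₀ (pow_ne_zero _ h2), one_smul]
  induction n generalizing Δ with
  | zero => simp [killer]
  | succ n ih =>
    rw [killer_succ, ih, killer_succ]
    have : ⁅pull h 2 Δ - (2 : ℝ) ^ (a - n) • Δ, mulOp f⁆ =
        ((2 : ℝ) ^ m)⁻¹ • (pull h 2 ⁅Δ, mulOp f⁆ - (2 : ℝ) ^ (a + m - n) • ⁅Δ, mulOp f⁆) := by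
      rw [sub_lie, smul_lie, smul_sub]
      congr 1
      · conv_lhs => rw [e]
        rw [lie_smul, pull_lie h h2]
      · rw [smul_smul]
        congr 1
        rw [show a + m - (n : ℤ) = m + (a - n) by ring, zpow_add₀ h2, ← mul_assoc, zpow_natCast,
          inv_mul_cancel₀ (pow_ne_zero _ h2), one_mul]
    rw [this, map_smul, smul_smul, pow_succ]

theorem killer_eq_zero_of_le {a : ℤ} {n m : ℕ} (hnm : n ≤ m) {Δ : Module.End ℝ A}
    (hΔ : killer h a n Δ = 0) : killer h a m Δ = 0 := by
  induction m, hnm using Nat.le_induction with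
  | base => exact hΔ
  | succ m _ ih =>
    rw [killer_succ, map_sub, map_smul, ih, smul_zero, sub_zero]
    have := LinearMap.congr_fun (killer_commute (h := h) a m).eq Δ
    rw [Module.End.mul_apply, Module.End.mul_apply, ih, map_zero] at this
    exact this

theorem killer_succ_eq_zero {a : ℤ} {n : ℕ} {Δ : Module.End ℝ A}
    (hΔ : killer h a n Δ = 0) : killer h (a + 1) (n + 1) Δ = 0 := by
  rw [killer_succ', map_sub, map_smul, hΔ, smul_zero, sub_zero]
  have := LinearMap.congr_fun (killer_commute (h := h) a n).eq Δ
  rw [Module.End.mul_apply, Module.End.mul_apply, hΔ, map_zero] at this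
  exact this

/-- On an eigenvector each factor acts by the scalar 2^m - 2^(a-k), which is nonzero because m
exceeds all exponents a - k. -/
theorem killer_eigen (a : ℤ) (n : ℕ) {m : ℤ} {Δ : Module.End ℝ A}
    (hΔ : pull h 2 Δ = (2 : ℝ) ^ m • Δ) (ham : a < m) (h0 : killer h a n Δ = 0) : Δ = 0 := by
  induction n with
  | zero => exact h0
  | succ n ih =>
    apply ih
    rw [killer_succ, hΔ, ← sub_smul, map_smul] at h0
    refine (smul_eq_zero.1 h0).resolve_left (sub_ne_zero.2 fun e => ?_)
    have := zpow_right_injective₀ (a := (2 : ℝ)) (by norm_num) (by norm_num) e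
    omega

/-- The part of a submodule on which `pull 2` acts by `2 ^ m`. -/
noncomputable def eigenPart (h : ℝ →* (A →ₐ[ℝ] A)) (W : Submodule ℝ (Module.End ℝ A)) (m : ℤ) :
    Submodule ℝ (Module.End ℝ A) :=
  W ⊓ Module.End.eigenspace (pull h 2) ((2 : ℝ) ^ m)

theorem mem_eigenPart {W : Submodule ℝ (Module.End ℝ A)} {m : ℤ} {Δ : Module.End ℝ A} :
    Δ ∈ eigenPart h W m ↔ Δ ∈ W ∧ pull h 2 Δ = (2 : ℝ) ^ m • Δ := by
  rw [eigenPart, Submodule.mem_inf, Module.End.mem_eigenspace_iff]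

/-- The annihilating polynomial has simple roots, so Δ is a sum of eigenvectors. The components stay
in W, which makes it possible to carry along order bounds and centrality or stability. -/
theorem mem_iSup_eigenPart {W : Submodule ℝ (Module.End ℝ A)} (hW : ∀ x ∈ W, pull h 2 x ∈ W)
    (a : ℤ) (n : ℕ) {Δ : Module.End ℝ A} (hΔ : Δ ∈ W) (h0 : killer h a n Δ = 0) :
    Δ ∈ ⨆ k : ℕ, eigenPart h W (a - k) := by
  suffices Δ ∈ ⨆ k : Fin n, eigenPart h W (a - (k : ℕ)) from
    (iSup_le fun k : Fin n => le_iSup (fun k : ℕ => eigenPart h W (a - k)) k) this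
  induction n generalizing Δ with
  | zero => rw [show Δ = 0 from h0]; exact Submodule.zero_mem _
  | succ n ih =>
    rw [killer_succ] at h0
    have hy := ih (W.sub_mem (hW _ hΔ) (W.smul_mem _ hΔ)) h0
    -- On the sum of the other eigenspaces the last factor is invertible. Subtracting a preimage x
    -- of its value on Δ leaves an eigenvector for the last exponent.
    have claim : ∀ y ∈ ⨆ k : Fin n, eigenPart h W (a - (k : ℕ)),
        ∃ x ∈ ⨆ k : Fin n, eigenPart h W (a - (k : ℕ)),
          pull h 2 x - (2 : ℝ) ^ (a - n) • x = y := by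
      intro y hy
      induction hy using Submodule.iSup_induction' with
      | mem k y hy =>
        have hne : (2 : ℝ) ^ (a - (k : ℕ)) - (2 : ℝ) ^ (a - n) ≠ 0 := sub_ne_zero.2 fun e => by
          have := zpow_right_injective₀ (a := (2 : ℝ)) (by norm_num) (by norm_num) e
          have := k.2
          omega
        refine ⟨((2 : ℝ) ^ (a - (k : ℕ)) - (2 : ℝ) ^ (a - n))⁻¹ • y, Submodule.smul_mem _ _
          (Submodule.mem_iSup_of_mem k hy), ?_⟩
        rw [map_smul, (mem_eigenPart.1 hy).2, smul_smul, smul_smul, ← sub_smul,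
          mul_comm ((2 : ℝ) ^ (a - n)), ← mul_sub, inv_mul_cancel₀ hne, one_smul]
      | zero => exact ⟨0, Submodule.zero_mem _, by simp⟩
      | add y z _ _ hy hz =>
        obtain ⟨x, hx, rfl⟩ := hy
        obtain ⟨x', hx', rfl⟩ := hz
        exact ⟨x + x', Submodule.add_mem _ hx hx', by rw [map_add, smul_add]; abel⟩
    obtain ⟨x, hx, e⟩ := claim _ hy
    have hxW : x ∈ W := (iSup_le fun k : Fin n => (inf_le_left : eigenPart h W (a - (k : ℕ)) ≤ W)) hx
    have hx' : x ∈ ⨆ k : Fin (n + 1), eigenPart h W (a - (k : ℕ)) :=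
      (iSup_le fun k : Fin n =>
        le_iSup (fun k : Fin (n + 1) => eigenPart h W (a - (k : ℕ))) k.castSucc) hx
    rw [← sub_add_cancel Δ x]
    refine Submodule.add_mem _ (Submodule.mem_iSup_of_mem (Fin.last n) (mem_eigenPart.2
      ⟨W.sub_mem hΔ hxW, ?_⟩)) hx'
    rw [map_sub, Fin.val_last, smul_sub]
    linear_combination (norm := abel) -e

/-! ### Stabilizer and centralizer of the core operators -/

variable (h) in
/-- The differential operators commuting with all core operators. -/
structure IsCentral (Δ : Module.End ℝ A) : Prop where
  lie_eq_zero : ∀ G ∈ coreDO h, ⁅Δ, G⁆ = 0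

variable (h) in
/-- The differential operators whose commutators with core operators are core. -/
structure IsStable (Δ : Module.End ℝ A) : Prop where
  lie_mem : ∀ G ∈ coreDO h, ⁅Δ, G⁆ ∈ coreDO h

theorem pull_mem_coreDO {t : ℝ} (ht : t ≠ 0) {G : Module.End ℝ A} (hG : G ∈ coreDO h) :
    pull h t G ∈ coreDO h := by
  have : (⨆ q, coreOrder h q) ≤ (⨆ q, coreOrder h q).comap (pull h t) := by
    refine iSup_le fun q x hx => ?_
    rw [Submodule.mem_comap, (mem_opDegree h).1 hx.2 t ht]
    exact Submodule.smul_mem _ _ (Submodule.mem_iSup_of_mem (p := coreOrder h) q hx)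
  exact ⟨this hG.mem⟩

theorem coreDO_lie_mulOp {f : A} (hf : f ∈ funDegree h 1) {G : Module.End ℝ A}
    (hG : G ∈ coreDO h) : ⁅mulOp f, G⁆ ∈ coreDO h :=
  lin_lie_core h (mulOp_mem_linDO h hf) hG

theorem IsCentral.sub {Δ Δ' : Module.End ℝ A} (hΔ : IsCentral h Δ) (hΔ' : IsCentral h Δ') :
    IsCentral h (Δ - Δ') :=
  ⟨fun G hG => by rw [sub_lie, hΔ.1 G hG, hΔ'.1 G hG, sub_zero]⟩

theorem IsStable.sub {Δ Δ' : Module.End ℝ A} (hΔ : IsStable h Δ) (hΔ' : IsStable h Δ') :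
    IsStable h (Δ - Δ') :=
  ⟨fun G hG => by rw [sub_lie]; exact sub_mem (hΔ.1 G hG) (hΔ'.1 G hG)⟩

theorem IsCentral.smul {Δ : Module.End ℝ A} (hΔ : IsCentral h Δ) (c : ℝ) : IsCentral h (c • Δ) :=
  ⟨fun G hG => by rw [smul_lie, hΔ.1 G hG, smul_zero]⟩

theorem IsStable.smul {Δ : Module.End ℝ A} (hΔ : IsStable h Δ) (c : ℝ) : IsStable h (c • Δ) :=
  ⟨fun G hG => by rw [smul_lie]; exact Subalgebra.smul_mem _ (hΔ.1 G hG) c⟩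

theorem IsCentral.pull {Δ : Module.End ℝ A} (hΔ : IsCentral h Δ) {t : ℝ} (ht : t ≠ 0) :
    IsCentral h (pull h t Δ) :=
  ⟨fun G hG => by
    rw [← pull_pull_inv h ht G, ← pull_lie h ht,
      hΔ.1 _ (pull_mem_coreDO (inv_ne_zero ht) hG), map_zero]⟩

theorem IsStable.pull {Δ : Module.End ℝ A} (hΔ : IsStable h Δ) {t : ℝ} (ht : t ≠ 0) :
    IsStable h (pull h t Δ) :=
  ⟨fun G hG => by
    rw [← pull_pull_inv h ht G, ← pull_lie h ht]
    exact pull_mem_coreDO ht (hΔ.1 _ (pull_mem_coreDO (inv_ne_zero ht) hG))⟩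

theorem IsCentral.lie_mulOp_zero {Δ : Module.End ℝ A} (hΔ : IsCentral h Δ) {f : A}
    (hf : f ∈ funDegree h 0) : ⁅Δ, mulOp f⁆ = 0 :=
  hΔ.1 _ (mulOp_mem_coreDO h hf)

theorem IsCentral.lie_mulOp {Δ : Module.End ℝ A} (hΔ : IsCentral h Δ) {f : A}
    (hf : f ∈ funDegree h 1) : IsCentral h ⁅Δ, mulOp f⁆ :=
  ⟨fun G hG => by
    rw [lie_lie, hΔ.1 _ hG, lie_zero, sub_zero, hΔ.1 _ (coreDO_lie_mulOp hf hG)]⟩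

/-- Multiplication by a function of degree 1 is itself fibrewise linear, hence stabilizes the core
operators; the Jacobi identity does the rest. This drives all inductions on the order below. -/
theorem IsStable.lie_mulOp {Δ : Module.End ℝ A} (hΔ : IsStable h Δ) {f : A}
    (hf : f ∈ funDegree h 1) : IsStable h ⁅Δ, mulOp f⁆ :=
  ⟨fun G hG => by
    rw [lie_lie]
    exact sub_mem (hΔ.1 _ (coreDO_lie_mulOp hf hG)) (coreDO_lie_mulOp hf (hΔ.1 _ hG))⟩

theorem isStable_of_mem_linDO {Δ : Module.End ℝ A} (hΔ : Δ ∈ linDO h) : IsStable h Δ :=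
  ⟨fun _ hG => lin_lie_core h hΔ hG⟩

theorem disjoint_funDegree {f : A} (h0 : f ∈ funDegree h 0) (h1 : f ∈ funDegree h 1) : f = 0 := by
  have := (h0 2).symm.trans (h1 2)
  rw [← sub_eq_zero, ← sub_smul] at this
  exact (smul_eq_zero.1 this).resolve_left (by norm_num)

/-- Comparing the two components under t = 2 shows that f is zero, or of degree 0 with m = 0, or of
degree 1 with m = 1. One scaling factor thus determines all of them. -/
theorem scale_eq_of_mem_sup {f : A} (hf : f ∈ funDegree h 0 ⊔ funDegree h 1) {m : ℤ}
    (h2 : h 2 f = (2 : ℝ) ^ m • f) (t : ℝ) : h t f = t ^ m • f := by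
  obtain ⟨b, hb, l, hl, rfl⟩ := Submodule.mem_sup.1 hf
  rw [map_add, hb 2, hl 2, pow_zero, pow_one, one_smul, smul_add] at h2
  have e : (1 - (2 : ℝ) ^ m) • b = ((2 : ℝ) ^ m - 2) • l := by
    rw [sub_smul, sub_smul, one_smul]
    linear_combination (norm := abel) h2
  have hz : (1 - (2 : ℝ) ^ m) • b = 0 :=
    disjoint_funDegree (Submodule.smul_mem _ _ hb) (e ▸ Submodule.smul_mem _ _ hl)
  have inj : ∀ n : ℤ, (2 : ℝ) ^ m = (2 : ℝ) ^ n → m = n := fun n e =>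
    zpow_right_injective₀ (a := (2 : ℝ)) (by norm_num) (by norm_num) e
  rw [map_add, hb t, hl t]
  rcases smul_eq_zero.1 hz with h' | rfl <;> rcases smul_eq_zero.1 (e ▸ hz) with h'' | rfl
  · linarith
  · obtain rfl := inj 0 (by rw [zpow_zero]; linarith)
    simp
  · obtain rfl := inj 1 (by rw [zpow_one]; linarith)
    simp
  · simp

namespace IsFibrewise

variable (H : IsFibrewise h)

include H

theorem isCentral_of_mem_coreDO {Δ : Module.End ℝ A} (hΔ : Δ ∈ coreDO h) : IsCentral h Δ :=
  ⟨fun _ hG => H.core_lie_core hΔ hG⟩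

/-- Both G(Δ 1) and G 1 · Δ 1 equal Δ(G 1): the first since Δ commutes with G, the second since G 1
has degree zero and so its multiplication is a core operator. -/
theorem apply_one_of_isCentral {Δ : Module.End ℝ A} (hΔ : IsCentral h Δ) :
    Δ 1 ∈ funDegree h 0 := by
  refine H.mem_zero _ fun G hG => ?_
  have h1 := LinearMap.congr_fun (hΔ.1 G hG) 1
  have h2 := LinearMap.congr_fun (hΔ.lie_mulOp_zero (H.core_apply_one hG)) 1
  rw [lie_mulOp_apply, mul_one, LinearMap.zero_apply, sub_eq_zero] at h2
  rw [Ring.lie_def, LinearMap.sub_apply, Module.End.mul_apply, Module.End.mul_apply,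
    LinearMap.zero_apply, sub_eq_zero] at h1
  rw [← h1, h2]

theorem apply_one_of_isStable {Δ : Module.End ℝ A} (hΔ : IsStable h Δ) :
    Δ 1 ∈ funDegree h 0 ⊔ funDegree h 1 := by
  refine H.mem_sup _ fun G hG => ?_
  have h1 := H.core_apply_one (hΔ.1 G hG)
  have h2 := H.core_apply_one (hΔ.1 _ (mulOp_mem_coreDO h (H.core_apply_one hG)))
  rw [lie_mulOp_apply, mul_one] at h2
  rw [Ring.lie_def, LinearMap.sub_apply, Module.End.mul_apply, Module.End.mul_apply] at h1
  have := sub_mem h2 h1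
  rwa [sub_sub_sub_cancel_left] at this

/-- The possible weights of a central operator of order q are 0, -1, …, -q, whence q + 1 factors
starting at the exponent 0. -/
theorem killer_eq_zero_of_isCentral {q : ℕ} {Δ : Module.End ℝ A} (hq : Δ ∈ order A q)
    (hΔ : IsCentral h Δ) : killer h 0 (q + 1) Δ = 0 := by
  have base : ∀ f ∈ funDegree h 0, killer h 0 1 (mulOp f) = 0 := fun f hf => by
    simp [pull_mulOp h two_ne_zero, hf 2, killer]
  have hf := H.apply_one_of_isCentral hΔ
  induction q generalizing Δ with
  | zero => rw [eq_mulOp_of_mem_order_zero hq]; exact base _ hf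
  | succ q ih =>
    have hb := killer_eq_zero_of_le (show 1 ≤ q + 1 + 1 by omega) (base _ hf)
    have hc := H.isCentral_of_mem_coreDO (mulOp_mem_coreDO h hf)
    have hmem : Δ - mulOp (Δ 1) ∈ order A (q + 1) :=
      sub_mem hq (order_mono (Nat.zero_le _) (mulOp_mem_order _))
    have hcent := hΔ.sub hc
    -- By `killer_lie` its commutators with functions of degree 0 and 1 are multiples of `killer`
    -- values on commutators of lower order, which vanish. Subtracting Δ 1 beforehand makes the
    -- resulting multiplication operator zero.
    have hK : killer h 0 (q + 1 + 1) (Δ - mulOp (Δ 1)) ∈ order A 0 := by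
      refine H.mem_order_zero (q := q + 1)
        (killer_mem (fun x hx => pull_mem_order h two_ne_zero hx) _ _ hmem)
        (fun f hf => ?_) fun f hf => ?_
      · rw [killer_lie _ _ _ _ hf, hcent.lie_mulOp_zero hf, map_zero, smul_zero]
      · have h2 := hcent.lie_mulOp hf
        have := killer_succ_eq_zero (ih (hmem f) h2 (H.apply_one_of_isCentral h2))
        rw [killer_lie _ _ _ _ hf, Nat.cast_one, this, smul_zero]
    have h0 := eq_mulOp_of_mem_order_zero hK
    rw [killer_mulOp_one _ _ (by simp [mulOp_apply])] at h0
    rw [map_sub, hb, sub_zero] at h0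
    rw [h0]
    ext
    simp [mulOp]

/-- Now the weights are 1, 0, …, -q, since the value at 1 may have a part of degree 1. Commutators
with functions of degree 0 are core, hence covered by the central case; those with functions of
degree 1 are stable of lower order. -/
theorem killer_eq_zero_of_isStable {q : ℕ} {Δ : Module.End ℝ A} (hq : Δ ∈ order A q)
    (hΔ : IsStable h Δ) : killer h 1 (q + 2) Δ = 0 := by
  have base : ∀ f ∈ funDegree h 0 ⊔ funDegree h 1, killer h 1 2 (mulOp f) = 0 := fun f hf => by
    obtain ⟨b, hb, l, hl, rfl⟩ := Submodule.mem_sup.1 hf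
    have e : mulOp (b + l) = mulOp b + mulOp l := by ext; simp [mulOp, add_mul]
    have eb : (pull h 2) (mulOp b) = mulOp b := by rw [pull_mulOp h two_ne_zero, hb 2]; simp
    have el : (pull h 2) (mulOp l) = (2 : ℝ) • mulOp l := by
      rw [pull_mulOp h two_ne_zero, hl 2]; ext; simp [mulOp]
    rw [killer_succ, killer_succ, e]
    simp only [killer, Module.End.one_apply, map_add, map_sub, map_smul, eb, el]
    module
  have stab : ∀ f ∈ funDegree h 0 ⊔ funDegree h 1, IsStable h (mulOp f) := fun f hf => by
    obtain ⟨b, hb, l, hl, rfl⟩ := Submodule.mem_sup.1 hf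
    have e : mulOp (b + l) = mulOp b + mulOp l := by ext; simp [mulOp, add_mul]
    rw [e]
    exact isStable_of_mem_linDO (add_mem (coreDO_le_linDO h (mulOp_mem_coreDO h hb))
      (mulOp_mem_linDO h hl))
  have hf := H.apply_one_of_isStable hΔ
  induction q generalizing Δ with
  | zero => rw [eq_mulOp_of_mem_order_zero hq]; exact base _ hf
  | succ q ih =>
    have hb := killer_eq_zero_of_le (show 2 ≤ q + 1 + 2 by omega) (base _ hf)
    have hc := stab _ hf
    have hmem : Δ - mulOp (Δ 1) ∈ order A (q + 1) :=
      sub_mem hq (order_mono (Nat.zero_le _) (mulOp_mem_order _))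
    have hst := hΔ.sub hc
    have hK : killer h 1 (q + 1 + 2) (Δ - mulOp (Δ 1)) ∈ order A 0 := by
      refine H.mem_order_zero (q := q + 1)
        (killer_mem (fun x hx => pull_mem_order h two_ne_zero hx) _ _ hmem)
        (fun f hf => ?_) fun f hf => ?_
      · have h1 := H.isCentral_of_mem_coreDO (hst.1 _ (mulOp_mem_coreDO h hf))
        have := killer_succ_eq_zero (killer_eq_zero_of_le (show q + 1 ≤ q + 1 + 1 by omega)
          (H.killer_eq_zero_of_isCentral (hmem f) h1))
        rw [zero_add] at this
        rw [killer_lie _ _ _ _ hf, Nat.cast_zero, add_zero, this, smul_zero]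
      · have h2 := hst.lie_mulOp hf
        have := killer_succ_eq_zero (ih (hmem f) h2 (H.apply_one_of_isStable h2))
        rw [killer_lie _ _ _ _ hf, Nat.cast_one, this, smul_zero]
    have h0 := eq_mulOp_of_mem_order_zero hK
    rw [killer_mulOp_one _ _ (by simp [mulOp_apply])] at h0
    rw [map_sub, hb, sub_zero] at h0
    rw [h0]
    ext
    simp [mulOp]

/-- By induction `pull h t Δ - t ^ m • Δ` commutes with functions of degree 0 and 1, so it is
multiplication by its value at 1. That value vanishes by `scale_eq_of_mem_sup`. -/
theorem mem_opDegree_of_isStable {q : ℕ} {Δ : Module.End ℝ A} (hq : Δ ∈ order A q)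
    (hΔ : IsStable h Δ) {m : ℤ} (h2 : pull h 2 Δ = (2 : ℝ) ^ m • Δ) : Δ ∈ opDegree h m := by
  have key : ∀ {Δ : Module.End ℝ A} {m : ℤ}, IsStable h Δ → pull h 2 Δ = (2 : ℝ) ^ m • Δ →
      ∀ t : ℝ, t ≠ 0 → pull h t Δ - t ^ m • Δ ∈ order A 0 → pull h t Δ = t ^ m • Δ := by
    intro Δ m hΔ h2 t ht h0
    have e := eq_mulOp_of_mem_order_zero h0
    have h2' : h 2 (Δ 1) = (2 : ℝ) ^ m • Δ 1 := by
      rw [← pull_apply_one, h2, LinearMap.smul_apply]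
    rw [LinearMap.sub_apply, pull_apply_one, LinearMap.smul_apply,
      scale_eq_of_mem_sup (H.apply_one_of_isStable hΔ) h2', sub_self] at e
    rw [← sub_eq_zero, e]
    ext
    simp [mulOp]
  refine (mem_opDegree h).2 ?_
  induction q generalizing Δ m with
  | zero =>
    exact fun t ht => key hΔ h2 t ht
      (sub_mem (pull_mem_order h ht hq) (Submodule.smul_mem _ _ hq))
  | succ q ih =>
    have h20 : (2 : ℝ) ≠ 0 := two_ne_zero
    have main : ∀ t : ℝ, t ≠ 0 → ∀ (n : ℕ) (f : A), f ∈ funDegree h n → IsStable h ⁅Δ, mulOp f⁆ →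
        ⁅pull h t Δ - t ^ m • Δ, mulOp f⁆ = 0 := by
      intro t ht n f hf hst
      have e : ∀ s : ℝ, s ≠ 0 → pull h s (mulOp f) = s ^ n • mulOp f := fun s hs => by
        rw [(mem_opDegree h).1 (mulOp_mem_opDegree h hf) s hs, zpow_natCast]
      have h2' : pull h 2 ⁅Δ, mulOp f⁆ = (2 : ℝ) ^ (m + n) • ⁅Δ, mulOp f⁆ := by
        rw [pull_lie h h20, h2, e 2 h20, smul_lie, lie_smul, smul_smul, zpow_add₀ h20,
          zpow_natCast]
      have h3 := ih (hq f) hst h2' t ht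
      rw [pull_lie h ht, e t ht, lie_smul, zpow_add₀ ht, zpow_natCast, mul_comm, mul_smul] at h3
      rw [sub_lie, smul_lie, sub_eq_zero]
      exact smul_right_injective _ (pow_ne_zero n ht) h3
    refine fun t ht => key hΔ h2 t ht (H.mem_order_zero (q := q + 1)
      (sub_mem (pull_mem_order h ht hq) (Submodule.smul_mem _ _ hq)) (fun f hf => ?_)
      fun f hf => ?_)
    · exact main t ht 0 f hf
        (isStable_of_mem_linDO (coreDO_le_linDO h (hΔ.1 _ (mulOp_mem_coreDO h hf))))
    · exact main t ht 1 f hf (hΔ.lie_mulOp hf)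

/-- Commutators with functions of degree 1 raise the degree to -(n-1). The induction ends at n = 0,
where such a commutator would be central of degree 1; this is larger than every admissible weight,
so it is zero. -/
theorem order_of_isCentral {q : ℕ} {Δ : Module.End ℝ A} (hq : Δ ∈ order A q)
    (hΔ : IsCentral h Δ) {n : ℕ} (hn : Δ ∈ opDegree h (-(n : ℤ))) : Δ ∈ order A n := by
  induction n generalizing Δ with
  | zero =>
    refine H.mem_order_zero hq (fun f hf => hΔ.lie_mulOp_zero hf) fun f hf => ?_
    have h2 := (mem_opDegree h).1 (opDegree_lie h hn (mulOp_mem_opDegree h hf)) 2 two_ne_zero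
    exact killer_eigen 0 _ h2 (by simp) (H.killer_eq_zero_of_isCentral
      (order_le_succ q hq f) (hΔ.lie_mulOp hf))
  | succ n ih =>
    refine H.mem_order_succ hq (fun f hf => ?_) fun f hf => ?_
    · rw [hΔ.lie_mulOp_zero hf]; exact Submodule.zero_mem _
    · refine ih (order_le_succ q hq f) (hΔ.lie_mulOp hf) ?_
      have := opDegree_lie h hn (mulOp_mem_opDegree h hf)
      rwa [show -((n + 1 : ℕ) : ℤ) + (1 : ℕ) = -(n : ℤ) by push_cast; ring] at this

theorem order_of_isStable {q : ℕ} {Δ : Module.End ℝ A} (hq : Δ ∈ order A q)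
    (hΔ : IsStable h Δ) {n : ℕ} (hn : Δ ∈ opDegree h (1 - (n : ℤ))) : Δ ∈ order A n := by
  induction n generalizing Δ with
  | zero =>
    refine H.mem_order_zero hq (fun f hf => ?_) fun f hf => ?_
    · have h2 := (mem_opDegree h).1 (opDegree_lie h hn (mulOp_mem_opDegree h hf)) 2 two_ne_zero
      exact killer_eigen 0 _ h2 (by simp) (H.killer_eq_zero_of_isCentral
        (order_le_succ q hq f) (H.isCentral_of_mem_coreDO (hΔ.1 _ (mulOp_mem_coreDO h hf))))
    · have h2 := (mem_opDegree h).1 (opDegree_lie h hn (mulOp_mem_opDegree h hf)) 2 two_ne_zero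
      exact killer_eigen 1 _ h2 (by simp) (H.killer_eq_zero_of_isStable
        (order_le_succ q hq f) (hΔ.lie_mulOp hf))
  | succ n ih =>
    refine H.mem_order_succ hq (fun f hf => ?_) fun f hf => ?_
    · refine H.order_of_isCentral (order_le_succ q hq f)
        (H.isCentral_of_mem_coreDO (hΔ.1 _ (mulOp_mem_coreDO h hf))) ?_
      have := opDegree_lie h hn (mulOp_mem_opDegree h hf)
      rwa [show 1 - ((n + 1 : ℕ) : ℤ) + (0 : ℕ) = -(n : ℤ) by push_cast; ring] at this
    · refine ih (order_le_succ q hq f) (hΔ.lie_mulOp hf) ?_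
      have := opDegree_lie h hn (mulOp_mem_opDegree h hf)
      rwa [show 1 - ((n + 1 : ℕ) : ℤ) + (1 : ℕ) = 1 - (n : ℤ) by push_cast; ring] at this

/-- The core operators are their own centralizer. -/
theorem mem_coreDO_iff (Δ : Module.End ℝ A) :
    Δ ∈ coreDO h ↔ Δ ∈ diffOps A ∧ ∀ G ∈ coreDO h, ⁅Δ, G⁆ = 0 := by
  refine ⟨fun hΔ => ⟨exists_order_of_mem_coreDO h hΔ, fun G hG => H.core_lie_core hΔ hG⟩, ?_⟩
  rintro ⟨⟨q, hq⟩, hΔ⟩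
  -- Order at most q and centrality are both invariant under `pull h 2`, so the eigencomponents
  -- inherit them. Each component is then homogeneous, of order at most the negative of its degree.
  let W : Submodule ℝ (Module.End ℝ A) :=
    { carrier := {Δ | Δ ∈ order A q ∧ IsCentral h Δ}
      zero_mem' := ⟨Submodule.zero_mem _, ⟨fun G _ => zero_lie G⟩⟩
      add_mem' := fun ha hb => ⟨add_mem ha.1 hb.1, by
        simpa using ha.2.sub (hb.2.smul (-1))⟩
      smul_mem' := fun c x hx => ⟨Submodule.smul_mem _ _ hx.1, hx.2.smul c⟩ }
  have := mem_iSup_eigenPart (W := W)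
    (fun x hx => ⟨pull_mem_order h two_ne_zero hx.1, hx.2.pull two_ne_zero⟩) 0 (q + 1)
    ⟨hq, ⟨hΔ⟩⟩ (H.killer_eq_zero_of_isCentral hq ⟨hΔ⟩)
  have hle : (⨆ k : ℕ, eigenPart h W (0 - k)) ≤ ⨆ k, coreOrder h k := by
    refine iSup_mono fun k x hx => ?_
    obtain ⟨⟨h1, h2⟩, h3⟩ := mem_eigenPart.1 hx
    have hd := H.mem_opDegree_of_isStable h1
      ⟨fun G hG => by rw [h2.1 G hG]; exact zero_mem _⟩ h3
    rw [zero_sub] at hd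
    exact ⟨H.order_of_isCentral h1 h2 hd, hd⟩
  exact ⟨hle this⟩

/-- The fibre-wise linear operators are the stabilizer of the core operators. -/
theorem mem_linDO_iff (Δ : Module.End ℝ A) :
    Δ ∈ linDO h ↔ Δ ∈ diffOps A ∧ ∀ G ∈ coreDO h, ⁅Δ, G⁆ ∈ coreDO h := by
  refine ⟨fun hΔ => ⟨exists_order_of_mem_linDO h hΔ, fun G hG => lin_lie_core h hΔ hG⟩, ?_⟩
  rintro ⟨⟨q, hq⟩, hΔ⟩
  let W : Submodule ℝ (Module.End ℝ A) :=
    { carrier := {Δ | Δ ∈ order A q ∧ IsStable h Δ}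
      zero_mem' := ⟨Submodule.zero_mem _, ⟨fun G _ => by rw [zero_lie]; exact zero_mem _⟩⟩
      add_mem' := fun ha hb => ⟨add_mem ha.1 hb.1, by
        simpa using ha.2.sub (hb.2.smul (-1))⟩
      smul_mem' := fun c x hx => ⟨Submodule.smul_mem _ _ hx.1, hx.2.smul c⟩ }
  have := mem_iSup_eigenPart (W := W)
    (fun x hx => ⟨pull_mem_order h two_ne_zero hx.1, hx.2.pull two_ne_zero⟩) 1 (q + 2)
    ⟨hq, ⟨hΔ⟩⟩ (H.killer_eq_zero_of_isStable hq ⟨hΔ⟩)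
  -- The exponent 1 - k is the degree of a fibrewise linear operator of order k, so the index of the
  -- eigenpart is already the order.
  have hle : (⨆ k : ℕ, eigenPart h W (1 - k)) ≤ ⨆ k, linOrder h k := by
    refine iSup_mono fun k x hx => ?_
    obtain ⟨⟨h1, h2⟩, h3⟩ := mem_eigenPart.1 hx
    have hd := H.mem_opDegree_of_isStable h1 h2 h3
    exact ⟨H.order_of_isStable h1 h2 hd, by rwa [neg_add_eq_sub]⟩
  exact ⟨hle this⟩

end IsFibrewise

end AbstractAlgebra

/-! ### Integrals depending on parameters and Hadamard's lemma -/

section Calculus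

open MeasureTheory Metric

variable {H : Type*} [NormedAddCommGroup H] [NormedSpace ℝ H] [FiniteDimensional ℝ H]

theorem hasFDerivAt_integral_of_contDiff {φ : ℝ × H → ℝ} (hφ : ContDiff ℝ 1 φ) (z : H) :
    HasFDerivAt (fun z => ∫ t in (0 : ℝ)..1, φ (t, z))
      (∫ t in (0 : ℝ)..1, (fderiv ℝ φ (t, z)).comp (ContinuousLinearMap.inr ℝ ℝ H)) z := by
  have hc : Continuous fun p : ℝ × H => (fderiv ℝ φ p).comp (ContinuousLinearMap.inr ℝ ℝ H) :=
    (hφ.continuous_fderiv (by simp)).clm_comp continuous_const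
  have hcurve : ∀ z : H, Continuous fun t : ℝ => (t, z) := fun z => by fun_prop
  -- A constant on the compact product of the interval with a closed ball dominates the derivative.
  obtain ⟨C, hC⟩ := ((isCompact_Icc (a := (0 : ℝ)) (b := 1)).prod
    (isCompact_closedBall z 1)).exists_bound_of_continuousOn hc.continuousOn
  refine intervalIntegral.hasFDerivAt_integral_of_dominated_of_fderiv_le
    (F := fun z t => φ (t, z))
    (F' := fun z t => (fderiv ℝ φ (t, z)).comp (ContinuousLinearMap.inr ℝ ℝ H))
    (bound := fun _ => C) (ball_mem_nhds z one_pos) ?_ ?_ ?_ ?_ ?_ ?_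
  · exact Filter.Eventually.of_forall fun y =>
      (hφ.continuous.comp (hcurve y)).aestronglyMeasurable
  · exact (hφ.continuous.comp (hcurve z)).intervalIntegrable _ _
  · exact (hc.comp (hcurve z)).aestronglyMeasurable
  · refine Filter.Eventually.of_forall fun t ht y hy => hC (t, y) ⟨?_, ball_subset_closedBall hy⟩
    rw [Set.uIoc_of_le zero_le_one] at ht
    exact ⟨ht.1.le, ht.2⟩
  · exact intervalIntegrable_const
  · refine Filter.Eventually.of_forall fun t _ y _ => ?_
    exact ((hφ.differentiable (by simp) (t, y)).hasFDerivAt).comp y (hasFDerivAt_prodMk_right t y)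

theorem contDiff_integral_of_contDiff {φ : ℝ × H → ℝ} (hφ : ContDiff ℝ ∞ φ) :
    ContDiff ℝ ∞ fun z => ∫ t in (0 : ℝ)..1, φ (t, z) := by
  refine contDiff_infty.2 fun n => ?_
  induction n generalizing φ with
  | zero =>
    exact contDiff_zero.2 (continuous_iff_continuousAt.2 fun z =>
      (hasFDerivAt_integral_of_contDiff (hφ.of_le (by simp)) z).continuousAt)
  | succ n ih =>
    have h1 : ContDiff ℝ 1 φ := hφ.of_le (by simp)
    rw [show ((n + 1 : ℕ) : ℕ∞ω) = (n : ℕ∞ω) + 1 by push_cast; rfl,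
      contDiff_succ_iff_fderiv_apply]
    refine ⟨fun z => (hasFDerivAt_integral_of_contDiff h1 z).differentiableAt, by simp, fun w => ?_⟩
    -- The derivative of the integral in the direction w is an integral of the same kind, with this
    -- smooth integrand, so the induction hypothesis applies to it.
    have hw : ContDiff ℝ ∞ fun p : ℝ × H => fderiv ℝ φ p (0, w) :=
      (hφ.fderiv_right (m := ∞) (by simp)).clm_apply contDiff_const
    convert ih hw using 1
    ext z
    rw [(hasFDerivAt_integral_of_contDiff h1 z).fderiv]
    refine (ContinuousLinearMap.intervalIntegral_apply ?_ w).trans ?_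
    · refine Continuous.intervalIntegrable ?_ _ _
      exact ((h1.continuous_fderiv (by simp)).comp (by fun_prop)).clm_comp continuous_const
    · simp

/-- Hadamard's lemma: the coefficients of the first order expansion of a smooth function at a
point are smooth. -/
theorem exists_contDiff_expansion {f : H → ℝ} (hf : ContDiff ℝ ∞ f) (z₀ : H) :
    ∃ g : H → H → ℝ, (∀ w, ContDiff ℝ ∞ (g w)) ∧
      (∀ (ι : Type) [Fintype ι] (b : Module.Basis ι ℝ H) (z : H),
        f z = f z₀ + ∑ i, b.repr (z - z₀) i * g (b i) z) := by
  -- The mean of the directional derivative along the segment from z₀ to z; the fundamental theorem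
  -- of calculus on this segment gives the expansion.
  refine ⟨fun w z => ∫ t in (0 : ℝ)..1, fderiv ℝ f (z₀ + t • (z - z₀)) w, fun w => ?_,
    fun ι _ b z => ?_⟩
  · refine contDiff_integral_of_contDiff (φ := fun p => fderiv ℝ f (z₀ + p.1 • (p.2 - z₀)) w) ?_
    refine ((hf.fderiv_right (m := ∞) (by simp)).comp ?_).clm_apply contDiff_const
    fun_prop
  · have hd : ∀ t ∈ Set.uIcc (0 : ℝ) 1, HasDerivAt (fun t : ℝ => f (z₀ + t • (z - z₀)))
        (fderiv ℝ f (z₀ + t • (z - z₀)) (z - z₀)) t := fun t _ => by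
      have h1 : HasDerivAt (fun t : ℝ => z₀ + t • (z - z₀)) (z - z₀) t := by
        simpa using ((hasDerivAt_id t).smul_const (z - z₀)).const_add z₀
      exact ((hf.differentiable (by simp) _).hasFDerivAt).comp_hasDerivAt t h1
    have hcont : ∀ w, Continuous fun t : ℝ => fderiv ℝ f (z₀ + t • (z - z₀)) w := fun w =>
      ((hf.continuous_fderiv (by simp)).comp (by fun_prop)).clm_apply continuous_const
    have := intervalIntegral.integral_eq_sub_of_hasDerivAt hd ((hcont _).intervalIntegrable _ _)
    rw [one_smul, add_sub_cancel, zero_smul, add_zero] at this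
    rw [← sub_eq_iff_eq_add', ← this]
    conv_lhs => rw [← b.sum_repr (z - z₀)]
    have e : ∀ t : ℝ, fderiv ℝ f (z₀ + t • ∑ i, b.repr (z - z₀) i • b i)
        (∑ i, b.repr (z - z₀) i • b i) =
        ∑ i, b.repr (z - z₀) i * fderiv ℝ f (z₀ + t • (z - z₀)) (b i) := fun t => by
      rw [map_sum]
      simp only [map_smul, smul_eq_mul]
      rw [b.sum_repr]
    simp only [e]
    rw [intervalIntegral.integral_finsetSum fun i _ =>
      ((hcont (b i)).const_mul _).intervalIntegrable _ _]
    simp only [intervalIntegral.integral_const_mul]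

end Calculus

section LocalModel

variable (EB : Type*) [NormedAddCommGroup EB] [NormedSpace ℝ EB]
  {M : Type*} [TopologicalSpace M] [ChartedSpace EB M]
  (F : Type*) [NormedAddCommGroup F] [NormedSpace ℝ F]
  (E : M → Type*) [∀ x, AddCommGroup (E x)] [∀ x, Module ℝ (E x)] [∀ x, TopologicalSpace (E x)]
  [TopologicalSpace (TotalSpace F E)] [FiberBundle F E] [VectorBundle ℝ F E]

/-! ### The bundle in a chart -/

/-- The part of `M` on which both the chart and the trivialization at `x₀` are defined. -/
def chartDom (x₀ : M) : Set M :=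
  (chartAt EB x₀).source ∩ (trivializationAt F E x₀).baseSet

theorem isOpen_chartDom (x₀ : M) : IsOpen (chartDom EB F E x₀) :=
  (chartAt EB x₀).open_source.inter (trivializationAt F E x₀).open_baseSet

theorem mem_chartDom (x₀ : M) : x₀ ∈ chartDom EB F E x₀ :=
  ⟨mem_chart_source EB x₀, mem_baseSet_trivializationAt F E x₀⟩

/-- The coordinates of a point of the total space. -/
noncomputable def toModel (x₀ : M) (p : TotalSpace F E) : EB × F :=
  (extChartAt 𝓘(ℝ, EB) x₀ p.proj, (trivializationAt F E x₀ p).2)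

/-- The point of the total space with given coordinates. -/
noncomputable def ofModel (x₀ : M) (z : EB × F) : TotalSpace F E :=
  (trivializationAt F E x₀).toOpenPartialHomeomorph.symm ((extChartAt 𝓘(ℝ, EB) x₀).symm z.1, z.2)

/-- The set of coordinates of points of the total space. -/
noncomputable def modelDom (x₀ : M) : Set (EB × F) :=
  {z | z.1 ∈ (extChartAt 𝓘(ℝ, EB) x₀).target ∧
    (extChartAt 𝓘(ℝ, EB) x₀).symm z.1 ∈ (trivializationAt F E x₀).baseSet}

theorem isOpen_modelDom (x₀ : M) : IsOpen (modelDom EB F E x₀) := by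
  have h : IsOpen ((extChartAt 𝓘(ℝ, EB) x₀).target ∩
      (extChartAt 𝓘(ℝ, EB) x₀).symm ⁻¹' (trivializationAt F E x₀).baseSet) :=
    (continuousOn_extChartAt_symm x₀).isOpen_inter_preimage (isOpen_extChartAt_target x₀)
      (trivializationAt F E x₀).open_baseSet
  exact h.preimage continuous_fst

variable {EB F E}

theorem toModel_mem {x₀ : M} {p : TotalSpace F E} (hp : p.proj ∈ chartDom EB F E x₀) :
    toModel EB F E x₀ p ∈ modelDom EB F E x₀ := by
  have h1 : p.proj ∈ (extChartAt 𝓘(ℝ, EB) x₀).source := by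
    rw [extChartAt_source]; exact hp.1
  refine ⟨(extChartAt 𝓘(ℝ, EB) x₀).map_source h1, ?_⟩
  change (extChartAt 𝓘(ℝ, EB) x₀).symm (extChartAt 𝓘(ℝ, EB) x₀ p.proj) ∈ _
  rw [(extChartAt 𝓘(ℝ, EB) x₀).left_inv h1]
  exact hp.2

theorem ofModel_toModel {x₀ : M} {p : TotalSpace F E} (hp : p.proj ∈ chartDom EB F E x₀) :
    ofModel EB F E x₀ (toModel EB F E x₀ p) = p := by
  have h1 : p.proj ∈ (extChartAt 𝓘(ℝ, EB) x₀).source := by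
    rw [extChartAt_source]; exact hp.1
  have h2 : p ∈ (trivializationAt F E x₀).source := (trivializationAt F E x₀).mem_source.2 hp.2
  rw [ofModel, toModel, (extChartAt 𝓘(ℝ, EB) x₀).left_inv h1]
  rw [(trivializationAt F E x₀).mk_proj_snd h2]
  exact (trivializationAt F E x₀).left_inv h2

theorem mem_target_of_modelDom {x₀ : M} {z : EB × F} (hz : z ∈ modelDom EB F E x₀) :
    ((extChartAt 𝓘(ℝ, EB) x₀).symm z.1, z.2) ∈ (trivializationAt F E x₀).target :=
  (trivializationAt F E x₀).mem_target.2 hz.2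

theorem ofModel_proj {x₀ : M} {z : EB × F} (hz : z ∈ modelDom EB F E x₀) :
    (ofModel EB F E x₀ z).proj = (extChartAt 𝓘(ℝ, EB) x₀).symm z.1 :=
  (trivializationAt F E x₀).proj_symm_apply (mem_target_of_modelDom hz)

theorem ofModel_mem {x₀ : M} {z : EB × F} (hz : z ∈ modelDom EB F E x₀) :
    (ofModel EB F E x₀ z).proj ∈ chartDom EB F E x₀ := by
  rw [ofModel_proj hz]
  refine ⟨?_, hz.2⟩
  rw [← extChartAt_source 𝓘(ℝ, EB)]
  exact (extChartAt 𝓘(ℝ, EB) x₀).map_target hz.1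

theorem toModel_ofModel {x₀ : M} {z : EB × F} (hz : z ∈ modelDom EB F E x₀) :
    toModel EB F E x₀ (ofModel EB F E x₀ z) = z := by
  rw [toModel, ofModel_proj hz, (extChartAt 𝓘(ℝ, EB) x₀).right_inv hz.1, ofModel]
  have : trivializationAt F E x₀ ((trivializationAt F E x₀).toOpenPartialHomeomorph.symm
      ((extChartAt 𝓘(ℝ, EB) x₀).symm z.1, z.2)) = ((extChartAt 𝓘(ℝ, EB) x₀).symm z.1, z.2) :=
    (trivializationAt F E x₀).right_inv (mem_target_of_modelDom hz)
  rw [this]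

theorem toModel_mk {x₀ x : M} (hx : x ∈ chartDom EB F E x₀) (v : E x) :
    toModel EB F E x₀ ⟨x, v⟩ = (extChartAt 𝓘(ℝ, EB) x₀ x,
      (trivializationAt F E x₀).continuousLinearEquivAt ℝ x hx.2 v) := rfl

theorem modelDom_of_fst {x₀ : M} {z z' : EB × F} (hz : z ∈ modelDom EB F E x₀) (h : z'.1 = z.1) :
    z' ∈ modelDom EB F E x₀ := by
  rw [modelDom, Set.mem_ofPred_eq, h]
  exact hz

theorem ofModel_add_smul {x₀ : M} {p : TotalSpace F E} (hp : p.proj ∈ chartDom EB F E x₀)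
    (a : ℝ) (v : E p.proj) :
    (⟨p.proj, a • p.2 + v⟩ : TotalSpace F E) = ofModel EB F E x₀ ((toModel EB F E x₀ p).1,
      a • (toModel EB F E x₀ p).2 +
        (trivializationAt F E x₀).continuousLinearEquivAt ℝ p.proj hp.2 v) := by
  have := ofModel_toModel (p := (⟨p.proj, a • p.2 + v⟩ : TotalSpace F E)) (x₀ := x₀) (EB := EB) hp
  rw [toModel_mk hp, map_add, map_smul] at this
  exact this.symm

theorem ofModel_smul {x₀ : M} {z : EB × F} (hz : z ∈ modelDom EB F E x₀) (t : ℝ) :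
    ofModel EB F E x₀ (z.1, t • z.2) =
      ⟨(ofModel EB F E x₀ z).proj, t • (ofModel EB F E x₀ z).2⟩ := by
  have h := ofModel_add_smul (ofModel_mem hz) t 0
  rw [toModel_ofModel hz, map_zero, add_zero, add_zero] at h
  exact h.symm

variable [IsManifold 𝓘(ℝ, EB) ∞ M] [ContMDiffVectorBundle ∞ F E 𝓘(ℝ, EB)]

theorem contMDiffOn_toModel (x₀ : M) :
    ContMDiffOn (𝓘(ℝ, EB).prod 𝓘(ℝ, F)) 𝓘(ℝ, EB × F) ∞ (toModel EB F E x₀)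
      (TotalSpace.proj ⁻¹' chartDom EB F E x₀) := by
  have h1 : ContMDiffOn (𝓘(ℝ, EB).prod 𝓘(ℝ, F)) 𝓘(ℝ, EB) ∞
      (fun p : TotalSpace F E => extChartAt 𝓘(ℝ, EB) x₀ p.proj)
      (TotalSpace.proj ⁻¹' chartDom EB F E x₀) :=
    (contMDiffOn_extChartAt (x := x₀)).comp (contMDiffOn_proj E) fun p hp => hp.1
  have h2 : ContMDiffOn (𝓘(ℝ, EB).prod 𝓘(ℝ, F)) 𝓘(ℝ, F) ∞
      (fun p : TotalSpace F E => (trivializationAt F E x₀ p).2)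
      (TotalSpace.proj ⁻¹' chartDom EB F E x₀) :=
    contMDiffOn_snd.comp (t := Set.univ) ((trivializationAt F E x₀).contMDiffOn.mono fun p hp =>
      (trivializationAt F E x₀).mem_source.2 hp.2) fun _ _ => trivial
  exact h1.prodMk_space h2

theorem contMDiffOn_ofModel (x₀ : M) :
    ContMDiffOn 𝓘(ℝ, EB × F) (𝓘(ℝ, EB).prod 𝓘(ℝ, F)) ∞ (ofModel EB F E x₀)
      (modelDom EB F E x₀) := by
  have h1 : ContMDiffOn 𝓘(ℝ, EB × F) 𝓘(ℝ, EB) ∞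
      (fun z : EB × F => (extChartAt 𝓘(ℝ, EB) x₀).symm z.1) (modelDom EB F E x₀) :=
    (contMDiffOn_extChartAt_symm x₀).comp contDiff_fst.contMDiff.contMDiffOn fun z hz => hz.1
  exact ((trivializationAt F E x₀).contMDiffOn_symm).comp
    (h1.prodMk contDiff_snd.contMDiff.contMDiffOn) fun z hz => mem_target_of_modelDom hz

/-- A smooth function on the total space, in coordinates. -/
noncomputable def inModel (x₀ : M) (f : SmoothFun EB F E) (z : EB × F) : ℝ := f (ofModel EB F E x₀ z)

theorem contDiffOn_inModel (x₀ : M) (f : SmoothFun EB F E) :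
    ContDiffOn ℝ ∞ (inModel x₀ f) (modelDom EB F E x₀) :=
  contMDiffOn_iff_contDiffOn.1
    (f.contMDiff.comp_contMDiffOn (contMDiffOn_ofModel x₀))

theorem inModel_toModel {x₀ : M} (f : SmoothFun EB F E) {p : TotalSpace F E}
    (hp : p.proj ∈ chartDom EB F E x₀) : inModel x₀ f (toModel EB F E x₀ p) = f p := by
  rw [inModel, ofModel_toModel hp]

theorem differentiableAt_inModel {x₀ : M} (f : SmoothFun EB F E) {z : EB × F}
    (hz : z ∈ modelDom EB F E x₀) : DifferentiableAt ℝ (inModel x₀ f) z :=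
  ((contDiffOn_inModel x₀ f).contDiffAt ((isOpen_modelDom EB F E x₀).mem_nhds hz)).differentiableAt
    (by simp)

theorem continuousAt_ofModel {x₀ : M} {z : EB × F} (hz : z ∈ modelDom EB F E x₀) :
    ContinuousAt (ofModel EB F E x₀) z :=
  (contMDiffOn_ofModel x₀).continuousOn.continuousAt ((isOpen_modelDom EB F E x₀).mem_nhds hz)

theorem isOpen_proj_preimage {s : Set M} (hs : IsOpen s) :
    IsOpen ((TotalSpace.proj : TotalSpace F E → M) ⁻¹' s) :=
  hs.preimage (FiberBundle.continuous_proj F E)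

theorem continuousAt_toModel {x₀ : M} {p : TotalSpace F E} (hp : p.proj ∈ chartDom EB F E x₀) :
    ContinuousAt (toModel EB F E x₀) p :=
  (contMDiffOn_toModel x₀).continuousOn.continuousAt
    ((isOpen_proj_preimage (isOpen_chartDom EB F E x₀)).mem_nhds hp)

/-! ### Cutting off functions that are defined in a chart -/

/-- The product of a smooth function on the base with support in the domain of a chart and a
function that is smooth in this chart. -/
noncomputable def cutoff (x₀ : M) (κ : C^∞⟮𝓘(ℝ, EB), M; 𝓘(ℝ, ℝ), ℝ⟯)
    (hκ : tsupport κ ⊆ chartDom EB F E x₀) (g : EB × F → ℝ)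
    (hg : ContDiffOn ℝ ∞ g (modelDom EB F E x₀)) : SmoothFun EB F E :=
  ⟨fun p => κ p.proj * g (toModel EB F E x₀ p), by
    refine contMDiff_of_tsupport fun p hp => ?_
    have hp' : p.proj ∈ chartDom EB F E x₀ := by
      apply hκ
      -- Only the base direction is cut off. This suffices, since the chart covers entire fibres
      -- over its domain, and it keeps functions polynomial along the fibres.
      have h1 : tsupport (fun p : TotalSpace F E => κ p.proj * g (toModel EB F E x₀ p)) ⊆
          TotalSpace.proj ⁻¹' tsupport κ := by
        refine closure_minimal (fun q hq => subset_closure ?_)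
          ((isClosed_tsupport κ).preimage (FiberBundle.continuous_proj F E))
        exact left_ne_zero_of_mul hq
      exact h1 hp
    have hnhds := (isOpen_proj_preimage (F := F) (isOpen_chartDom EB F E x₀)).mem_nhds hp'
    have h1 : ContMDiffAt (𝓘(ℝ, EB).prod 𝓘(ℝ, F)) 𝓘(ℝ, ℝ) ∞
        (fun p : TotalSpace F E => κ p.proj) p :=
      (κ.contMDiff.comp (contMDiff_proj E)).contMDiffAt
    have h2 : ContMDiffAt (𝓘(ℝ, EB).prod 𝓘(ℝ, F)) 𝓘(ℝ, ℝ) ∞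
        (fun p : TotalSpace F E => g (toModel EB F E x₀ p)) p :=
      (hg.contMDiffOn.comp (contMDiffOn_toModel x₀) fun q hq => toModel_mem hq).contMDiffAt hnhds
    exact h1.mul h2⟩

theorem cutoff_apply {x₀ : M} {κ : C^∞⟮𝓘(ℝ, EB), M; 𝓘(ℝ, ℝ), ℝ⟯}
    (hκ : tsupport κ ⊆ chartDom EB F E x₀) {g : EB × F → ℝ}
    (hg : ContDiffOn ℝ ∞ g (modelDom EB F E x₀)) (p : TotalSpace F E) :
    cutoff x₀ κ hκ g hg p = κ p.proj * g (toModel EB F E x₀ p) := rfl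

theorem mem_chartDom_of_ne_zero {x₀ : M} {κ : C^∞⟮𝓘(ℝ, EB), M; 𝓘(ℝ, ℝ), ℝ⟯}
    (hκ : tsupport κ ⊆ chartDom EB F E x₀) {x : M} (hx : κ x ≠ 0) : x ∈ chartDom EB F E x₀ :=
  hκ (subset_closure hx)

theorem contDiffOn_fderiv_inModel (x₀ : M) (f : SmoothFun EB F E) (w : EB × F) :
    ContDiffOn ℝ ∞ (fun z => fderiv ℝ (inModel x₀ f) z w) (modelDom EB F E x₀) :=
  ((contDiffOn_inModel x₀ f).fderiv_of_isOpen (isOpen_modelDom EB F E x₀) (by simp)).clm_apply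
    contDiffOn_const

/-- The derivation of the algebra of smooth functions given by a cut-off directional derivative in
a chart. -/
noncomputable def coordDeriv (x₀ : M) (κ : C^∞⟮𝓘(ℝ, EB), M; 𝓘(ℝ, ℝ), ℝ⟯)
    (hκ : tsupport κ ⊆ chartDom EB F E x₀) (w : EB × F) :
    Derivation ℝ (SmoothFun EB F E) (SmoothFun EB F E) :=
  Derivation.mk'
    { toFun := fun f => cutoff x₀ κ hκ (fun z => fderiv ℝ (inModel x₀ f) z w)
        (contDiffOn_fderiv_inModel x₀ f w)
      map_add' := fun f g => by
        ext p
        change κ p.proj * fderiv ℝ (inModel x₀ f + inModel x₀ g) _ w =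
          κ p.proj * fderiv ℝ (inModel x₀ f) _ w + κ p.proj * fderiv ℝ (inModel x₀ g) _ w
        by_cases hp : κ p.proj = 0
        · simp [hp]
        · have hz := toModel_mem (mem_chartDom_of_ne_zero hκ hp)
          rw [fderiv_add (differentiableAt_inModel f hz) (differentiableAt_inModel g hz),
            add_apply, mul_add]
      map_smul' := fun c f => by
        ext p
        change κ p.proj * fderiv ℝ (c • inModel x₀ f) _ w =
          c * (κ p.proj * fderiv ℝ (inModel x₀ f) _ w)
        rw [fderiv_const_smul_field, Pi.smul_apply, smul_apply, smul_eq_mul]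
        ring }
    (fun f g => by
      ext p
      change κ p.proj * fderiv ℝ (inModel x₀ f * inModel x₀ g) _ w =
        f p * (κ p.proj * fderiv ℝ (inModel x₀ g) _ w) +
          g p * (κ p.proj * fderiv ℝ (inModel x₀ f) _ w)
      by_cases hp : κ p.proj = 0
      · simp [hp]
      · have hp' := mem_chartDom_of_ne_zero hκ hp
        have hz := toModel_mem hp'
        rw [fderiv_mul (differentiableAt_inModel f hz) (differentiableAt_inModel g hz),
          inModel_toModel f hp', inModel_toModel g hp']
        simp only [add_apply, smul_apply, smul_eq_mul]
        ring)

theorem coordDeriv_apply {x₀ : M} {κ : C^∞⟮𝓘(ℝ, EB), M; 𝓘(ℝ, ℝ), ℝ⟯}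
    (hκ : tsupport κ ⊆ chartDom EB F E x₀) (w : EB × F) (f : SmoothFun EB F E)
    (p : TotalSpace F E) : coordDeriv x₀ κ hκ w f p =
      κ p.proj * fderiv ℝ (inModel x₀ f) (toModel EB F E x₀ p) w := rfl

/-- A cut-off linear function of the coordinates. -/
noncomputable def coordFun (x₀ : M) (κ : C^∞⟮𝓘(ℝ, EB), M; 𝓘(ℝ, ℝ), ℝ⟯)
    (hκ : tsupport κ ⊆ chartDom EB F E x₀) (l : EB × F →L[ℝ] ℝ) : SmoothFun EB F E :=
  cutoff x₀ κ hκ l l.contDiff.contDiffOn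

/-- The open set on which a smooth function is locally equal to `1`. -/
def oneDom (κ : C^∞⟮𝓘(ℝ, EB), M; 𝓘(ℝ, ℝ), ℝ⟯) : Set M := interior {x | κ x = 1}

theorem isOpen_oneDom (κ : C^∞⟮𝓘(ℝ, EB), M; 𝓘(ℝ, ℝ), ℝ⟯) : IsOpen (oneDom κ) := isOpen_interior

theorem eq_one_of_mem_oneDom {κ : C^∞⟮𝓘(ℝ, EB), M; 𝓘(ℝ, ℝ), ℝ⟯} {x : M} (hx : x ∈ oneDom κ) :
    κ x = 1 := interior_subset (s := {x | κ x = 1}) hx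

theorem mem_chartDom_of_mem_oneDom {x₀ : M} {κ : C^∞⟮𝓘(ℝ, EB), M; 𝓘(ℝ, ℝ), ℝ⟯}
    (hκ : tsupport κ ⊆ chartDom EB F E x₀) {x : M} (hx : x ∈ oneDom κ) :
    x ∈ chartDom EB F E x₀ :=
  mem_chartDom_of_ne_zero hκ (by rw [eq_one_of_mem_oneDom hx]; exact one_ne_zero)

theorem coordDeriv_coordFun {x₀ : M} {κ : C^∞⟮𝓘(ℝ, EB), M; 𝓘(ℝ, ℝ), ℝ⟯}
    (hκ : tsupport κ ⊆ chartDom EB F E x₀) (w : EB × F) (l : EB × F →L[ℝ] ℝ)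
    {p : TotalSpace F E} (hp : p.proj ∈ oneDom κ) :
    coordDeriv x₀ κ hκ w (coordFun x₀ κ hκ l) p = l w := by
  have hp' := mem_chartDom_of_mem_oneDom hκ hp
  have hz := toModel_mem hp'
  have : inModel x₀ (coordFun x₀ κ hκ l) =ᶠ[nhds (toModel EB F E x₀ p)] l := by
    have h1 := (continuousAt_ofModel hz).eventually
      (((isOpen_proj_preimage (F := F) (E := E) (isOpen_oneDom κ)).mem_nhds
        (by rw [ofModel_toModel hp']; exact hp)))
    filter_upwards [h1, (isOpen_modelDom EB F E x₀).mem_nhds hz] with z hz1 hz2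
    change κ (ofModel EB F E x₀ z).proj * l (toModel EB F E x₀ (ofModel EB F E x₀ z)) = l z
    rw [toModel_ofModel hz2, eq_one_of_mem_oneDom hz1, one_mul]
  rw [coordDeriv_apply, eq_one_of_mem_oneDom hp, one_mul, this.fderiv_eq,
    ContinuousLinearMap.fderiv]

end LocalModel

/-! ### Fibre degree of functions and of coordinate derivatives -/

section LocalModel

variable {EB : Type*} [NormedAddCommGroup EB] [NormedSpace ℝ EB]
  {M : Type*} [TopologicalSpace M] [ChartedSpace EB M]
  {F : Type*} [NormedAddCommGroup F] [NormedSpace ℝ F]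
  {E : M → Type*} [∀ x, AddCommGroup (E x)] [∀ x, Module ℝ (E x)] [∀ x, TopologicalSpace (E x)]
  [TopologicalSpace (TotalSpace F E)] [FiberBundle F E] [VectorBundle ℝ F E]

theorem apply_smul_of_mem_funDegree {k : ℕ} {f : SmoothFun EB F E}
    (hf : f ∈ funDegree (scaleHom EB F E) k) (t : ℝ) (p : TotalSpace F E) :
    f ⟨p.proj, t • p.2⟩ = t ^ k * f p :=
  DFunLike.congr_fun (hf t) p

theorem mem_funDegree_iff {k : ℕ} {f : SmoothFun EB F E} :
    f ∈ funDegree (scaleHom EB F E) k ↔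
      ∀ (t : ℝ) (p : TotalSpace F E), f ⟨p.proj, t • p.2⟩ = t ^ k * f p :=
  ⟨fun hf t p => apply_smul_of_mem_funDegree hf t p, fun hf t => by ext p; exact hf t p⟩

theorem apply_eq_of_mem_funDegree_zero {f : SmoothFun EB F E}
    (hf : f ∈ funDegree (scaleHom EB F E) 0) {p q : TotalSpace F E} (h : p.proj = q.proj) :
    f p = f q := by
  have key : ∀ p : TotalSpace F E, f p = f (zeroSection F E p.proj) := fun p => by
    have := apply_smul_of_mem_funDegree hf 0 p
    rw [pow_zero, one_mul, zero_smul] at this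
    exact this.symm
  rw [key p, key q, h]

theorem apply_zero_of_mem_funDegree {k : ℕ} (hk : k ≠ 0) {f : SmoothFun EB F E}
    (hf : f ∈ funDegree (scaleHom EB F E) k) (x : M) : f (zeroSection F E x) = 0 := by
  have := apply_smul_of_mem_funDegree hf 0 (zeroSection F E x)
  rw [zero_smul, zero_pow hk, zero_mul] at this
  exact this

/-- Continuity of scalar multiplication in the fibre is obtained by transport from the model fibre
`F`. -/
theorem continuous_smul_fibre (p : TotalSpace F E) :
    Continuous fun t : ℝ => (⟨p.proj, t • p.2⟩ : TotalSpace F E) := by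
  let L := VectorBundle.continuousLinearEquivAt ℝ F E p.proj
  have h1 : Continuous fun t : ℝ => L.symm (t • L p.2) :=
    L.symm.continuous.comp (continuous_id.smul continuous_const)
  have h2 : (fun t : ℝ => (⟨p.proj, t • p.2⟩ : TotalSpace F E)) =
      fun t => TotalSpace.mk' F p.proj (L.symm (t • L p.2)) := by
    funext t
    rw [map_smul, L.symm_apply_apply]
  rw [h2]
  exact (FiberBundle.continuous_totalSpaceMk F E p.proj).comp h1

theorem tendsto_smul_fibre (f : SmoothFun EB F E) (p : TotalSpace F E) :
    Filter.Tendsto (fun t : ℝ => f ⟨p.proj, t • p.2⟩) (nhdsWithin 0 {0}ᶜ)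
      (nhds (f ⟨p.proj, (0 : ℝ) • p.2⟩)) :=
  ((f.contMDiff.continuous.comp (continuous_smul_fibre p)).tendsto 0).mono_left nhdsWithin_le_nhds

theorem mem_funDegree_of_ne_zero {k : ℕ} {f : SmoothFun EB F E}
    (hf : ∀ t : ℝ, t ≠ 0 → scaleHom EB F E t f = t ^ k • f) :
    f ∈ funDegree (scaleHom EB F E) k := by
  refine mem_funDegree_iff.2 fun t p => ?_
  rcases eq_or_ne t 0 with rfl | ht
  · refine tendsto_nhds_unique (tendsto_smul_fibre f p) ?_
    have h1 : Filter.Tendsto (fun t : ℝ => t ^ k * f p) (nhdsWithin 0 {0}ᶜ)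
        (nhds (0 ^ k * f p)) :=
      (Continuous.tendsto (by fun_prop) 0).mono_left nhdsWithin_le_nhds
    refine h1.congr' ?_
    filter_upwards [self_mem_nhdsWithin] with t ht
    exact (DFunLike.congr_fun (hf t ht) p).symm
  · exact DFunLike.congr_fun (hf t ht) p

/-- With k = -(n+1), f(p) = t^(n+1) f(t p) for all t ≠ 0, and the right-hand side tends to 0 with t
because f is continuous at the zero section. -/
theorem eq_zero_of_neg_degree {k : ℤ} {f : SmoothFun EB F E} (hk : k < 0)
    (hf : ∀ t : ℝ, t ≠ 0 → scaleHom EB F E t f = t ^ k • f) : f = 0 := by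
  obtain ⟨n, rfl⟩ : ∃ n : ℕ, k = -((n + 1 : ℕ) : ℤ) := ⟨(-k - 1).toNat, by omega⟩
  ext p
  refine tendsto_nhds_unique (f := fun _ : ℝ => f p) tendsto_const_nhds
    (l := nhdsWithin (0 : ℝ) {0}ᶜ) ?_
  have h1 : Filter.Tendsto (fun t : ℝ => t ^ (n + 1) * f ⟨p.proj, t • p.2⟩)
      (nhdsWithin 0 {0}ᶜ) (nhds (0 ^ (n + 1) * f ⟨p.proj, (0 : ℝ) • p.2⟩)) :=
    ((Continuous.tendsto (by fun_prop) 0).mono_left nhdsWithin_le_nhds).mul (tendsto_smul_fibre f p)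
  rw [zero_pow (by omega), zero_mul] at h1
  refine h1.congr' ?_
  filter_upwards [self_mem_nhdsWithin] with t ht
  have h2 : f ⟨p.proj, t • p.2⟩ = t ^ (-((n + 1 : ℕ) : ℤ)) * f p := DFunLike.congr_fun (hf t ht) p
  rw [h2, zpow_neg, zpow_natCast, mul_inv_cancel_left₀ (pow_ne_zero _ ht)]

variable [IsManifold 𝓘(ℝ, EB) ∞ M] [ContMDiffVectorBundle ∞ F E 𝓘(ℝ, EB)]

theorem inModel_smul {x₀ : M} {k : ℕ} {f : SmoothFun EB F E}
    (hf : f ∈ funDegree (scaleHom EB F E) k) {z : EB × F} (hz : z ∈ modelDom EB F E x₀) (t : ℝ) :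
    inModel x₀ f (z.1, t • z.2) = t ^ k * inModel x₀ f z := by
  rw [inModel, ofModel_smul hz, apply_smul_of_mem_funDegree hf, inModel]

/-- Differentiate the homogeneity relation. The direction is rescaled as well, which is why base
derivatives keep the degree and fibre derivatives lower it by one. -/
theorem fderiv_inModel_smul {x₀ : M} {k : ℕ} {f : SmoothFun EB F E}
    (hf : f ∈ funDegree (scaleHom EB F E) k) {z : EB × F} (hz : z ∈ modelDom EB F E x₀) (t : ℝ)
    (w : EB × F) :
    fderiv ℝ (inModel x₀ f) (z.1, t • z.2) (w.1, t • w.2) =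
      t ^ k * fderiv ℝ (inModel x₀ f) z w := by
  let m : EB × F →L[ℝ] EB × F := (ContinuousLinearMap.fst ℝ EB F).prod
    (t • ContinuousLinearMap.snd ℝ EB F)
  have hmz : m z ∈ modelDom EB F E x₀ := modelDom_of_fst hz rfl
  have h1 : HasFDerivAt (fun z => inModel x₀ f (m z)) ((fderiv ℝ (inModel x₀ f) (m z)).comp m) z :=
    (differentiableAt_inModel f hmz).hasFDerivAt.comp z m.hasFDerivAt
  have h2 : HasFDerivAt (fun z => t ^ k * inModel x₀ f z) (t ^ k • fderiv ℝ (inModel x₀ f) z) z :=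
    (differentiableAt_inModel f hz).hasFDerivAt.const_mul _
  have h3 := h1.congr_of_eventuallyEq (Filter.eventuallyEq_of_mem
    ((isOpen_modelDom EB F E x₀).mem_nhds hz) fun z hz => (inModel_smul hf hz t).symm)
  have := DFunLike.congr_fun (h3.unique h2) w
  exact this

variable {x₀ : M} {κ : C^∞⟮𝓘(ℝ, EB), M; 𝓘(ℝ, ℝ), ℝ⟯} (hκ : tsupport κ ⊆ chartDom EB F E x₀)

theorem toModel_smul {p : TotalSpace F E} (hp : p.proj ∈ chartDom EB F E x₀) (t : ℝ) :
    toModel EB F E x₀ ⟨p.proj, t • p.2⟩ =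
      ((toModel EB F E x₀ p).1, t • (toModel EB F E x₀ p).2) := by
  rw [toModel_mk hp, map_smul]
  rfl

theorem coordFun_base_mem (l : EB →L[ℝ] ℝ) :
    coordFun x₀ κ hκ (l.comp (ContinuousLinearMap.fst ℝ EB F)) ∈
      funDegree (scaleHom EB F E) 0 := by
  refine mem_funDegree_iff.2 fun t p => ?_
  change κ p.proj * l (toModel EB F E x₀ ⟨p.proj, t • p.2⟩).1 =
    t ^ 0 * (κ p.proj * l (toModel EB F E x₀ p).1)
  rw [pow_zero, one_mul]
  rfl

theorem coordFun_fibre_mem (l : F →L[ℝ] ℝ) :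
    coordFun x₀ κ hκ (l.comp (ContinuousLinearMap.snd ℝ EB F)) ∈
      funDegree (scaleHom EB F E) 1 := by
  refine mem_funDegree_iff.2 fun t p => ?_
  change κ p.proj * l (toModel EB F E x₀ ⟨p.proj, t • p.2⟩).2 =
    t ^ 1 * (κ p.proj * l (toModel EB F E x₀ p).2)
  by_cases hp : κ p.proj = 0
  · simp [hp]
  · rw [toModel_smul (mem_chartDom_of_ne_zero hκ hp), map_smul, smul_eq_mul, pow_one]
    ring

theorem coordDeriv_base_mem (w : EB) {k : ℕ} {f : SmoothFun EB F E}
    (hf : f ∈ funDegree (scaleHom EB F E) k) :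
    coordDeriv x₀ κ hκ (w, 0) f ∈ funDegree (scaleHom EB F E) k := by
  refine mem_funDegree_iff.2 fun t p => ?_
  rw [coordDeriv_apply, coordDeriv_apply]
  by_cases hp : κ p.proj = 0
  · simp [hp]
  · have hp' := mem_chartDom_of_ne_zero hκ hp
    have := fderiv_inModel_smul hf (toModel_mem hp') t (w, 0)
    rw [smul_zero] at this
    rw [toModel_smul hp', this]
    ring

/-- The differentiated homogeneity relation has to be divided by t, so it is tested for t ≠ 0 only
and extended to t = 0 by continuity. -/
theorem coordDeriv_fibre_mem (w : F) {k : ℕ} {f : SmoothFun EB F E}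
    (hf : f ∈ funDegree (scaleHom EB F E) (k + 1)) :
    coordDeriv x₀ κ hκ (0, w) f ∈ funDegree (scaleHom EB F E) k := by
  refine mem_funDegree_of_ne_zero fun t ht => ?_
  ext p
  change coordDeriv x₀ κ hκ (0, w) f ⟨p.proj, t • p.2⟩ = t ^ k * coordDeriv x₀ κ hκ (0, w) f p
  rw [coordDeriv_apply, coordDeriv_apply]
  by_cases hp : κ p.proj = 0
  · simp [hp]
  · have hp' := mem_chartDom_of_ne_zero hκ hp
    have := fderiv_inModel_smul hf (toModel_mem hp') t (0, w)
    have e : ((0, t • w) : EB × F) = t • (0, w) := by simp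
    rw [e, map_smul, smul_eq_mul, pow_succ', mul_assoc] at this
    rw [toModel_smul hp', mul_left_cancel₀ ht this]
    ring

theorem coordDeriv_fibre_zero (w : F) {f : SmoothFun EB F E}
    (hf : f ∈ funDegree (scaleHom EB F E) 0) : coordDeriv x₀ κ hκ (0, w) f = 0 := by
  ext p
  rw [coordDeriv_apply]
  by_cases hp : κ p.proj = 0
  · simp [hp]
  · have := fderiv_inModel_smul hf (toModel_mem (mem_chartDom_of_ne_zero hκ hp)) 0 (0, w)
    have e : ((0, (0 : ℝ) • w) : EB × F) = 0 := by simp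
    rw [e, map_zero, pow_zero, one_mul] at this
    rw [← this, mul_zero]
    rfl

variable [FiniteDimensional ℝ EB] [FiniteDimensional ℝ F]

include hκ in
theorem exists_bump {p : TotalSpace F E} (hp : p.proj ∈ oneDom κ) {N : Set (TotalSpace F E)}
    (hN : N ∈ nhds p) : ∃ β : SmoothFun EB F E, β p = 1 ∧ ∀ q ∉ N, β q = 0 := by
  have hp' := mem_chartDom_of_mem_oneDom hκ hp
  have h1 : ofModel EB F E x₀ ⁻¹' N ∈ nhds (toModel EB F E x₀ p) :=
    continuousAt_ofModel (toModel_mem hp') (by rwa [ofModel_toModel hp'])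
  obtain ⟨θ, hθ1, hθ2⟩ := exists_contDiff_tsupport_subset (n := (⊤ : ℕ∞)) h1
  refine ⟨cutoff x₀ κ hκ θ hθ2.2.1.contDiffOn, ?_, fun q hq => ?_⟩
  · rw [cutoff_apply, eq_one_of_mem_oneDom hp, one_mul]
    exact hθ2.2.2.2
  · rw [cutoff_apply]
    by_cases hκq : κ q.proj = 0
    · rw [hκq, zero_mul]
    · have : θ (toModel EB F E x₀ q) = 0 := by
        by_contra hne
        have := hθ1 (subset_tsupport θ hne)
        rw [Set.mem_preimage, ofModel_toModel (mem_chartDom_of_ne_zero hκ hκq)] at this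
        exact hq this
      rw [this, mul_zero]

theorem exists_expansion {ι ι' : Type} [Fintype ι] [Fintype ι'] (b : Module.Basis ι ℝ EB)
    (b' : Module.Basis ι' ℝ F) (f : SmoothFun EB F E) {p : TotalSpace F E}
    (hp : p.proj ∈ oneDom κ) :
    ∃ (g : ι → SmoothFun EB F E) (g' : ι' → SmoothFun EB F E), ∀ᶠ q in nhds p,
      f q = f p + (∑ i, (coordFun x₀ κ hκ ((b.coord i).toContinuousLinearMap.comp
          (ContinuousLinearMap.fst ℝ EB F)) q - coordFun x₀ κ hκ
          ((b.coord i).toContinuousLinearMap.comp (ContinuousLinearMap.fst ℝ EB F)) p) * g i q +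
        ∑ i, (coordFun x₀ κ hκ ((b'.coord i).toContinuousLinearMap.comp
          (ContinuousLinearMap.snd ℝ EB F)) q - coordFun x₀ κ hκ
          ((b'.coord i).toContinuousLinearMap.comp (ContinuousLinearMap.snd ℝ EB F)) p) *
            g' i q) := by
  have hp' := mem_chartDom_of_mem_oneDom hκ hp
  have hz := toModel_mem hp'
  have hnhds := (isOpen_modelDom EB F E x₀).mem_nhds hz
  obtain ⟨r, hr, hball⟩ := Metric.nhds_basis_closedBall.mem_iff.1 hnhds
  -- Multiplication by this bump extends the local expression of f to a smooth function on the whole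
  -- model space, where Hadamard's lemma is available, without changing it near p.
  let θ : ContDiffBump (toModel EB F E x₀ p) := ⟨r / 2, r, by positivity, by linarith⟩
  have hsm : ContDiff ℝ ∞ fun z => θ z * inModel x₀ f z := by
    rw [contDiff_iff_contDiffAt]
    intro z
    by_cases hzs : z ∈ tsupport θ
    · rw [θ.tsupport_eq] at hzs
      exact θ.contDiff.contDiffAt.mul ((contDiffOn_inModel x₀ f).contDiffAt
        ((isOpen_modelDom EB F E x₀).mem_nhds (hball hzs)))
    · refine (contDiffAt_const (c := (0 : ℝ))).congr_of_eventuallyEq ?_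
      filter_upwards [(isClosed_tsupport θ).isOpen_compl.mem_nhds hzs] with y hy
      rw [image_eq_zero_of_notMem_tsupport hy, zero_mul]
  obtain ⟨g, hg, hexp⟩ := exists_contDiff_expansion hsm (toModel EB F E x₀ p)
  refine ⟨fun i => cutoff x₀ κ hκ (g (b.prod b' (Sum.inl i))) (hg _).contDiffOn,
    fun i => cutoff x₀ κ hκ (g (b.prod b' (Sum.inr i))) (hg _).contDiffOn, ?_⟩
  have h1 : ∀ᶠ q in nhds p, q.proj ∈ oneDom κ :=
    (isOpen_proj_preimage (F := F) (E := E) (isOpen_oneDom κ)).mem_nhds hp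
  have h2 : ∀ᶠ q in nhds p, θ (toModel EB F E x₀ q) = 1 :=
    (continuousAt_toModel hp').eventually θ.eventuallyEq_one
  filter_upwards [h1, h2] with q hq1 hq2
  have hq' := mem_chartDom_of_mem_oneDom hκ hq1
  have := hexp _ (b.prod b') (toModel EB F E x₀ q)
  rw [hq2, θ.eventuallyEq_one.eq_of_nhds, Pi.one_apply, one_mul, one_mul,
    inModel_toModel f hq', inModel_toModel f hp', Fintype.sum_sum_type] at this
  rw [this]
  have hc : ∀ (l : EB × F →L[ℝ] ℝ) {q : TotalSpace F E}, q.proj ∈ oneDom κ →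
      coordFun x₀ κ hκ l q = l (toModel EB F E x₀ q) := fun l q hq => by
    rw [coordFun, cutoff_apply, eq_one_of_mem_oneDom hq, one_mul]
  congr 2
  · refine Finset.sum_congr rfl fun i _ => ?_
    rw [hc _ hq1, hc _ hp, ← map_sub, cutoff_apply, eq_one_of_mem_oneDom hq1, one_mul]
    simp
  · refine Finset.sum_congr rfl fun i _ => ?_
    rw [hc _ hq1, hc _ hp, ← map_sub, cutoff_apply, eq_one_of_mem_oneDom hq1, one_mul]
    simp

end LocalModel

section Coordinates

variable (EB : Type*) [NormedAddCommGroup EB] [NormedSpace ℝ EB]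
  {M : Type*} [TopologicalSpace M] [ChartedSpace EB M]
  (F : Type*) [NormedAddCommGroup F] [NormedSpace ℝ F]
  (E : M → Type*) [∀ x, AddCommGroup (E x)] [∀ x, Module ℝ (E x)] [∀ x, TopologicalSpace (E x)]
  [TopologicalSpace (TotalSpace F E)] [FiberBundle F E] [VectorBundle ℝ F E]

/-! ### Functions on the base and functions of degree zero -/

theorem corePull_mem (b : C^∞⟮𝓘(ℝ, EB), M; 𝓘(ℝ, ℝ), ℝ⟯) :
    corePull EB F E b ∈ funDegree (scaleHom EB F E) 0 :=
  mem_funDegree_iff.2 fun t p => by rw [pow_zero, one_mul]; rfl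

variable {EB F E} in
/-- The evaluation of smooth functions at a point. -/
noncomputable def evalHom (p : TotalSpace F E) : SmoothFun EB F E →ₐ[ℝ] ℝ where
  toFun f := f p
  map_one' := rfl
  map_mul' _ _ := rfl
  map_zero' := rfl
  map_add' _ _ := rfl
  commutes' _ := rfl

variable {EB F E} in
theorem sum_apply {κ : Type*} (s : Finset κ) (f : κ → SmoothFun EB F E) (p : TotalSpace F E) :
    (∑ i ∈ s, f i) p = ∑ i ∈ s, f i p :=
  map_sum (evalHom p) f s

variable {EB F E} in
/-- The restriction of a function on the total space to the zero section. -/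
noncomputable def restrict (f : SmoothFun EB F E) : C^∞⟮𝓘(ℝ, EB), M; 𝓘(ℝ, ℝ), ℝ⟯ :=
  f.comp ⟨zeroSection F E, contMDiff_zeroSection ℝ E⟩

theorem restrict_corePull (b : C^∞⟮𝓘(ℝ, EB), M; 𝓘(ℝ, ℝ), ℝ⟯) :
    restrict (corePull EB F E b) = b := rfl

variable {EB F E} in
theorem corePull_restrict {f : SmoothFun EB F E} (hf : f ∈ funDegree (scaleHom EB F E) 0) :
    corePull EB F E (restrict f) = f := by
  ext p
  exact apply_eq_of_mem_funDegree_zero hf rfl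

/-- Coordinates on a vector bundle over an open subset `U` of the base: globally defined
functions `x i` of degree zero and `u a` of degree one, and globally defined derivations `H i` of
degree zero and `T a` of degree `-1`, which are dual to each other over `U`. -/
structure Coordinates (U : Set M) (ι ι' : Type) [Fintype ι] [Fintype ι'] [DecidableEq ι]
    [DecidableEq ι'] where
  x : ι → C^∞⟮𝓘(ℝ, EB), M; 𝓘(ℝ, ℝ), ℝ⟯
  u : ι' → SmoothFun EB F E
  H : ι → Derivation ℝ (SmoothFun EB F E) (SmoothFun EB F E)
  T : ι' → Derivation ℝ (SmoothFun EB F E) (SmoothFun EB F E)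
  isOpen : IsOpen U
  u_mem : ∀ a, u a ∈ funDegree (scaleHom EB F E) 1
  H_mem : ∀ i (k : ℕ) (f : SmoothFun EB F E), f ∈ funDegree (scaleHom EB F E) k →
    H i f ∈ funDegree (scaleHom EB F E) k
  T_mem : ∀ a (k : ℕ) (f : SmoothFun EB F E), f ∈ funDegree (scaleHom EB F E) (k + 1) →
    T a f ∈ funDegree (scaleHom EB F E) k
  T_zero : ∀ a (f : SmoothFun EB F E), f ∈ funDegree (scaleHom EB F E) 0 → T a f = 0
  H_x : ∀ i j (p : TotalSpace F E), p.proj ∈ U →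
    H i (corePull EB F E (x j)) p = if i = j then 1 else 0
  H_u : ∀ i a (p : TotalSpace F E), p.proj ∈ U → H i (u a) p = 0
  T_u : ∀ a b (p : TotalSpace F E), p.proj ∈ U → T a (u b) p = if a = b then 1 else 0
  radial : ∀ (f : SmoothFun EB F E) (p : TotalSpace F E), p.proj ∈ U → ∀ t : ℝ,
    HasDerivAt (fun s : ℝ => f ⟨p.proj, s • p.2⟩) (∑ a, u a p * T a f ⟨p.proj, t • p.2⟩) t
  bump : ∀ (p : TotalSpace F E), p.proj ∈ U → ∀ N ∈ nhds p,
    ∃ β : SmoothFun EB F E, β p = 1 ∧ ∀ q ∉ N, β q = 0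
  expansion : ∀ (f : SmoothFun EB F E) (p : TotalSpace F E), p.proj ∈ U →
    ∃ (g : ι → SmoothFun EB F E) (g' : ι' → SmoothFun EB F E), ∀ᶠ q in nhds p,
      f q = f p + (∑ i, (x i q.proj - x i p.proj) * g i q + ∑ a, (u a q - u a p) * g' a q)

variable {EB F E}
variable [IsManifold 𝓘(ℝ, EB) ∞ M] [ContMDiffVectorBundle ∞ F E 𝓘(ℝ, EB)]
variable {x₀ : M} {κ : C^∞⟮𝓘(ℝ, EB), M; 𝓘(ℝ, ℝ), ℝ⟯} (hκ : tsupport κ ⊆ chartDom EB F E x₀)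

theorem coordFun_smul_eq {ι' : Type*} [Fintype ι'] (b' : Module.Basis ι' ℝ F)
    [FiniteDimensional ℝ F] {p : TotalSpace F E}
    (hp : p.proj ∈ oneDom κ) :
    (toModel EB F E x₀ p).2 = ∑ i, coordFun x₀ κ hκ ((b'.coord i).toContinuousLinearMap.comp
      (ContinuousLinearMap.snd ℝ EB F)) p • b' i := by
  conv_lhs => rw [← b'.sum_repr (toModel EB F E x₀ p).2]
  refine Finset.sum_congr rfl fun i _ => ?_
  change _ = (κ p.proj * b'.repr (toModel EB F E x₀ p).2 i) • b' i
  rw [eq_one_of_mem_oneDom hp, one_mul]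

theorem hasDerivAt_radial {ι' : Type*} [Fintype ι'] (b' : Module.Basis ι' ℝ F)
    [FiniteDimensional ℝ F] (f : SmoothFun EB F E) {p : TotalSpace F E}
    (hp : p.proj ∈ oneDom κ) (t : ℝ) :
    HasDerivAt (fun s : ℝ => f ⟨p.proj, s • p.2⟩)
      (∑ i, coordFun x₀ κ hκ ((b'.coord i).toContinuousLinearMap.comp
        (ContinuousLinearMap.snd ℝ EB F)) p *
        coordDeriv x₀ κ hκ (0, b' i) f ⟨p.proj, t • p.2⟩) t := by
  have hp' := mem_chartDom_of_mem_oneDom hκ hp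
  have hz := toModel_mem hp'
  have h1 : HasDerivAt (fun t : ℝ => ((toModel EB F E x₀ p).1, t • (toModel EB F E x₀ p).2))
      (0, (toModel EB F E x₀ p).2) t := by
    simpa using (hasDerivAt_const t (toModel EB F E x₀ p).1).prodMk
      ((hasDerivAt_id t).smul_const (toModel EB F E x₀ p).2)
  have hz' : ((toModel EB F E x₀ p).1, t • (toModel EB F E x₀ p).2) ∈ modelDom EB F E x₀ :=
    modelDom_of_fst hz rfl
  have h2 := (differentiableAt_inModel f hz').hasFDerivAt.comp_hasDerivAt t h1
  -- The trivialization is linear on fibres, so the ray through p is a straight line in the model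
  -- with velocity equal to the fibre part of p.
  have h3 : (inModel x₀ f ∘ fun t : ℝ => ((toModel EB F E x₀ p).1, t • (toModel EB F E x₀ p).2)) =
      fun s : ℝ => f ⟨p.proj, s • p.2⟩ := by
    funext s
    have hs : (⟨p.proj, s • p.2⟩ : TotalSpace F E).proj ∈ chartDom EB F E x₀ := hp'
    have e := inModel_toModel (x₀ := x₀) f hs
    rw [toModel_smul hp'] at e
    exact e
  rw [h3] at h2
  have e : ((0, (toModel EB F E x₀ p).2) : EB × F) =
      ∑ i, coordFun x₀ κ hκ ((b'.coord i).toContinuousLinearMap.comp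
        (ContinuousLinearMap.snd ℝ EB F)) p • ((0, b' i) : EB × F) := by
    rw [Prod.ext_iff]
    simp [Prod.fst_sum, Prod.snd_sum, ← coordFun_smul_eq hκ b' hp]
  rw [e, map_sum, ← toModel_smul hp'] at h2
  refine h2.congr_deriv (Finset.sum_congr rfl fun i _ => ?_)
  have h4 : κ (⟨p.proj, t • p.2⟩ : TotalSpace F E).proj = 1 := eq_one_of_mem_oneDom hp
  rw [map_smul, smul_eq_mul, coordDeriv_apply, h4, one_mul]

variable [FiniteDimensional ℝ EB] [FiniteDimensional ℝ F]

/-- The coordinates given by a chart of the base and a trivialization of the bundle. -/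
noncomputable def chartCoordinates {ι ι' : Type} [Fintype ι] [Fintype ι'] [DecidableEq ι]
    [DecidableEq ι'] (b : Module.Basis ι ℝ EB) (b' : Module.Basis ι' ℝ F) :
    Coordinates EB F E (oneDom κ) ι ι' where
  x i := restrict (coordFun x₀ κ hκ ((b.coord i).toContinuousLinearMap.comp
    (ContinuousLinearMap.fst ℝ EB F)))
  u a := coordFun x₀ κ hκ ((b'.coord a).toContinuousLinearMap.comp
    (ContinuousLinearMap.snd ℝ EB F))
  H i := coordDeriv x₀ κ hκ (b i, 0)
  T a := coordDeriv x₀ κ hκ (0, b' a)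
  isOpen := isOpen_oneDom κ
  u_mem a := coordFun_fibre_mem hκ _
  H_mem i k f hf := coordDeriv_base_mem hκ _ hf
  T_mem a k f hf := coordDeriv_fibre_mem hκ _ hf
  T_zero a f hf := coordDeriv_fibre_zero hκ _ hf
  H_x i j p hp := by
    rw [corePull_restrict (coordFun_base_mem hκ _), coordDeriv_coordFun hκ _ _ hp]
    simp [Finsupp.single_apply]
  H_u i a p hp := by
    rw [coordDeriv_coordFun hκ _ _ hp]
    simp
  T_u a c p hp := by
    rw [coordDeriv_coordFun hκ _ _ hp]
    simp [Finsupp.single_apply]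
  radial f p hp t := hasDerivAt_radial hκ b' f hp t
  bump p hp N hN := exists_bump hκ hp hN
  expansion f p hp := by
    obtain ⟨g, g', h⟩ := exists_expansion hκ b b' f hp
    exact ⟨g, g', h⟩

end Coordinates

/-! ### Euler's identity and derivations at a point -/

section Consequences

variable {EB : Type*} [NormedAddCommGroup EB] [NormedSpace ℝ EB]
  {M : Type*} [TopologicalSpace M] [ChartedSpace EB M]
  {F : Type*} [NormedAddCommGroup F] [NormedSpace ℝ F]
  {E : M → Type*} [∀ x, AddCommGroup (E x)] [∀ x, Module ℝ (E x)] [∀ x, TopologicalSpace (E x)]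
  [TopologicalSpace (TotalSpace F E)] [FiberBundle F E] [VectorBundle ℝ F E]
  {U : Set M} {ι ι' : Type} [Fintype ι] [Fintype ι'] [DecidableEq ι] [DecidableEq ι']
  (c : Coordinates EB F E U ι ι')

namespace Coordinates

/-- Euler's identity: differentiate f(s p) = s^k f(p) at s = 1. -/
theorem euler {k : ℕ} {f : SmoothFun EB F E} (hf : f ∈ funDegree (scaleHom EB F E) k)
    {p : TotalSpace F E} (hp : p.proj ∈ U) : k * f p = ∑ a, c.u a p * c.T a f p := by
  have h1 := c.radial f p hp 1
  have h2 : (fun s : ℝ => f ⟨p.proj, s • p.2⟩) = fun s : ℝ => s ^ k * f p :=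
    funext fun s => apply_smul_of_mem_funDegree hf s p
  rw [h2] at h1
  have h3 := ((hasDerivAt_pow k (1 : ℝ)).mul_const (f p)).unique h1
  rw [one_pow, mul_one, one_smul] at h3
  exact h3

/-- A linear functional that satisfies the Leibniz rule at a point `p` over `U` vanishes if it
vanishes on the coordinates. -/
theorem pointDerivation_eq_zero {p : TotalSpace F E} (hp : p.proj ∈ U)
    (δ : SmoothFun EB F E →ₗ[ℝ] ℝ) (hδ : ∀ f g, δ (f * g) = f p * δ g + g p * δ f)
    (hx : ∀ i, δ (corePull EB F E (c.x i)) = 0) (hu : ∀ a, δ (c.u a) = 0) : δ = 0 := by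
  ext f
  obtain ⟨g, g', hg⟩ := c.expansion f p hp
  obtain ⟨β, hβ, hβ'⟩ := c.bump p hp _ hg
  have h1 : δ 1 = 0 := by
    have := hδ 1 1
    rw [mul_one] at this
    change δ 1 = 1 * δ 1 + 1 * δ 1 at this
    linarith
  have hc : ∀ r : ℝ, δ (algebraMap ℝ _ r) = 0 := fun r => by
    rw [Algebra.algebraMap_eq_smul_one, map_smul, h1, smul_zero]
  -- The remainder of the first order expansion is zero near p. As β R = 0, β(p) = 1 and R(p) = 0,
  -- the Leibniz rule gives δ R = 0, and the terms subtracted from f are killed by δ.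
  set R : SmoothFun EB F E := f - algebraMap ℝ _ (f p) -
    (∑ i, (corePull EB F E (c.x i) - algebraMap ℝ _ (c.x i p.proj)) * g i +
      ∑ a, (c.u a - algebraMap ℝ _ (c.u a p)) * g' a) with hR
  have hRq : ∀ q, R q = f q - f p - (∑ i, (c.x i q.proj - c.x i p.proj) * g i q +
      ∑ a, (c.u a q - c.u a p) * g' a q) := fun q => by
    change f q - f p - ((∑ i, (corePull EB F E (c.x i) - algebraMap ℝ _ (c.x i p.proj)) * g i :
      SmoothFun EB F E) q +
      (∑ a, (c.u a - algebraMap ℝ _ (c.u a p)) * g' a : SmoothFun EB F E) q) = _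
    rw [sum_apply, sum_apply]
    rfl
  have hzero : β * R = 0 := by
    ext q
    by_cases hq : q ∈ {q | f q = f p + (∑ i, (c.x i q.proj - c.x i p.proj) * g i q +
      ∑ a, (c.u a q - c.u a p) * g' a q)}
    · change β q * R q = 0
      rw [hRq, Set.mem_ofPred_eq.mp hq]
      ring
    · change β q * R q = 0
      rw [hβ' q hq, zero_mul]
  have hRp : R p = 0 := by rw [hRq]; simp
  have h2 := congrArg δ hzero
  rw [hδ, hRp, hβ, one_mul, zero_mul, add_zero, map_zero, hR, map_sub, map_sub, map_add, map_sum,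
    map_sum, hc, Finset.sum_eq_zero, Finset.sum_eq_zero] at h2
  · simpa using h2
  · intro a _
    rw [hδ, map_sub, hu, hc]
    change (c.u a p - c.u a p) * _ + _ = _
    simp
  · intro i _
    rw [hδ, map_sub, hx, hc]
    change (c.x i p.proj - c.x i p.proj) * _ + _ = _
    simp

end Coordinates

end Consequences

section DualCoordinates

/-! ### Coordinates on a vector bundle and its dual -/

variable {EB : Type*} [NormedAddCommGroup EB] [NormedSpace ℝ EB]
  {M : Type*} [TopologicalSpace M] [ChartedSpace EB M]
  {F : Type*} [NormedAddCommGroup F] [NormedSpace ℝ F]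
  {E : M → Type*} [∀ x, AddCommGroup (E x)] [∀ x, Module ℝ (E x)] [∀ x, TopologicalSpace (E x)]
  [TopologicalSpace (TotalSpace F E)] [FiberBundle F E] [VectorBundle ℝ F E]

/-- The pairing of an element of the dual bundle with a vector. -/
def pair (φ : TotalSpace (F →L[ℝ] ℝ) (Dual E)) (v : E φ.proj) : ℝ := φ.2 v

theorem chartDom_dual (x₀ : M) :
    chartDom EB (F →L[ℝ] ℝ) (Dual E) x₀ = chartDom EB F E x₀ := by
  rw [chartDom, chartDom, hom_trivializationAt_baseSet]
  congr 1
  exact Set.inter_univ _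

variable [IsManifold 𝓘(ℝ, EB) ∞ M] [ContMDiffVectorBundle ∞ F E 𝓘(ℝ, EB)]

/-- A section of a local frame, cut off to a global section. -/
noncomputable def frameSection (x₀ : M) (κ : C^∞⟮𝓘(ℝ, EB), M; 𝓘(ℝ, ℝ), ℝ⟯)
    (hκ : tsupport κ ⊆ chartDom EB F E x₀) {ι' : Type*} (b' : Module.Basis ι' ℝ F) (a : ι') :
    Cₛ^∞⟮𝓘(ℝ, EB); F, E⟯ :=
  ⟨⇑κ • (trivializationAt F E x₀).localFrame b' a,
    ContMDiffOn.smul_section_of_tsupport (u := (trivializationAt F E x₀).baseSet)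
      κ.contMDiff.contMDiffOn (trivializationAt F E x₀).open_baseSet
      (fun _ hx => (hκ hx).2)
      ((trivializationAt F E x₀).contMDiffOn_localFrame_baseSet ∞ b' a)⟩

variable {x₀ : M} {κ : C^∞⟮𝓘(ℝ, EB), M; 𝓘(ℝ, ℝ), ℝ⟯} (hκ : tsupport κ ⊆ chartDom EB F E x₀)

theorem frameSection_apply {ι' : Type*} (b' : Module.Basis ι' ℝ F) (a : ι') (x : M) :
    frameSection x₀ κ hκ b' a x = κ x • (trivializationAt F E x₀).localFrame b' a x := rfl

theorem localFrame_eq {ι' : Type*} (b' : Module.Basis ι' ℝ F) (a : ι') {x : M}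
    (hx : x ∈ chartDom EB F E x₀) : (trivializationAt F E x₀).localFrame b' a x =
      ((trivializationAt F E x₀).continuousLinearEquivAt ℝ x hx.2).symm (b' a) := by
  rw [Trivialization.localFrame_apply_of_mem_baseSet _ _ hx.2, Trivialization.basisAt,
    Module.Basis.map_apply]
  rfl

/-- Moving along a frame section is moving along a basis vector of the model fibre, so the fibre
derivatives of the coordinates are core operators. -/
theorem verticalLift_frameSection {ι' : Type*} (b' : Module.Basis ι' ℝ F) (a : ι') :
    verticalLift EB F (frameSection x₀ κ hκ b' a) = coordDeriv x₀ κ hκ (0, b' a) := by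
  ext f p
  rw [coordDeriv_apply]
  change deriv (fun s : ℝ => f ⟨p.proj, p.2 + s • frameSection x₀ κ hκ b' a p.proj⟩) 0 = _
  by_cases hp : κ p.proj = 0
  · simp [frameSection_apply, hp]
  · have hp' := mem_chartDom_of_ne_zero hκ hp
    have e : (fun s : ℝ => f ⟨p.proj, p.2 + s • frameSection x₀ κ hκ b' a p.proj⟩) =
        fun s : ℝ => inModel x₀ f (toModel EB F E x₀ p + s • (0, κ p.proj • b' a)) := by
      funext s
      have := ofModel_add_smul hp' 1 (s • frameSection x₀ κ hκ b' a p.proj)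
      rw [one_smul, one_smul, frameSection_apply, localFrame_eq _ _ hp', map_smul, map_smul,
        ContinuousLinearEquiv.apply_symm_apply] at this
      rw [frameSection_apply, localFrame_eq _ _ hp', this, inModel]
      congr 2
      rw [Prod.ext_iff]
      simp
    have h1 : HasDerivAt (fun s : ℝ => toModel EB F E x₀ p + s • ((0, κ p.proj • b' a) : EB × F))
        (0, κ p.proj • b' a) 0 := by
      simpa using ((hasDerivAt_id (0 : ℝ)).smul_const ((0, κ p.proj • b' a) : EB × F)).const_add
        (toModel EB F E x₀ p)
    have h2 : HasFDerivAt (inModel x₀ f) (fderiv ℝ (inModel x₀ f) (toModel EB F E x₀ p))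
        ((fun s : ℝ => toModel EB F E x₀ p + s • ((0, κ p.proj • b' a) : EB × F)) 0) := by
      simpa using (differentiableAt_inModel f (toModel_mem hp')).hasFDerivAt
    have h3 := (h2.comp_hasDerivAt 0 h1).deriv
    rw [e]
    refine h3.trans ?_
    have e2 : ((0, κ p.proj • b' a) : EB × F) = κ p.proj • (0, b' a) := by simp
    rw [e2, map_smul, smul_eq_mul]

variable [FiniteDimensional ℝ EB] [FiniteDimensional ℝ F]

/-- The basis of the continuous dual that is dual to a given basis. -/
noncomputable def dualBasis {ι' : Type} [Fintype ι'] [DecidableEq ι'] (b' : Module.Basis ι' ℝ F) :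
    Module.Basis ι' ℝ (F →L[ℝ] ℝ) :=
  b'.dualBasis.map LinearMap.toContinuousLinearMap

theorem dualBasis_repr {ι' : Type} [Fintype ι'] [DecidableEq ι'] (b' : Module.Basis ι' ℝ F)
    (l : F →L[ℝ] ℝ) (a : ι') : (dualBasis b').repr l a = l (b' a) := by
  rw [dualBasis, Module.Basis.map_repr, LinearEquiv.trans_apply, Module.Basis.dualBasis_repr]
  rfl

/-- Counterpart on the dual bundle: the same frame sections provide the fibre coordinates there,
provided the dual basis is used in the model. Together with the vertical lifts this links Φ to
coordinates on both bundles. -/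
theorem linFun_frameSection {ι' : Type} [Fintype ι'] [DecidableEq ι'] (b' : Module.Basis ι' ℝ F)
    (hκ' : tsupport κ ⊆ chartDom EB (F →L[ℝ] ℝ) (Dual E) x₀) (a : ι') :
    linFun EB F (frameSection x₀ κ hκ b' a) = coordFun x₀ κ hκ'
      (((dualBasis b').coord a).toContinuousLinearMap.comp
        (ContinuousLinearMap.snd ℝ EB (F →L[ℝ] ℝ))) := by
  ext φ
  change φ.2 (frameSection x₀ κ hκ b' a φ.proj) = κ φ.proj * (dualBasis b').repr
    (toModel EB (F →L[ℝ] ℝ) (Dual E) x₀ φ).2 a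
  rw [frameSection_apply, map_smul, dualBasis_repr]
  by_cases hp : κ φ.proj = 0
  · rw [hp, zero_smul, zero_mul]
  · have hp' := mem_chartDom_of_ne_zero hκ hp
    rw [localFrame_eq _ _ hp']
    congr 1
    rw [toModel, hom_trivializationAt_apply, ContinuousLinearMap.inCoordinates_eq hp'.2
      (Set.mem_univ _)]
    simp

variable (EB F E) in
/-- Coordinates on a vector bundle and on its dual bundle over the same open subset of the base,
which are related to each other by a frame of sections. -/
structure DualCoordinates (U : Set M) (ι ι' : Type) [Fintype ι] [Fintype ι'] [DecidableEq ι]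
    [DecidableEq ι'] extends Coordinates EB F E U ι ι' where
  dual : Coordinates EB (F →L[ℝ] ℝ) (Dual E) U ι ι'
  s : ι' → Cₛ^∞⟮𝓘(ℝ, EB); F, E⟯
  T_eq : ∀ a, T a = verticalLift EB F (s a)
  dual_u : ∀ a, dual.u a = linFun EB F (s a)
  pair_eq : ∀ (φ : TotalSpace (F →L[ℝ] ℝ) (Dual E)) (v : E φ.proj), φ.proj ∈ U →
    pair φ v = ∑ a, pair φ (s a φ.proj) * u a ⟨φ.proj, v⟩
  coframe : ∀ a, ∀ y ∈ U, ∃ φ : Dual E y, ∀ v : E y, pair (⟨y, φ⟩ : TotalSpace (F →L[ℝ] ℝ) (Dual E)) v = u a ⟨y, v⟩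

theorem exists_bump_near [T2Space M] [SecondCountableTopology M] {x : M} {V : Set M}
    (hV : IsOpen V) (hx : x ∈ V) :
    ∃ κ : C^∞⟮𝓘(ℝ, EB), M; 𝓘(ℝ, ℝ), ℝ⟯, tsupport κ ⊆ V ∧ x ∈ oneDom κ := by
  have : LocallyCompactSpace M := ChartedSpace.locallyCompactSpace EB M
  obtain ⟨N, hN, hNc, hNV⟩ := exists_mem_nhds_isClosed_subset (hV.mem_nhds hx)
  obtain ⟨κ, h1, h0, -⟩ := exists_contMDiffMap_one_nhds_of_subset_interior (n := ⊤) 𝓘(ℝ, EB)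
    (isClosed_singleton (x := x)) (Set.singleton_subset_iff.2 (mem_interior_iff_mem_nhds.2 hN))
  refine ⟨κ, (closure_minimal (fun y hy => ?_) hNc).trans hNV, ?_⟩
  · by_contra hyN
    exact hy (h0 y hyN)
  · rw [nhdsSet_singleton] at h1
    exact mem_interior_iff_mem_nhds.2 h1

variable (EB F E) in
theorem exists_dualCoordinates [T2Space M] [SecondCountableTopology M] (x : M) :
    ∃ U : Set M, x ∈ U ∧ Nonempty (DualCoordinates EB F E U
      (Fin (Module.finrank ℝ EB)) (Fin (Module.finrank ℝ F))) := by
  obtain ⟨κ, hκ, hx⟩ := exists_bump_near (EB := EB) (isOpen_chartDom EB F E x) (mem_chartDom EB F E x)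
  have hκ' : tsupport κ ⊆ chartDom EB (F →L[ℝ] ℝ) (Dual E) x := by rwa [chartDom_dual]
  let b := Module.finBasis ℝ EB
  let b' := Module.finBasis ℝ F
  refine ⟨oneDom κ, hx, ⟨{ chartCoordinates hκ b b' with
    dual := chartCoordinates hκ' b (dualBasis b')
    s := frameSection x κ hκ b'
    T_eq := fun a => (verticalLift_frameSection hκ b' a).symm
    dual_u := fun a => (linFun_frameSection hκ b' hκ' a).symm
    pair_eq := fun φ v hφ => ?_
    coframe := fun a y hy => ?_ }⟩⟩
  swap
  · have hy' := mem_chartDom_of_mem_oneDom hκ hy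
    refine ⟨(b'.coord a).toContinuousLinearMap.comp
      ((trivializationAt F E x).continuousLinearEquivAt ℝ y hy'.2 : E y →L[ℝ] F), fun v => ?_⟩
    change b'.coord a ((trivializationAt F E x).continuousLinearEquivAt ℝ y hy'.2 v) =
      κ y * b'.coord a (toModel EB F E x (⟨y, v⟩ : TotalSpace F E)).2
    rw [toModel_mk hy', eq_one_of_mem_oneDom hy, one_mul]
  have hφ' := mem_chartDom_of_mem_oneDom hκ hφ
  have e : v = ∑ a, (chartCoordinates hκ b b').u a ⟨φ.proj, v⟩ •
      frameSection x κ hκ b' a φ.proj := by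
    apply ((trivializationAt F E x).continuousLinearEquivAt ℝ φ.proj hφ'.2).injective
    have h1 := coordFun_smul_eq hκ b' (p := (⟨φ.proj, v⟩ : TotalSpace F E)) hφ
    have h2 : (toModel EB F E x (⟨φ.proj, v⟩ : TotalSpace F E)).2 =
        (trivializationAt F E x).continuousLinearEquivAt ℝ φ.proj hφ'.2 v := by
      rw [toModel_mk hφ']
    rw [← h2, h1, map_sum]
    refine Finset.sum_congr rfl fun a _ => ?_
    rw [map_smul, frameSection_apply, eq_one_of_mem_oneDom hφ, one_smul, localFrame_eq _ _ hφ',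
      ContinuousLinearEquiv.apply_symm_apply]
    rfl
  have h3 : φ.2 v = φ.2 (∑ a, (chartCoordinates hκ b b').u a ⟨φ.proj, v⟩ •
      frameSection x κ hκ b' a φ.proj) := congrArg φ.2 e
  rw [map_sum] at h3
  refine h3.trans (Finset.sum_congr rfl fun a _ => ?_)
  rw [map_smul]
  exact mul_comm _ _

end DualCoordinates

/-! ### Homogeneous components of polynomial functions -/

section PolyFun

variable {A : Type*} [CommRing A] [Algebra ℝ A] {h : ℝ →* (A →ₐ[ℝ] A)}

theorem mem_polyFun {k : ℕ} {f : A} (hf : f ∈ funDegree h k) : f ∈ polyFun h :=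
  Submodule.mem_iSup_of_mem (p := funDegree h) k hf

theorem polyFun_induction {P : polyFun h → Prop} (h1 : ∀ k (f : A) (hf : f ∈ funDegree h k),
    P ⟨f, mem_polyFun hf⟩) (h2 : ∀ f g, P f → P g → P (f + g)) (f : polyFun h) : P f := by
  obtain ⟨f, hf⟩ := f
  induction hf using Submodule.iSup_induction' with
  | mem k x hx => exact h1 k x hx
  | zero => exact h1 0 0 (Submodule.zero_mem _)
  | add x y hx hy ihx ihy => exact h2 ⟨x, hx⟩ ⟨y, hy⟩ ihx ihy

theorem pow_mem_funDegree {f : A} (hf : f ∈ funDegree h 1) (k : ℕ) :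
    f ^ k ∈ funDegree h k := fun t => by
  rw [map_pow, hf t, pow_one, smul_pow]

end PolyFun

section Consequences

/-! ### Consequences of the existence of coordinates -/

variable {EB : Type*} [NormedAddCommGroup EB] [NormedSpace ℝ EB]
  {M : Type*} [TopologicalSpace M] [ChartedSpace EB M]
  {F : Type*} [NormedAddCommGroup F] [NormedSpace ℝ F]
  {E : M → Type*} [∀ x, AddCommGroup (E x)] [∀ x, Module ℝ (E x)] [∀ x, TopologicalSpace (E x)]
  [TopologicalSpace (TotalSpace F E)] [FiberBundle F E] [VectorBundle ℝ F E]

/-- The restriction of functions to the zero section, as a linear map. -/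
noncomputable def restrictₗ : SmoothFun EB F E →ₗ[ℝ] C^∞⟮𝓘(ℝ, EB), M; 𝓘(ℝ, ℝ), ℝ⟯ where
  toFun := restrict
  map_add' _ _ := rfl
  map_smul' _ _ := rfl

variable {U : Set M} {ι ι' : Type} [Fintype ι] [Fintype ι'] [DecidableEq ι] [DecidableEq ι']

namespace Coordinates

variable (c : Coordinates EB F E U ι ι')

/-- A linear functional on functions on the base that satisfies the Leibniz rule at a point of `U`
is determined by its values on the coordinates. -/
theorem basePointDerivation {x : M} (hx : x ∈ U) (δ : C^∞⟮𝓘(ℝ, EB), M; 𝓘(ℝ, ℝ), ℝ⟯ →ₗ[ℝ] ℝ)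
    (hδ : ∀ f g, δ (f * g) = f x * δ g + g x * δ f) (b : C^∞⟮𝓘(ℝ, EB), M; 𝓘(ℝ, ℝ), ℝ⟯) :
    δ b = ∑ j, c.H j (corePull EB F E b) (zeroSection F E x) * δ (c.x j) := by
  -- The functional is moved to the total space by restriction to the zero section, and its expected
  -- coordinate expression is subtracted. The difference vanishes on the x_i by duality, and on the
  -- u_a because these vanish on the zero section.
  let δ' : SmoothFun EB F E →ₗ[ℝ] ℝ := δ ∘ₗ restrictₗ -
    ∑ j, δ (c.x j) • ((evalHom (zeroSection F E x)).toLinearMap ∘ₗ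
      (c.H j : SmoothFun EB F E →ₗ[ℝ] SmoothFun EB F E))
  have hδ' : ∀ f, δ' f = δ (restrict f) -
      ∑ j, δ (c.x j) * c.H j f (zeroSection F E x) := fun f => by
    simp only [δ', LinearMap.sub_apply, LinearMap.sum_apply, LinearMap.comp_apply,
      LinearMap.smul_apply, smul_eq_mul]
    rfl
  have key := c.pointDerivation_eq_zero (p := zeroSection F E x) hx δ' (fun f g => ?_)
    (fun i => ?_) fun a => ?_
  · have := hδ' (corePull EB F E b)
    rw [key, LinearMap.zero_apply, restrict_corePull, eq_comm, sub_eq_zero] at this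
    rw [this]
    exact Finset.sum_congr rfl fun j _ => mul_comm _ _
  · rw [hδ', hδ', hδ']
    have e : ∀ j, c.H j (f * g) (zeroSection F E x) = f (zeroSection F E x) *
        c.H j g (zeroSection F E x) + g (zeroSection F E x) * c.H j f (zeroSection F E x) :=
      fun j => by rw [Derivation.leibniz]; rfl
    have e2 : δ (restrict (f * g)) = f (zeroSection F E x) * δ (restrict g) +
      g (zeroSection F E x) * δ (restrict f) := hδ (restrict f) (restrict g)
    simp only [e, e2, mul_add, Finset.sum_add_distrib, mul_sub, Finset.mul_sum]
    have e3 : ∀ r s t : ℝ, r * (s * t) = s * (r * t) := fun r s t => by ring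
    simp only [e3 (δ _)]
    ring
  · rw [hδ', restrict_corePull, Finset.sum_eq_single i]
    · rw [c.H_x i i (zeroSection F E x) hx, if_pos rfl, mul_one, sub_self]
    · intro j _ hj
      rw [c.H_x j i (zeroSection F E x) hx, if_neg hj, mul_zero]
    · simp
  · rw [hδ', Finset.sum_eq_zero fun j _ => by rw [c.H_u j a (zeroSection F E x) hx, mul_zero],
      sub_zero]
    have : restrict (c.u a) = 0 := by
      ext y
      exact apply_zero_of_mem_funDegree one_ne_zero (c.u_mem a) y
    rw [this, map_zero]

theorem euler_mul {χ : C^∞⟮𝓘(ℝ, EB), M; 𝓘(ℝ, ℝ), ℝ⟯} (hχ : tsupport χ ⊆ U) {k : ℕ}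
    {f : SmoothFun EB F E} (hf : f ∈ funDegree (scaleHom EB F E) k) :
    (k : ℝ) • (corePull EB F E χ * f) = ∑ a, corePull EB F E χ * c.u a * c.T a f := by
  ext p
  rw [sum_apply]
  change (k : ℝ) * (χ p.proj * f p) = ∑ a, χ p.proj * c.u a p * c.T a f p
  by_cases hp : χ p.proj = 0
  · simp [hp]
  · have h1 := c.euler hf (hχ (subset_closure hp))
    rw [mul_left_comm, h1, Finset.mul_sum]
    exact Finset.sum_congr rfl fun a _ => (mul_assoc _ _ _).symm

variable [FiniteDimensional ℝ EB] [IsManifold 𝓘(ℝ, EB) ∞ M] [T2Space M] [SecondCountableTopology M]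

variable (EB F E) in
/-- The pull-back of a function on the base as a polynomial function. -/
noncomputable def _root_.FWL.polyBase (b : C^∞⟮𝓘(ℝ, EB), M; 𝓘(ℝ, ℝ), ℝ⟯) :
    polyFun (scaleHom EB F E) := ⟨corePull EB F E b, mem_polyFun (corePull_mem EB F E b)⟩

/-- A linear functional on polynomial functions that satisfies the Leibniz rule at a point `p` over
`U` vanishes if it vanishes on the coordinates. -/
theorem polyPointDerivation_eq_zero {p : TotalSpace F E} (hp : p.proj ∈ U)
    (δ : polyFun (scaleHom EB F E) →ₗ[ℝ] ℝ)
    (hδ : ∀ f g, δ (f * g) = (f : SmoothFun EB F E) p * δ g + (g : SmoothFun EB F E) p * δ f)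
    (hx : ∀ i, δ (polyBase EB F E (c.x i)) = 0)
    (hu : ∀ a, δ ⟨c.u a, mem_polyFun (c.u_mem a)⟩ = 0) : δ = 0 := by
  have h0 : ∀ b, δ (polyBase EB F E b) = 0 := fun b => by
    let δ₀ : C^∞⟮𝓘(ℝ, EB), M; 𝓘(ℝ, ℝ), ℝ⟯ →ₗ[ℝ] ℝ :=
      { toFun := fun b => δ (polyBase EB F E b)
        map_add' := fun b b' => map_add δ (polyBase EB F E b) (polyBase EB F E b')
        map_smul' := fun r b => map_smul δ r (polyBase EB F E b) }
    have := c.basePointDerivation hp δ₀ (fun f g => hδ (polyBase EB F E f) (polyBase EB F E g)) b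
    refine this.trans (Finset.sum_eq_zero fun j _ => ?_)
    rw [show δ₀ (c.x j) = 0 from hx j, mul_zero]
  obtain ⟨χ, hχ, hχ1⟩ := exists_bump_near (EB := EB) c.isOpen hp
  have hone := eq_one_of_mem_oneDom hχ1
  -- A bump function in the fibre direction is not polynomial, so the argument with Hadamard's
  -- expansion is not available here. The localized Euler identity writes a function of degree k + 1
  -- through the u_a and functions of degree k instead.
  have key : ∀ k (f : SmoothFun EB F E) (hf : f ∈ funDegree (scaleHom EB F E) k),
      δ ⟨f, mem_polyFun hf⟩ = 0 := by
    intro k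
    induction k with
    | zero =>
      intro f hf
      have : (⟨f, mem_polyFun hf⟩ : polyFun (scaleHom EB F E)) = polyBase EB F E (restrict f) :=
        Subtype.ext (corePull_restrict hf).symm
      rw [this, h0]
    | succ k ih =>
      intro f hf
      have e : ((k + 1 : ℕ) : ℝ) • (polyBase EB F E χ * ⟨f, mem_polyFun hf⟩) =
          ∑ a, polyBase EB F E χ * ⟨c.u a, mem_polyFun (c.u_mem a)⟩ *
            ⟨c.T a f, mem_polyFun (c.T_mem a k f hf)⟩ := by
        apply Subtype.ext
        rw [AddSubmonoidClass.coe_finsetSum]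
        exact c.euler_mul hχ hf
      have e2 := congrArg δ e
      rw [map_smul, map_sum, hδ, h0, mul_zero, add_zero, Finset.sum_eq_zero] at e2
      · have h1 : (polyBase EB F E χ : SmoothFun EB F E) p = 1 := hone
        rw [h1, one_mul, smul_eq_mul] at e2
        exact (mul_eq_zero.1 e2).resolve_left (by positivity)
      · intro a _
        rw [hδ, hδ, ih _ (c.T_mem a k f hf), hu, h0]
        simp
  ext f
  exact polyFun_induction (P := fun f => δ f = 0) key
    (fun f g hf hg => by rw [map_add, hf, hg, add_zero]) f

/-- A real character of the algebra of polynomial functions is the evaluation at a point `p` over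
`U` if it is on functions on the base and on the fibre coordinates. -/
theorem polyCharacter_eq {p : TotalSpace F E} (hp : p.proj ∈ U)
    (δ : polyFun (scaleHom EB F E) →ₐ[ℝ] ℝ) (hx : ∀ b, δ (polyBase EB F E b) = b p.proj)
    (hu : ∀ a, δ ⟨c.u a, mem_polyFun (c.u_mem a)⟩ = c.u a p) (f : polyFun (scaleHom EB F E)) :
    δ f = (f : SmoothFun EB F E) p := by
  obtain ⟨χ, hχ, hχ1⟩ := exists_bump_near (EB := EB) c.isOpen hp
  have hone := eq_one_of_mem_oneDom hχ1
  refine polyFun_induction (P := fun f => δ f = (f : SmoothFun EB F E) p) ?_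
    (fun f g hf hg => by rw [map_add, hf, hg]; rfl) f
  intro k
  induction k with
  | zero =>
    intro f hf
    have : (⟨f, mem_polyFun hf⟩ : polyFun (scaleHom EB F E)) = polyBase EB F E (restrict f) :=
      Subtype.ext (corePull_restrict hf).symm
    rw [this, hx]
    rfl
  | succ k ih =>
    intro f hf
    -- Applying the character to Euler's identity reduces degree k + 1 to degree k; the cut-off
    -- factor χ is harmless since the character takes it to 1.
    have e : ((k + 1 : ℕ) : ℝ) • (polyBase EB F E χ * ⟨f, mem_polyFun hf⟩) =
        ∑ a, polyBase EB F E χ * ⟨c.u a, mem_polyFun (c.u_mem a)⟩ *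
          ⟨c.T a f, mem_polyFun (c.T_mem a k f hf)⟩ := by
      apply Subtype.ext
      rw [AddSubmonoidClass.coe_finsetSum]
      exact c.euler_mul hχ hf
    have e2 := congrArg δ e
    rw [map_smul, map_sum, map_mul, hx, hone, one_mul, smul_eq_mul] at e2
    have hk : ((k + 1 : ℕ) : ℝ) ≠ 0 := by positivity
    apply mul_left_cancel₀ hk
    rw [e2]
    refine Eq.trans ?_ (c.euler hf hp).symm
    refine Finset.sum_congr rfl fun a _ => ?_
    rw [map_mul, map_mul, hx, hone, one_mul, hu, ih _ (c.T_mem a k f hf)]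

end Coordinates

variable [IsManifold 𝓘(ℝ, EB) ∞ M] [ContMDiffVectorBundle ∞ F E 𝓘(ℝ, EB)]
  [FiniteDimensional ℝ EB] [FiniteDimensional ℝ F] [T2Space M] [SecondCountableTopology M]

theorem derivation_eq_zero {X : Derivation ℝ (SmoothFun EB F E) (SmoothFun EB F E)}
    (h0 : ∀ f ∈ funDegree (scaleHom EB F E) 0, X f = 0)
    (h1 : ∀ f ∈ funDegree (scaleHom EB F E) 1, X f = 0) : X = 0 := by
  ext f p
  obtain ⟨U, hU, ⟨c⟩⟩ := exists_dualCoordinates EB F E p.proj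
  have := c.pointDerivation_eq_zero hU ((evalHom p).toLinearMap ∘ₗ (X : _ →ₗ[ℝ] _))
    (fun f g => by
      change X (f * g) p = f p * X g p + g p * X f p
      rw [Derivation.leibniz]; rfl)
    (fun i => by
      change X _ p = 0
      rw [h0 _ (corePull_mem EB F E _)]; rfl)
    (fun a => by
      change X _ p = 0
      rw [h1 _ (c.u_mem a)]; rfl)
  exact LinearMap.congr_fun this f

/-- The last two properties only need vertical lifts of frame sections as test operators: if all
fibre derivatives of f vanish, f is constant on rays; if they have degree zero, f is affine on rays.
-/
theorem isFibrewise : IsFibrewise (scaleHom EB F E) where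
  derivation_eq_zero X h0 h1 := derivation_eq_zero h0 h1
  eq_zero_of_neg k f hk hf := eq_zero_of_neg_degree hk hf
  mem_funDegree k f hf := mem_funDegree_of_ne_zero hf
  mem_zero f hf := by
    refine mem_funDegree_iff.2 fun t p => ?_
    obtain ⟨U, hU, ⟨c⟩⟩ := exists_dualCoordinates EB F E p.proj
    have hT : ∀ a, c.T a f = 0 := fun a => by
      have := hf _ (coreField EB F (c.s a)).2
      change verticalLift EB F (c.s a) f = verticalLift EB F (c.s a) 1 * f at this
      rw [Derivation.map_one_eq_zero, zero_mul] at this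
      rw [c.T_eq, this]
    have h1 : ∀ t : ℝ, HasDerivAt (fun s : ℝ => f ⟨p.proj, s • p.2⟩) 0 t := fun t => by
      refine (c.radial f p hU t).congr_deriv (Finset.sum_eq_zero fun a _ => ?_)
      rw [hT, show (0 : SmoothFun EB F E) ⟨p.proj, t • p.2⟩ = 0 from rfl, mul_zero]
    have h2 := is_const_of_deriv_eq_zero (fun t => (h1 t).differentiableAt)
      (fun t => (h1 t).deriv) t 1
    rw [pow_zero, one_mul]
    simpa using h2
  mem_sup f hf := by
    have key : f - corePull EB F E (restrict f) ∈ funDegree (scaleHom EB F E) 1 := by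
      refine mem_funDegree_iff.2 fun t p => ?_
      obtain ⟨U, hU, ⟨c⟩⟩ := exists_dualCoordinates EB F E p.proj
      have hT : ∀ a, c.T a f ∈ funDegree (scaleHom EB F E) 0 := fun a => by
        have := hf _ (coreField EB F (c.s a)).2
        change verticalLift EB F (c.s a) f - verticalLift EB F (c.s a) 1 * f ∈ _ at this
        rw [Derivation.map_one_eq_zero, zero_mul, sub_zero] at this
        rwa [c.T_eq]
      let L := ∑ a, c.u a p * c.T a f p
      -- The derivative of f along the ray is the constant L, because the fibre derivatives do not
      -- depend on the point of the fibre.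
      have h1 : ∀ t : ℝ, HasDerivAt (fun s : ℝ => f ⟨p.proj, s • p.2⟩ - s * L) 0 t := fun t => by
        have h2 := (c.radial f p hU t).sub ((hasDerivAt_id t).mul_const L)
        refine h2.congr_deriv ?_
        rw [one_mul, sub_eq_zero]
        refine Finset.sum_congr rfl fun a _ => ?_
        rw [apply_eq_of_mem_funDegree_zero (hT a) (p := (⟨p.proj, t • p.2⟩ : TotalSpace F E))
          (q := p) rfl]
      have h2 : ∀ t : ℝ, f ⟨p.proj, t • p.2⟩ - t * L = f (zeroSection F E p.proj) := fun t => by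
        have := is_const_of_deriv_eq_zero (fun t => (h1 t).differentiableAt)
          (fun t => (h1 t).deriv) t 0
        simp only [zero_smul, zero_mul, sub_zero] at this
        exact this
      have h3 := h2 1
      rw [one_smul, one_mul] at h3
      change f ⟨p.proj, t • p.2⟩ - f (zeroSection F E p.proj) =
        t ^ 1 * (f p - f (zeroSection F E p.proj))
      change f p - L = _ at h3
      linear_combination h2 t - t * h3
    rw [← add_sub_cancel (corePull EB F E (restrict f)) f]
    exact Submodule.add_mem_sup (corePull_mem EB F E _) key

end Consequences

section Gluing

/-! ### Locally finite sums -/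

attribute [local instance] LieRing.ofAssociativeRing

variable {EB : Type*} [NormedAddCommGroup EB] [NormedSpace ℝ EB]
  {M : Type*} [TopologicalSpace M] [ChartedSpace EB M]
  {F : Type*} [NormedAddCommGroup F] [NormedSpace ℝ F]
  {E : M → Type*} [∀ x, AddCommGroup (E x)] [∀ x, Module ℝ (E x)] [∀ x, TopologicalSpace (E x)]
  [TopologicalSpace (TotalSpace F E)] [FiberBundle F E] [VectorBundle ℝ F E]

/-- The indices whose coefficient does not vanish at a point. -/
noncomputable def indicesAt {κ : Type*} {ρ : κ → C^∞⟮𝓘(ℝ, EB), M; 𝓘(ℝ, ℝ), ℝ⟯}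
    (hρ : LocallyFinite fun i => Function.support (ρ i)) (x : M) : Finset κ :=
  (hρ.point_finite x).toFinset

theorem ne_zero_of_mem_indicesAt {κ : Type*} {ρ : κ → C^∞⟮𝓘(ℝ, EB), M; 𝓘(ℝ, ℝ), ℝ⟯}
    {hρ : LocallyFinite fun i => Function.support (ρ i)} {x : M} {i : κ}
    (hi : i ∈ indicesAt hρ x) : ρ i x ≠ 0 :=
  (hρ.point_finite x).mem_toFinset.1 hi

theorem mem_indicesAt {κ : Type*} {ρ : κ → C^∞⟮𝓘(ℝ, EB), M; 𝓘(ℝ, ℝ), ℝ⟯}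
    {hρ : LocallyFinite fun i => Function.support (ρ i)} {x : M} {i : κ}
    (hi : ρ i x ≠ 0) : i ∈ indicesAt hρ x :=
  (hρ.point_finite x).mem_toFinset.2 hi

variable {κ : Type*} {ρ : κ → C^∞⟮𝓘(ℝ, EB), M; 𝓘(ℝ, ℝ), ℝ⟯}
  (hρ : LocallyFinite fun i => Function.support (ρ i))

theorem finsum_eq_sum_indicesAt (x : M) (a : κ → ℝ) :
    ∑ᶠ i, ρ i x * a i = ∑ i ∈ indicesAt hρ x, ρ i x * a i := by
  refine finsum_eq_sum_of_support_subset _ fun i hi => ?_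
  exact Finset.mem_coe.2 (mem_indicesAt (left_ne_zero_of_mul hi))

/-- The sum of smooth functions on the total space with locally finite coefficients on the base. -/
noncomputable def locSum (f : κ → SmoothFun EB F E) : SmoothFun EB F E :=
  ⟨fun p => ∑ᶠ i, ρ i p.proj * f i p, by
    refine contMDiff_finsum (fun i => ?_) ?_
    · exact ((ρ i).contMDiff.comp (contMDiff_proj E)).mul (f i).contMDiff
    · refine (hρ.preimage_continuous (FiberBundle.continuous_proj F E)).subset fun i p hp => ?_
      exact left_ne_zero_of_mul hp⟩

theorem locSum_apply (f : κ → SmoothFun EB F E) (p : TotalSpace F E) :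
    locSum hρ f p = ∑ i ∈ indicesAt hρ p.proj, ρ i p.proj * f i p :=
  finsum_eq_sum_indicesAt hρ p.proj fun i => f i p

theorem locSum_mem {k : ℕ} {f : κ → SmoothFun EB F E}
    (hf : ∀ i, f i ∈ funDegree (scaleHom EB F E) k) :
    locSum hρ f ∈ funDegree (scaleHom EB F E) k := by
  refine mem_funDegree_iff.2 fun t p => ?_
  rw [locSum_apply, locSum_apply, Finset.mul_sum]
  refine Finset.sum_congr rfl fun i _ => ?_
  rw [apply_smul_of_mem_funDegree (hf i)]
  ring

/-- The sum of operators with locally finite coefficients on the base. -/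
noncomputable def glue (Δ : κ → Module.End ℝ (SmoothFun EB F E)) :
    Module.End ℝ (SmoothFun EB F E) where
  toFun f := locSum hρ fun i => Δ i f
  map_add' f g := by
    ext p
    change locSum hρ _ p = locSum hρ _ p + locSum hρ _ p
    rw [locSum_apply, locSum_apply, locSum_apply, ← Finset.sum_add_distrib]
    refine Finset.sum_congr rfl fun i _ => ?_
    rw [map_add, ← mul_add]
    rfl
  map_smul' r f := by
    ext p
    change locSum hρ _ p = r * locSum hρ _ p
    rw [locSum_apply, locSum_apply, Finset.mul_sum]
    refine Finset.sum_congr rfl fun i _ => ?_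
    rw [map_smul, mul_left_comm]
    rfl

theorem glue_apply (Δ : κ → Module.End ℝ (SmoothFun EB F E)) (f : SmoothFun EB F E)
    (p : TotalSpace F E) :
    glue hρ Δ f p = ∑ i ∈ indicesAt hρ p.proj, ρ i p.proj * Δ i f p :=
  locSum_apply hρ _ p

/-- The coefficients multiply from the left, so they pass through the commutator with a
multiplication. This is why gluing preserves orders. -/
theorem glue_lie_mulOp (Δ : κ → Module.End ℝ (SmoothFun EB F E)) (g : SmoothFun EB F E) :
    ⁅glue hρ Δ, mulOp g⁆ = glue hρ fun i => ⁅Δ i, mulOp g⁆ := by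
  ext f p
  rw [lie_mulOp_apply, glue_apply]
  change glue hρ Δ (g * f) p - g p * glue hρ Δ f p = _
  rw [glue_apply, glue_apply, Finset.mul_sum, ← Finset.sum_sub_distrib]
  refine Finset.sum_congr rfl fun i _ => ?_
  rw [lie_mulOp_apply]
  change _ = ρ i p.proj * (Δ i (g * f) p - g p * Δ i f p)
  ring

theorem glue_mem_order {q : ℕ} {Δ : κ → Module.End ℝ (SmoothFun EB F E)}
    (hΔ : ∀ i, Δ i ∈ order (SmoothFun EB F E) q) :
    glue hρ Δ ∈ order (SmoothFun EB F E) q := by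
  induction q generalizing Δ with
  | zero =>
    intro g
    rw [glue_lie_mulOp]
    ext f p
    rw [glue_apply]
    refine Finset.sum_eq_zero fun i _ => ?_
    rw [hΔ i g]
    exact mul_zero _
  | succ q ih =>
    intro g
    rw [glue_lie_mulOp]
    exact ih fun i => hΔ i g

theorem glue_mem_opDegree {k : ℤ} {Δ : κ → Module.End ℝ (SmoothFun EB F E)}
    (hΔ : ∀ i, Δ i ∈ opDegree (scaleHom EB F E) k) :
    glue hρ Δ ∈ opDegree (scaleHom EB F E) k := by
  refine (mem_opDegree _).2 fun t ht => ?_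
  ext f p
  change glue hρ Δ (scaleHom EB F E t⁻¹ f) ⟨p.proj, t • p.2⟩ = t ^ k * glue hρ Δ f p
  rw [glue_apply, glue_apply, Finset.mul_sum]
  refine Finset.sum_congr rfl fun i _ => ?_
  have := congrArg (fun Δ : Module.End ℝ (SmoothFun EB F E) => Δ f p)
    ((mem_opDegree _).1 (hΔ i) t ht)
  change Δ i (scaleHom EB F E t⁻¹ f) ⟨p.proj, t • p.2⟩ = t ^ k * Δ i f p at this
  rw [this]
  ring

/-- The sum of derivations with locally finite coefficients on the base. -/
noncomputable def glueDerivation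
    (X : κ → Derivation ℝ (SmoothFun EB F E) (SmoothFun EB F E)) :
    Derivation ℝ (SmoothFun EB F E) (SmoothFun EB F E) :=
  Derivation.mk' (glue hρ fun i => (X i : Module.End ℝ (SmoothFun EB F E))) fun f g => by
    ext p
    change _ = f p * glue hρ _ g p + g p * glue hρ _ f p
    rw [glue_apply, glue_apply, glue_apply, Finset.mul_sum, Finset.mul_sum,
      ← Finset.sum_add_distrib]
    refine Finset.sum_congr rfl fun i _ => ?_
    change ρ i p.proj * X i (f * g) p = _
    rw [Derivation.leibniz]
    change ρ i p.proj * (f p * X i g p + g p * X i f p) =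
      f p * (ρ i p.proj * X i g p) + g p * (ρ i p.proj * X i f p)
    ring

theorem glueDerivation_apply (X : κ → Derivation ℝ (SmoothFun EB F E) (SmoothFun EB F E))
    (f : SmoothFun EB F E) (p : TotalSpace F E) :
    glueDerivation hρ X f p = ∑ i ∈ indicesAt hρ p.proj, ρ i p.proj * X i f p :=
  glue_apply hρ _ f p

variable [IsManifold 𝓘(ℝ, EB) ∞ M] [ContMDiffVectorBundle ∞ F E 𝓘(ℝ, EB)]

theorem verticalLift_apply (e : Cₛ^∞⟮𝓘(ℝ, EB); F, E⟯) (f : SmoothFun EB F E)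
    (p : TotalSpace F E) : verticalLift EB F e f p =
      deriv (fun s : ℝ => f ⟨p.proj, p.2 + s • e p.proj⟩) 0 := rfl

/-- A vertical curve stays in one fibre, where the coefficients are constant and the index set of
the sum is fixed. -/
theorem verticalLift_locSum (e : Cₛ^∞⟮𝓘(ℝ, EB); F, E⟯) (f : κ → SmoothFun EB F E)
    (p : TotalSpace F E) : verticalLift EB F e (locSum hρ f) p =
      ∑ i ∈ indicesAt hρ p.proj, ρ i p.proj * verticalLift EB F e (f i) p := by
  rw [verticalLift_apply]
  have e1 : (fun s : ℝ => locSum hρ f ⟨p.proj, p.2 + s • e p.proj⟩) = fun s : ℝ =>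
      ∑ i ∈ indicesAt hρ p.proj, ρ i p.proj * f i ⟨p.proj, p.2 + s • e p.proj⟩ := by
    funext s
    rw [locSum_apply]
  rw [e1, deriv_fun_sum fun i _ => (differentiable_along EB F e (f i) p 0).const_mul _]
  refine Finset.sum_congr rfl fun i _ => ?_
  rw [deriv_const_mul _ (differentiable_along EB F e (f i) p 0)]
  rfl

theorem glue_lie_verticalLift (Δ : κ → Module.End ℝ (SmoothFun EB F E))
    (e : Cₛ^∞⟮𝓘(ℝ, EB); F, E⟯) :
    ⁅glue hρ Δ, (verticalLift EB F e : Module.End ℝ (SmoothFun EB F E))⁆ =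
      glue hρ fun i => ⁅Δ i, (verticalLift EB F e : Module.End ℝ (SmoothFun EB F E))⁆ := by
  ext f p
  rw [glue_apply]
  change glue hρ Δ (verticalLift EB F e f) p - verticalLift EB F e (locSum hρ fun i => Δ i f) p = _
  rw [glue_apply, verticalLift_locSum, ← Finset.sum_sub_distrib]
  refine Finset.sum_congr rfl fun i _ => ?_
  rw [← mul_sub]
  rfl

variable [FiniteDimensional ℝ EB] [FiniteDimensional ℝ F] [T2Space M] [SecondCountableTopology M]

variable (EB F E) in
/-- Coordinates on a vector bundle and its dual over each set of an open covering of the base,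
together with a subordinate partition of unity. -/
structure CoordinateAtlas where
  U : M → Set M
  coord : ∀ i, DualCoordinates EB F E (U i) (Fin (Module.finrank ℝ EB)) (Fin (Module.finrank ℝ F))
  ρ : M → C^∞⟮𝓘(ℝ, EB), M; 𝓘(ℝ, ℝ), ℝ⟯
  locallyFinite : LocallyFinite fun i => Function.support (ρ i)
  tsupport_subset : ∀ i, tsupport (ρ i) ⊆ U i
  sum_eq_one : ∀ x, ∑ i ∈ indicesAt locallyFinite x, ρ i x = 1

variable (EB F E) in
theorem exists_coordinateAtlas : Nonempty (CoordinateAtlas EB F E) := by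
  have : LocallyCompactSpace M := ChartedSpace.locallyCompactSpace EB M
  choose U hU c using exists_dualCoordinates EB F E
  obtain ⟨ρ, hρ⟩ := SmoothPartitionOfUnity.exists_isSubordinate 𝓘(ℝ, EB) isClosed_univ U
    (fun x => (c x).some.isOpen) fun x _ => Set.mem_iUnion_of_mem x (hU x)
  refine ⟨⟨U, fun x => (c x).some, fun i => ρ i, ρ.locallyFinite, hρ, fun x => ?_⟩⟩
  have h1 := ρ.sum_eq_one (Set.mem_univ x)
  have h2 := finsum_eq_sum_indicesAt (ρ := fun i => ρ i) ρ.locallyFinite x fun _ => 1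
  simp only [mul_one] at h2
  rw [← h2, h1]

theorem CoordinateAtlas.mem_of_mem_indicesAt (𝒜 : CoordinateAtlas EB F E) {x i : M}
    (hi : i ∈ indicesAt 𝒜.locallyFinite x) : x ∈ 𝒜.U i :=
  𝒜.tsupport_subset i (subset_closure (ne_zero_of_mem_indicesAt hi))

end Gluing

section CoreAlgebra

/-! ### Core operators on powers of an element of degree one -/

attribute [local instance] LieRing.ofAssociativeRing

variable {A : Type*} [CommRing A] [Algebra ℝ A] {h : ℝ →* (A →ₐ[ℝ] A)}

theorem mem_coreDO_of_mem_coreOrder {q : ℕ} {G : Module.End ℝ A} (hG : G ∈ coreOrder h q) :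
    G ∈ coreDO h := IsCore.of_order q hG

theorem coreOrder_lie_mulOp {q : ℕ} {G : Module.End ℝ A} (hG : G ∈ coreOrder h (q + 1)) {l : A}
    (hl : l ∈ funDegree h 1) : ⁅G, mulOp l⁆ ∈ coreOrder h q := by
  refine ⟨hG.1 l, ?_⟩
  have := opDegree_lie h hG.2 (mulOp_mem_opDegree h hl)
  rwa [show -((q + 1 : ℕ) : ℤ) + ((1 : ℕ) : ℤ) = -(q : ℤ) by push_cast; ring] at this

theorem apply_mul_of_mem_funDegree_zero (H : IsFibrewise h) {G : Module.End ℝ A}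
    (hG : G ∈ coreDO h) {b : A} (hb : b ∈ funDegree h 0) (f : A) : G (b * f) = b * G f := by
  have := LinearMap.congr_fun (H.core_lie_core hG (mulOp_mem_coreDO h hb)) f
  rwa [lie_mulOp_apply, LinearMap.zero_apply, sub_eq_zero] at this

theorem coreOrder_apply_mem (H : IsFibrewise h) {q k : ℕ} {G : Module.End ℝ A}
    (hG : G ∈ coreOrder h q) {f : A} (hf : f ∈ funDegree h (q + k)) : G f ∈ funDegree h k := by
  refine H.mem_funDegree k _ fun t ht => ?_
  have := scale_apply_of_mem_opDegree h hG.2 ht (m := ((q + k : ℕ) : ℤ)) (by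
    rw [zpow_natCast]; exact hf t)
  rwa [show -(q : ℤ) + ((q + k : ℕ) : ℤ) = (k : ℤ) by push_cast; ring, zpow_natCast] at this

theorem coreOrder_apply_eq_zero (H : IsFibrewise h) {q k : ℕ} (hk : k < q) {G : Module.End ℝ A}
    (hG : G ∈ coreOrder h q) {f : A} (hf : f ∈ funDegree h k) : G f = 0 := by
  refine H.eq_zero_of_neg (-(q : ℤ) + k) _ (by omega) fun t ht => ?_
  exact scale_apply_of_mem_opDegree h hG.2 ht (by rw [zpow_natCast]; exact hf t)

/-- The rule for differentiating a power q times along the fibres, written without division. The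
commutator with l has order q - 1 and relates the neighbouring cases as in Pascal's triangle, hence
the double induction on q and m. -/
theorem coreOrder_apply_pow (H : IsFibrewise h) {q : ℕ} (m : ℕ) {G : Module.End ℝ A}
    (hG : G ∈ coreOrder h q) {l : A} (hl : l ∈ funDegree h 1) :
    ((m.factorial * q.factorial : ℕ) : A) * G (l ^ (q + m)) = ((q + m).factorial : ℕ) * (G (l ^ q) * l ^ m) := by
  induction q generalizing G m with
  | zero =>
    rw [eq_mulOp_of_mem_order_zero hG.1]
    simp [mulOp_apply]
  | succ q ihq =>
    induction m with
    | zero => simp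
    | succ m ihm =>
      have hK := coreOrder_lie_mulOp hG hl
      have e1 := ihq (m + 1) hK
      have e2 : ⁅G, mulOp l⁆ (l ^ q) = G (l ^ (q + 1)) := by
        rw [lie_mulOp_apply, coreOrder_apply_eq_zero H (Nat.lt_succ_self q) hG
          (pow_mem_funDegree hl q), mul_zero, sub_zero, ← pow_succ']
      have e3 : ⁅G, mulOp l⁆ (l ^ (q + (m + 1))) =
          G (l ^ (q + 1 + (m + 1))) - l * G (l ^ (q + 1 + m)) := by
        rw [lie_mulOp_apply, ← pow_succ', show q + (m + 1) + 1 = q + 1 + (m + 1) by ring,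
          show q + (m + 1) = q + 1 + m by ring]
      rw [e2, e3] at e1
      rw [show q + (m + 1) = q + 1 + m by ring] at e1
      rw [show q + 1 + (m + 1) = (q + 1 + m) + 1 by ring] at *
      rw [Nat.factorial_succ m] at *
      rw [Nat.factorial_succ q, Nat.factorial_succ (q + 1 + m)] at *
      push_cast at *
      linear_combination ((q : A) + 1) * e1 + ((m : A) + 1) * l * ihm

theorem coreOrder_apply_pow' (H : IsFibrewise h) {q : ℕ} (m : ℕ) {G : Module.End ℝ A}
    (hG : G ∈ coreOrder h q) {l : A} (hl : l ∈ funDegree h 1) :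
    G (l ^ (q + m)) = ((q + m).factorial * ((m.factorial : ℝ)⁻¹ * (q.factorial : ℝ)⁻¹)) •
      (G (l ^ q) * l ^ m) := by
  have hm : (m.factorial : ℝ) ≠ 0 := Nat.cast_ne_zero.2 m.factorial_ne_zero
  have hq : (q.factorial : ℝ) ≠ 0 := Nat.cast_ne_zero.2 q.factorial_ne_zero
  have h1 := coreOrder_apply_pow H m hG hl
  rw [← nsmul_eq_mul, ← nsmul_eq_mul, ← Nat.cast_smul_eq_nsmul ℝ, ← Nat.cast_smul_eq_nsmul ℝ,
    Nat.cast_mul] at h1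
  have h2 := congrArg (((m.factorial : ℝ)⁻¹ * (q.factorial : ℝ)⁻¹) • ·) h1
  simp only [smul_smul] at h2
  rw [mul_mul_mul_comm, inv_mul_cancel₀ hm, inv_mul_cancel₀ hq, one_mul, one_smul] at h2
  rw [h2, mul_comm ((q + m).factorial : ℝ)]

/-- By polarization G also kills l · l'^q, so every commutator with a function of degree 1 satisfies
the hypothesis with lower q and is zero by induction. Then G has order zero but negative degree. -/
theorem eq_zero_of_forall_apply_pow (H : IsFibrewise h) {q : ℕ} {G : Module.End ℝ A}
    (hG : G ∈ coreOrder h q) (h0 : ∀ l ∈ funDegree h 1, G (l ^ q) = 0) : G = 0 := by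
  induction q generalizing G with
  | zero =>
    rw [eq_mulOp_of_mem_order_zero hG.1]
    have := h0 0 (Submodule.zero_mem _)
    rw [pow_zero] at this
    rw [this]
    ext
    simp [mulOp_apply]
  | succ q ih =>
    have key : ∀ l ∈ funDegree h 1, ∀ l' ∈ funDegree h 1, G (l * l' ^ q) = 0 := by
      intro l hl l' hl'
      rw [← Module.forall_dual_apply_eq_zero_iff ℝ]
      intro f
      -- The value of the linear functional f on G((t l + l')^(q+1)) as a polynomial in t. It
      -- vanishes for all real t, and its coefficient of t is (q + 1) f(G(l · l'^q)).
      let P : Polynomial ℝ := ∑ k ∈ Finset.range (q + 1 + 1),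
        Polynomial.monomial k (((q + 1).choose k : ℝ) * f (G (l ^ k * l' ^ (q + 1 - k))))
      have hP : P = 0 := by
        apply Polynomial.funext
        intro t
        have h1 := h0 (t • l + l') (add_mem (Submodule.smul_mem _ t hl) hl')
        rw [add_pow] at h1
        have h2 := congrArg f h1
        rw [map_sum, map_sum, map_zero] at h2
        rw [Polynomial.eval_zero, ← h2, Polynomial.eval_finsetSum]
        refine Finset.sum_congr rfl fun k _ => ?_
        have e : ∀ (n : ℕ) (y : A), (n : A) * y = (n : ℝ) • y := fun n y => by
          rw [Nat.cast_smul_eq_nsmul, nsmul_eq_mul]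
        rw [Polynomial.eval_monomial, smul_pow, smul_mul_assoc, mul_comm _ (Nat.cast _ : A), e]
        simp only [map_smul, smul_eq_mul]
        ring
      have h3 := congrArg (fun P => Polynomial.coeff P 1) hP
      simp only [P, Polynomial.finsetSum_coeff, Polynomial.coeff_monomial, Polynomial.coeff_zero,
        Finset.sum_ite_eq', Finset.mem_range] at h3
      rw [if_pos (by omega), Nat.choose_one_right, pow_one, Nat.add_sub_cancel] at h3
      exact (mul_eq_zero.1 h3).resolve_left (by positivity)
    have hl : ∀ l ∈ funDegree h 1, ⁅G, mulOp l⁆ = 0 := fun l hl => by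
      refine ih (coreOrder_lie_mulOp hG hl) fun l' hl' => ?_
      rw [lie_mulOp_apply, key l hl l' hl', coreOrder_apply_eq_zero H (Nat.lt_succ_self q) hG
        (pow_mem_funDegree hl' q), mul_zero, sub_zero]
    have h0 := H.mem_order_zero hG.1 (fun f hf =>
      H.core_lie_core (mem_coreDO_of_mem_coreOrder hG) (mulOp_mem_coreDO h hf)) hl
    exact H.eq_zero_of_degree h0 hG.2 (by push_cast; omega)

end CoreAlgebra

section Symbol

/-! ### The symbol of a core operator -/

attribute [local instance] LieRing.ofAssociativeRing

variable {EB : Type*} [NormedAddCommGroup EB] [NormedSpace ℝ EB]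
  {M : Type*} [TopologicalSpace M] [ChartedSpace EB M]
  {F : Type*} [NormedAddCommGroup F] [NormedSpace ℝ F]
  {E : M → Type*} [∀ x, AddCommGroup (E x)] [∀ x, Module ℝ (E x)] [∀ x, TopologicalSpace (E x)]
  [TopologicalSpace (TotalSpace F E)] [FiberBundle F E] [VectorBundle ℝ F E]
  [IsManifold 𝓘(ℝ, EB) ∞ M] [ContMDiffVectorBundle ∞ F E 𝓘(ℝ, EB)]
  [FiniteDimensional ℝ EB] [FiniteDimensional ℝ F] [T2Space M] [SecondCountableTopology M]

/-- Near p, Euler's identity writes d as a combination of the u_a with coefficients T_a d of degree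
zero. Core operators are linear over such coefficients, and these vanish at p. -/
theorem core_apply_eq_zero_of_vanishing {G : Module.End ℝ (SmoothFun EB F E)}
    (hG : G ∈ DOcore EB F E) {d : SmoothFun EB F E} (hd : d ∈ funDegree (scaleHom EB F E) 1)
    {p : TotalSpace F E} (hdp : ∀ v : E p.proj, d ⟨p.proj, v⟩ = 0) (g : SmoothFun EB F E) :
    G (d * g) p = 0 := by
  obtain ⟨U, hU, ⟨c⟩⟩ := exists_dualCoordinates EB F E p.proj
  obtain ⟨χ, hχ, hχ1⟩ := exists_bump_near (EB := EB) c.isOpen hU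
  have hone : corePull EB F E χ p = 1 := eq_one_of_mem_oneDom hχ1
  have hcomm : ∀ b ∈ funDegree (scaleHom EB F E) 0, ∀ f, G (b * f) = b * G f := fun b hb f =>
    apply_mul_of_mem_funDegree_zero isFibrewise hG hb f
  have e1 := c.euler_mul hχ hd
  rw [Nat.cast_one, one_smul] at e1
  have e2 : corePull EB F E χ * G (d * g) =
      ∑ a, c.T a d * G (corePull EB F E χ * c.u a * g) := by
    rw [← hcomm _ (corePull_mem EB F E χ), ← mul_assoc, e1, Finset.sum_mul, map_sum]
    refine Finset.sum_congr rfl fun a _ => ?_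
    rw [← hcomm _ (c.T_mem a 0 d hd)]
    congr 1
    ring
  have e3 := congrArg (fun f : SmoothFun EB F E => f p) e2
  have e4 : (corePull EB F E χ * G (d * g)) p = corePull EB F E χ p * G (d * g) p := rfl
  simp only [sum_apply, e4, hone, one_mul] at e3
  rw [e3]
  refine Finset.sum_eq_zero fun a _ => ?_
  have e5 : c.T a d p = 0 := by
    rw [c.T_eq, verticalLift_apply]
    simp only [hdp, deriv_const]
  change c.T a d p * _ = 0
  rw [e5, zero_mul]

/-- Makes the symbol independent of the chosen extension of φ: the factors l are replaced by l' one
at a time. -/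
theorem core_apply_pow_congr {G : Module.End ℝ (SmoothFun EB F E)}
    (hG : G ∈ DOcore EB F E) {l l' : SmoothFun EB F E} (hl : l ∈ funDegree (scaleHom EB F E) 1)
    (hl' : l' ∈ funDegree (scaleHom EB F E) 1) {p : TotalSpace F E}
    (hp : ∀ v : E p.proj, l ⟨p.proj, v⟩ = l' ⟨p.proj, v⟩) (n : ℕ) (g : SmoothFun EB F E) :
    G (l ^ n * g) p = G (l' ^ n * g) p := by
  induction n generalizing g with
  | zero => rw [pow_zero, pow_zero]
  | succ n ih =>
    have h1 := core_apply_eq_zero_of_vanishing hG (sub_mem hl hl') (p := p)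
      (fun v => sub_eq_zero.2 (hp v)) (l ^ n * g)
    rw [sub_mul, map_sub] at h1
    have h2 : G (l * (l ^ n * g)) p = G (l' * (l ^ n * g)) p := sub_eq_zero.1 h1
    rw [pow_succ', mul_assoc, h2, mul_left_comm, ih, pow_succ, mul_assoc]

/-- A function of degree one extends an element of the dual bundle. -/
def Extends (l : SmoothFun EB F E) (φ : TotalSpace (F →L[ℝ] ℝ) (Dual E)) : Prop :=
  ∀ v : E φ.proj, l ⟨φ.proj, v⟩ = pair φ v

theorem extends_of_dualCoordinates {U : Set M} {ι ι' : Type} [Fintype ι] [Fintype ι'] [DecidableEq ι]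
    [DecidableEq ι'] (c : DualCoordinates EB F E U ι ι') (φ : TotalSpace (F →L[ℝ] ℝ) (Dual E))
    (hφ : φ.proj ∈ U) : Extends (∑ a, pair φ (c.s a φ.proj) • c.u a) φ := fun v => by
  rw [sum_apply, c.pair_eq φ v hφ]
  rfl

theorem sum_smul_mem {U : Set M} {ι ι' : Type} [Fintype ι] [Fintype ι'] [DecidableEq ι]
    [DecidableEq ι'] (c : DualCoordinates EB F E U ι ι') (r : ι' → ℝ) :
    (∑ a, r a • c.u a) ∈ funDegree (scaleHom EB F E) 1 :=
  Submodule.sum_mem _ fun a _ => Submodule.smul_mem _ _ (c.u_mem a)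

theorem exists_extends (φ : TotalSpace (F →L[ℝ] ℝ) (Dual E)) :
    ∃ l ∈ funDegree (scaleHom EB F E) 1, Extends l φ := by
  obtain ⟨U, hU, ⟨c⟩⟩ := exists_dualCoordinates EB F E φ.proj
  exact ⟨_, sum_smul_mem c _, extends_of_dualCoordinates c φ hU⟩

theorem exists_extends_of_mem {l : SmoothFun EB F E} (hl : l ∈ funDegree (scaleHom EB F E) 1)
    (x : M) : ∃ φ : Dual E x, Extends l ⟨x, φ⟩ := by
  obtain ⟨U, hU, ⟨c⟩⟩ := exists_dualCoordinates EB F E x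
  choose ψ hψ using fun a => c.coframe a x hU
  refine ⟨∑ a, c.T a l (zeroSection F E x) • ψ a, fun v => ?_⟩
  have h1 := c.euler hl (p := ⟨x, v⟩) hU
  rw [Nat.cast_one, one_mul] at h1
  rw [h1]
  change _ = (∑ a, c.T a l (zeroSection F E x) • ψ a) v
  rw [_root_.sum_apply]
  refine Finset.sum_congr rfl fun a _ => ?_
  rw [← hψ a v, apply_eq_of_mem_funDegree_zero (c.T_mem a 0 l hl)
    (p := (⟨x, v⟩ : TotalSpace F E)) (q := zeroSection F E x) rfl]
  exact mul_comm (pair (⟨x, ψ a⟩ : TotalSpace (F →L[ℝ] ℝ) (Dual E)) v) _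

/-- The value of the symbol of a core operator of order `q`. -/
noncomputable def symbolValue (q : ℕ) (G : Module.End ℝ (SmoothFun EB F E))
    (φ : TotalSpace (F →L[ℝ] ℝ) (Dual E)) : ℝ :=
  (q.factorial : ℝ)⁻¹ * G ((exists_extends (EB := EB) φ).choose ^ q) (zeroSection F E φ.proj)

theorem symbolValue_eq {q : ℕ} {G : Module.End ℝ (SmoothFun EB F E)} (hG : G ∈ DOcore EB F E)
    {φ : TotalSpace (F →L[ℝ] ℝ) (Dual E)} {l : SmoothFun EB F E}
    (hl : l ∈ funDegree (scaleHom EB F E) 1) (hlφ : Extends l φ) :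
    symbolValue q G φ = (q.factorial : ℝ)⁻¹ * G (l ^ q) (zeroSection F E φ.proj) := by
  have h1 := (exists_extends (EB := EB) φ).choose_spec
  have h2 := core_apply_pow_congr hG h1.1 hl (p := zeroSection F E φ.proj)
    (fun v => (h1.2 v).trans (hlφ v).symm) q 1
  rw [mul_one, mul_one] at h2
  rw [symbolValue, h2]

/-- Locally φ extends to Σ φ(s_a) u_a. Expanding its q-th power turns the symbol into a polynomial
in the functions ℓ of the s_a whose coefficients are functions on the base. -/
theorem contMDiff_symbolValue {q : ℕ} {G : Module.End ℝ (SmoothFun EB F E)}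
    (hG : G ∈ DOcore EB F E) :
    ContMDiff (𝓘(ℝ, EB).prod 𝓘(ℝ, F →L[ℝ] ℝ)) 𝓘(ℝ, ℝ) ∞
      (symbolValue q G : TotalSpace (F →L[ℝ] ℝ) (Dual E) → ℝ) := by
  intro φ₀
  obtain ⟨U, hU, ⟨c⟩⟩ := exists_dualCoordinates EB F E φ₀.proj
  let P : SmoothFun EB (F →L[ℝ] ℝ) (Dual E) := (q.factorial : ℝ)⁻¹ • ∑ p : Fin q → Fin (Module.finrank ℝ F),
    (∏ i, linFun EB F (c.s (p i))) *
      corePull EB (F →L[ℝ] ℝ) (Dual E) (restrict (G (∏ i, c.u (p i))))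
  refine (P.contMDiff φ₀).congr_of_eventuallyEq ?_
  filter_upwards [(isOpen_proj_preimage (F := F →L[ℝ] ℝ) (E := Dual E) c.isOpen).mem_nhds hU]
    with φ hφ
  rw [symbolValue_eq hG (sum_smul_mem c _) (extends_of_dualCoordinates c φ hφ), Fintype.sum_pow,
    map_sum, sum_apply]
  change _ = (q.factorial : ℝ)⁻¹ * (∑ p, _ : SmoothFun EB (F →L[ℝ] ℝ) (Dual E)) φ
  rw [sum_apply]
  congr 1
  refine Finset.sum_congr rfl fun p _ => ?_
  rw [Finset.prod_smul, map_smul]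
  change (∏ i, pair φ (c.s (p i) φ.proj)) * _ = (∏ i, linFun EB F (c.s (p i))) φ * _
  congr 1
  exact (map_prod (evalHom φ) (fun i => linFun EB F (c.s (p i))) Finset.univ).symm

end Symbol

section Symbol

attribute [local instance] LieRing.ofAssociativeRing

variable {EB : Type*} [NormedAddCommGroup EB] [NormedSpace ℝ EB]
  {M : Type*} [TopologicalSpace M] [ChartedSpace EB M]
  {F : Type*} [NormedAddCommGroup F] [NormedSpace ℝ F]
  {E : M → Type*} [∀ x, AddCommGroup (E x)] [∀ x, Module ℝ (E x)] [∀ x, TopologicalSpace (E x)]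
  [TopologicalSpace (TotalSpace F E)] [FiberBundle F E] [VectorBundle ℝ F E]
  [IsManifold 𝓘(ℝ, EB) ∞ M] [ContMDiffVectorBundle ∞ F E 𝓘(ℝ, EB)]
  [FiniteDimensional ℝ EB] [FiniteDimensional ℝ F] [T2Space M] [SecondCountableTopology M]

/-- G' maps l^(r+q) to a binomial multiple of G'(l^r) l^q, and G'(l^r) has degree zero, so it can be
pulled out of G. The factorials in the definition of the symbol cancel the binomial coefficient. -/
theorem symbolValue_mul {q r : ℕ} {G G' : Module.End ℝ (SmoothFun EB F E)}
    (hG : G ∈ coreOrder (scaleHom EB F E) q) (hG' : G' ∈ coreOrder (scaleHom EB F E) r)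
    (φ : TotalSpace (F →L[ℝ] ℝ) (Dual E)) :
    symbolValue (q + r) (G * G') φ = symbolValue q G φ * symbolValue r G' φ := by
  obtain ⟨l, hl, hlφ⟩ := exists_extends (EB := EB) φ
  have hc := mem_coreDO_of_mem_coreOrder hG
  have hc' := mem_coreDO_of_mem_coreOrder hG'
  rw [symbolValue_eq (mul_mem hc hc') hl hlφ, symbolValue_eq hc hl hlφ, symbolValue_eq hc' hl hlφ,
    Module.End.mul_apply, add_comm q r, coreOrder_apply_pow' isFibrewise q hG' hl, map_smul,
    apply_mul_of_mem_funDegree_zero isFibrewise hc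
      (coreOrder_apply_mem isFibrewise hG' (k := 0) (pow_mem_funDegree hl r))]
  change (_ : ℝ) * ((_ : ℝ) * ((_ : ℝ) * (_ : ℝ))) = _
  have h1 : ((r + q).factorial : ℝ) ≠ 0 := Nat.cast_ne_zero.2 (Nat.factorial_ne_zero _)
  rw [← mul_assoc, inv_mul_cancel_left₀ h1]
  ring

theorem symbolValue_smul_fibre {q : ℕ} {G : Module.End ℝ (SmoothFun EB F E)}
    (hG : G ∈ DOcore EB F E) (t : ℝ) (φ : TotalSpace (F →L[ℝ] ℝ) (Dual E)) :
    symbolValue q G ⟨φ.proj, t • φ.2⟩ = t ^ q * symbolValue q G φ := by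
  obtain ⟨l, hl, hlφ⟩ := exists_extends (EB := EB) φ
  have h1 : Extends (t • l) (⟨φ.proj, t • φ.2⟩ : TotalSpace (F →L[ℝ] ℝ) (Dual E)) := fun v =>
    congrArg (t * ·) (hlφ v)
  rw [symbolValue_eq hG hl hlφ, symbolValue_eq hG (Submodule.smul_mem _ t hl) h1, smul_pow, map_smul]
  exact mul_left_comm _ _ _

variable (EB F E) in
/-- The symbol of core operators of order `q`. -/
noncomputable def symbolMap (q : ℕ) : coreOrder (scaleHom EB F E) q →ₗ[ℝ]
    funDegree (scaleHom EB (F →L[ℝ] ℝ) (Dual E)) q where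
  toFun G := ⟨⟨symbolValue q G.1, contMDiff_symbolValue (mem_coreDO_of_mem_coreOrder G.2)⟩,
    mem_funDegree_iff.2 (symbolValue_smul_fibre (mem_coreDO_of_mem_coreOrder G.2))⟩
  map_add' G G' := by
    ext φ
    exact mul_add _ _ _
  map_smul' r G := by
    ext φ
    exact mul_left_comm _ _ _

theorem symbolMap_apply (q : ℕ) (G : coreOrder (scaleHom EB F E) q)
    (φ : TotalSpace (F →L[ℝ] ℝ) (Dual E)) :
    (symbolMap EB F E q G : SmoothFun EB (F →L[ℝ] ℝ) (Dual E)) φ = symbolValue q G.1 φ := rfl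

theorem symbolMap_injective (q : ℕ) : Function.Injective (symbolMap EB F E q) := by
  rw [← LinearMap.ker_eq_bot, LinearMap.ker_eq_bot']
  intro G hG
  have hc := mem_coreDO_of_mem_coreOrder G.2
  refine Subtype.ext (eq_zero_of_forall_apply_pow isFibrewise G.2 fun l hl => ?_)
  ext p
  obtain ⟨φ, hφ⟩ := exists_extends_of_mem hl p.proj
  have h1 : symbolValue q G.1 (⟨p.proj, φ⟩ : TotalSpace (F →L[ℝ] ℝ) (Dual E)) = 0 :=
    congrArg (fun f : funDegree (scaleHom EB (F →L[ℝ] ℝ) (Dual E)) q =>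
      (f : SmoothFun EB (F →L[ℝ] ℝ) (Dual E)) (⟨p.proj, φ⟩ : TotalSpace (F →L[ℝ] ℝ) (Dual E))) hG
  rw [symbolValue_eq hc hl hφ] at h1
  have h2 := (mul_eq_zero.1 h1).resolve_left
    (inv_ne_zero (Nat.cast_ne_zero.2 (Nat.factorial_ne_zero _)))
  rw [apply_eq_of_mem_funDegree_zero (coreOrder_apply_mem isFibrewise G.2 (k := 0)
    (pow_mem_funDegree hl q)) (p := p) (q := zeroSection F E p.proj) rfl]
  exact h2

theorem coreFun_mem_coreOrder (b : C^∞⟮𝓘(ℝ, EB), M; 𝓘(ℝ, ℝ), ℝ⟯) :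
    mulOp (corePull EB F E b) ∈ coreOrder (scaleHom EB F E) 0 :=
  ⟨mulOp_mem_order _, mulOp_mem_opDegree _ (corePull_mem EB F E b)⟩

theorem symbolValue_coreFun (b : C^∞⟮𝓘(ℝ, EB), M; 𝓘(ℝ, ℝ), ℝ⟯)
    (φ : TotalSpace (F →L[ℝ] ℝ) (Dual E)) :
    symbolValue 0 (mulOp (corePull EB F E b)) φ = b φ.proj := by
  rw [symbolValue, pow_zero, mulOp_apply, mul_one, Nat.factorial_zero, Nat.cast_one, inv_one,
    one_mul]
  rfl

theorem verticalLift_mem_coreOrder (e : Cₛ^∞⟮𝓘(ℝ, EB); F, E⟯) :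
    (verticalLift EB F e : Module.End ℝ (SmoothFun EB F E)) ∈ coreOrder (scaleHom EB F E) 1 := by
  refine ⟨derivation_mem_order _, (mem_opDegree _).2 fun t ht => ?_⟩
  ext g p
  change deriv (fun s : ℝ => g ⟨p.proj, t⁻¹ • (t • p.2 + s • e p.proj)⟩) 0 =
    t ^ (-((1 : ℕ) : ℤ)) * deriv (fun s : ℝ => g ⟨p.proj, p.2 + s • e p.proj⟩) 0
  have h1 : (fun s : ℝ => g ⟨p.proj, t⁻¹ • (t • p.2 + s • e p.proj)⟩) =
      fun s : ℝ => (fun s : ℝ => g ⟨p.proj, p.2 + s • e p.proj⟩) (t⁻¹ * s) := by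
    funext s
    simp only [smul_add, inv_smul_smul₀ ht, mul_smul]
  rw [h1]
  refine (deriv_comp_mul_left t⁻¹ (fun s : ℝ => g ⟨p.proj, p.2 + s • e p.proj⟩) 0).trans ?_
  simp

theorem symbolValue_verticalLift (e : Cₛ^∞⟮𝓘(ℝ, EB); F, E⟯)
    (φ : TotalSpace (F →L[ℝ] ℝ) (Dual E)) :
    symbolValue 1 (verticalLift EB F e : Module.End ℝ (SmoothFun EB F E)) φ = linFun EB F e φ := by
  obtain ⟨l, hl, hlφ⟩ := exists_extends (EB := EB) φ
  rw [symbolValue_eq (mem_coreDO_of_mem_coreOrder (verticalLift_mem_coreOrder e)) hl hlφ, pow_one, Nat.factorial_one, Nat.cast_one, inv_one,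
    one_mul]
  change deriv (fun s : ℝ => l ⟨φ.proj, 0 + s • e φ.proj⟩) 0 = pair φ (e φ.proj)
  have h1 : (fun s : ℝ => l ⟨φ.proj, 0 + s • e φ.proj⟩) = fun s => s * pair φ (e φ.proj) := by
    funext s
    rw [zero_add, ← hlφ]
    have := apply_smul_of_mem_funDegree hl s ⟨φ.proj, e φ.proj⟩
    rwa [pow_one] at this
  rw [h1]
  simp

/-- Over a coordinate domain of the dual bundle Euler's identity reads (q+1) P = Σ ℓ(s_a) T_a P.
Preimages of the T_a P exist by induction; they are composed with the vertical lifts of the s_a and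
glued. -/
theorem symbolMap_surjective (q : ℕ) : Function.Surjective (symbolMap EB F E q) := by
  induction q with
  | zero =>
    intro P
    refine ⟨⟨_, coreFun_mem_coreOrder (restrict P.1)⟩, ?_⟩
    ext φ
    rw [symbolMap_apply, symbolValue_coreFun]
    exact DFunLike.congr_fun (corePull_restrict P.2) φ
  | succ q ih =>
    intro P
    obtain ⟨𝒜⟩ := exists_coordinateAtlas EB F E
    choose G hG using fun i a => ih ⟨(𝒜.coord i).dual.T a P.1, (𝒜.coord i).dual.T_mem a q P.1 P.2⟩
    let Δ : M → Module.End ℝ (SmoothFun EB F E) := fun i => ∑ a,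
      (verticalLift EB F ((𝒜.coord i).s a) : Module.End ℝ (SmoothFun EB F E)) * (G i a).1
    have hΔa : ∀ i a, (verticalLift EB F ((𝒜.coord i).s a) : Module.End ℝ (SmoothFun EB F E)) *
        (G i a).1 ∈ coreOrder (scaleHom EB F E) (1 + q) := fun i a => by
      have h1 := verticalLift_mem_coreOrder (EB := EB) (F := F) ((𝒜.coord i).s a)
      refine ⟨order_mul h1.1 (G i a).2.1, ?_⟩
      have := opDegree_mul _ h1.2 (G i a).2.2
      rwa [show -((1 : ℕ) : ℤ) + -(q : ℤ) = -((1 + q : ℕ) : ℤ) by push_cast; ring] at this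
    have hΔ : ∀ i, Δ i ∈ coreOrder (scaleHom EB F E) (q + 1) := fun i => by
      rw [add_comm]
      exact Submodule.sum_mem _ fun a _ => hΔa i a
    have hglue : glue 𝒜.locallyFinite Δ ∈ coreOrder (scaleHom EB F E) (q + 1) :=
      ⟨glue_mem_order _ fun i => (hΔ i).1, glue_mem_opDegree _ fun i => (hΔ i).2⟩
    refine ⟨((q + 1 : ℕ) : ℝ)⁻¹ • ⟨glue 𝒜.locallyFinite Δ, hglue⟩, ?_⟩
    rw [map_smul]
    ext φ
    change ((q + 1 : ℕ) : ℝ)⁻¹ * symbolValue (q + 1) (glue 𝒜.locallyFinite Δ) φ = P.1 φ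
    have h1 : symbolValue (q + 1) (glue 𝒜.locallyFinite Δ) φ =
        ∑ i ∈ indicesAt 𝒜.locallyFinite φ.proj, 𝒜.ρ i φ.proj * symbolValue (q + 1) (Δ i) φ := by
      rw [symbolValue, glue_apply, Finset.mul_sum]
      exact Finset.sum_congr rfl fun i _ => mul_left_comm _ _ _
    have h2 : ∀ i ∈ indicesAt 𝒜.locallyFinite φ.proj,
        symbolValue (q + 1) (Δ i) φ = ((q + 1 : ℕ) : ℝ) * P.1 φ := fun i hi => by
      have h3 : symbolValue (q + 1) (Δ i) φ = ∑ a, symbolValue (q + 1)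
          ((verticalLift EB F ((𝒜.coord i).s a) : Module.End ℝ (SmoothFun EB F E)) * (G i a).1)
            φ := by
        rw [symbolValue, LinearMap.sum_apply, sum_apply, Finset.mul_sum]
        rfl
      rw [h3, (𝒜.coord i).dual.euler P.2 (𝒜.mem_of_mem_indicesAt hi)]
      refine Finset.sum_congr rfl fun a _ => ?_
      have h4 := symbolValue_mul (verticalLift_mem_coreOrder ((𝒜.coord i).s a)) (G i a).2 φ
      rw [add_comm 1 q] at h4
      rw [h4, symbolValue_verticalLift, (𝒜.coord i).dual_u, ← symbolMap_apply, hG]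
    have hq : ((q + 1 : ℕ) : ℝ) ≠ 0 := by positivity
    rw [h1, Finset.sum_congr rfl fun i hi => by rw [h2 i hi], ← Finset.sum_mul, 𝒜.sum_eq_one,
      one_mul, inv_mul_cancel_left₀ hq]

end Symbol

section Graded

/-! ### Graded decompositions -/

attribute [local instance] LieRing.ofAssociativeRing

/-- The elements of a sum of independent submodules as finitely supported families. -/
noncomputable def sumEquiv {V : Type*} [AddCommGroup V] [Module ℝ V] {p : ℕ → Submodule ℝ V}
    (hp : iSupIndep p) : (Π₀ i, p i) ≃ₗ[ℝ] (⨆ i, p i : Submodule ℝ V) :=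
  (LinearEquiv.ofInjective _ hp.dfinsupp_lsum_injective).trans
    (LinearEquiv.ofEq _ _ (Submodule.iSup_eq_range_dfinsupp_lsum p).symm)

theorem sumEquiv_single {V : Type*} [AddCommGroup V] [Module ℝ V] {p : ℕ → Submodule ℝ V}
    (hp : iSupIndep p) (i : ℕ) (x : p i) : (sumEquiv hp (DFinsupp.single i x) : V) = x := by
  change DFinsupp.lsum ℕ (fun i => (p i).subtype) (DFinsupp.single i x) = x
  rw [DFinsupp.lsum_single]
  rfl

variable {A : Type*} [CommRing A] [Algebra ℝ A] (h : ℝ →* (A →ₐ[ℝ] A))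

/-- Scaling by 2 already separates the degrees: the pieces lie in eigenspaces for distinct
eigenvalues. -/
theorem iSupIndep_funDegree : iSupIndep (funDegree h) := by
  have h1 := Module.End.eigenspaces_iSupIndep (h 2).toLinearMap
  have h2 : Function.Injective fun k : ℕ => (2 : ℝ) ^ k := pow_right_injective₀ (by norm_num) (by norm_num)
  exact (h1.comp h2).mono fun k f hf => Module.End.mem_eigenspace_iff.2 (hf 2)

theorem iSupIndep_coreOrder : iSupIndep (coreOrder h) := by
  have h1 := Module.End.eigenspaces_iSupIndep (pull h 2)
  have h2 : Function.Injective fun k : ℕ => (2 : ℝ) ^ (-(k : ℤ)) := fun k l hkl => by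
    have := zpow_right_injective₀ (by norm_num : (0 : ℝ) < 2) (by norm_num) hkl
    simpa using this
  exact (h1.comp h2).mono fun k f hf => Module.End.mem_eigenspace_iff.2
    ((mem_opDegree h).1 hf.2 2 two_ne_zero)

variable {h}

theorem coreOrder_mul {q r : ℕ} {G G' : Module.End ℝ A} (hG : G ∈ coreOrder h q)
    (hG' : G' ∈ coreOrder h r) : G * G' ∈ coreOrder h (q + r) := by
  refine ⟨order_mul hG.1 hG'.1, ?_⟩
  have := opDegree_mul h hG.2 hG'.2
  rwa [show -(q : ℤ) + -(r : ℤ) = -((q + r : ℕ) : ℤ) by push_cast; ring] at this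

theorem coreDO_induction {P : coreDO h → Prop} (h1 : ∀ q (G : Module.End ℝ A)
    (hG : G ∈ coreOrder h q), P ⟨G, mem_coreDO_of_mem_coreOrder hG⟩)
    (h2 : ∀ G G', P G → P G' → P (G + G')) (G : coreDO h) : P G := by
  obtain ⟨G, hG⟩ := G
  have key : ∀ hG : G ∈ ⨆ q, coreOrder h q, P ⟨G, ⟨hG⟩⟩ := by
    clear hG
    intro hG
    induction hG using Submodule.iSup_induction' with
    | mem q x hx => exact h1 q x hx
    | zero => exact h1 0 0 (Submodule.zero_mem _)
    | add x y hx hy ihx ihy => exact h2 ⟨x, ⟨hx⟩⟩ ⟨y, ⟨hy⟩⟩ ihx ihy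
  exact key hG.mem

theorem map_mul_of_coreOrder {B : Type*} [Ring B] [Algebra ℝ B] (f : coreDO h →ₗ[ℝ] B)
    (hf : ∀ (q r : ℕ) (G : Module.End ℝ A) (hG : G ∈ coreOrder h q) (G' : Module.End ℝ A)
      (hG' : G' ∈ coreOrder h r), f ⟨G * G', mem_coreDO_of_mem_coreOrder (coreOrder_mul hG hG')⟩ =
        f ⟨G, mem_coreDO_of_mem_coreOrder hG⟩ * f ⟨G', mem_coreDO_of_mem_coreOrder hG'⟩)
    (G G' : coreDO h) : f (G * G') = f G * f G' := by
  refine coreDO_induction (P := fun G => f (G * G') = f G * f G') (fun q G hG => ?_)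
    (fun G₁ G₂ h1 h2 => by rw [add_mul, map_add, h1, h2, map_add, add_mul]) G
  exact coreDO_induction (P := fun G' => f (⟨G, mem_coreDO_of_mem_coreOrder hG⟩ * G') =
    f ⟨G, mem_coreDO_of_mem_coreOrder hG⟩ * f G') (fun r G' hG' => hf q r G hG G' hG')
    (fun G₁ G₂ h1 h2 => by rw [mul_add, map_add, h1, h2, map_add, mul_add]) G'

/-- Core operators as a sum of submodules. -/
def coreEquiv : coreDO h ≃ₗ[ℝ] (⨆ q, coreOrder h q : Submodule ℝ (Module.End ℝ A)) where
  toFun G := ⟨G.1, G.2.mem⟩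
  invFun G := ⟨G.1, ⟨G.2⟩⟩
  map_add' _ _ := rfl
  map_smul' _ _ := rfl

/-- Polynomial elements as a sum of submodules. -/
def polyEquiv : polyFun h ≃ₗ[ℝ] (⨆ q, funDegree h q : Submodule ℝ A) where
  toFun G := ⟨G.1, G.2⟩
  invFun G := ⟨G.1, G.2⟩
  map_add' _ _ := rfl
  map_smul' _ _ := rfl

end Graded

section Phi

/-! ### The isomorphism between core operators and polynomial functions on the dual bundle -/

attribute [local instance] LieRing.ofAssociativeRing

variable {EB : Type*} [NormedAddCommGroup EB] [NormedSpace ℝ EB]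
  {M : Type*} [TopologicalSpace M] [ChartedSpace EB M]
  {F : Type*} [NormedAddCommGroup F] [NormedSpace ℝ F]
  {E : M → Type*} [∀ x, AddCommGroup (E x)] [∀ x, Module ℝ (E x)] [∀ x, TopologicalSpace (E x)]
  [TopologicalSpace (TotalSpace F E)] [FiberBundle F E] [VectorBundle ℝ F E]
  [IsManifold 𝓘(ℝ, EB) ∞ M] [ContMDiffVectorBundle ∞ F E 𝓘(ℝ, EB)]
  [FiniteDimensional ℝ EB] [FiniteDimensional ℝ F] [T2Space M] [SecondCountableTopology M]

variable (EB F E) in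
/-- The symbol of core operators of all orders, as a linear map. -/
noncomputable def coreLinearEquiv : DOcore EB F E ≃ₗ[ℝ] PolyFunDual EB F E :=
  coreEquiv.trans <| (sumEquiv (iSupIndep_coreOrder (scaleHom EB F E))).symm.trans <|
    (DFinsupp.mapRange.linearEquiv fun q => LinearEquiv.ofBijective (symbolMap EB F E q)
      ⟨symbolMap_injective q, symbolMap_surjective q⟩).trans <|
    (sumEquiv (iSupIndep_funDegree (scaleHom EB (F →L[ℝ] ℝ) (Dual E)))).trans polyEquiv.symm

theorem coreLinearEquiv_apply {q : ℕ} {G : Module.End ℝ (SmoothFun EB F E)}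
    (hG : G ∈ coreOrder (scaleHom EB F E) q) :
    coreLinearEquiv EB F E ⟨G, mem_coreDO_of_mem_coreOrder hG⟩ =
      ⟨symbolMap EB F E q ⟨G, hG⟩, mem_polyFun (symbolMap EB F E q ⟨G, hG⟩).2⟩ := by
  have h1 : coreEquiv ⟨G, mem_coreDO_of_mem_coreOrder hG⟩ =
      sumEquiv (iSupIndep_coreOrder (scaleHom EB F E)) (DFinsupp.single q ⟨G, hG⟩) :=
    Subtype.ext (sumEquiv_single _ q ⟨G, hG⟩).symm
  simp only [coreLinearEquiv, LinearEquiv.trans_apply]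
  rw [h1, LinearEquiv.symm_apply_apply]
  apply Subtype.ext
  have h2 : (DFinsupp.mapRange.linearEquiv fun q => LinearEquiv.ofBijective (symbolMap EB F E q)
      ⟨symbolMap_injective q, symbolMap_surjective q⟩) (DFinsupp.single q ⟨G, hG⟩) =
      DFinsupp.single q (symbolMap EB F E q ⟨G, hG⟩) :=
    DFinsupp.mapRange_single (hf := fun i => map_zero (symbolMap EB F E i))
  rw [h2]
  exact sumEquiv_single (iSupIndep_funDegree (scaleHom EB (F →L[ℝ] ℝ) (Dual E))) q _

attribute [irreducible] coreLinearEquiv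

theorem coreLinearEquiv_mul (G G' : DOcore EB F E) :
    coreLinearEquiv EB F E (G * G') = coreLinearEquiv EB F E G * coreLinearEquiv EB F E G' := by
  refine map_mul_of_coreOrder (coreLinearEquiv EB F E).toLinearMap (fun q r G hG G' hG' => ?_) G G'
  simp only [LinearEquiv.coe_coe]
  rw [coreLinearEquiv_apply hG, coreLinearEquiv_apply hG',
    coreLinearEquiv_apply (coreOrder_mul hG hG')]
  apply Subtype.ext
  ext φ
  exact symbolValue_mul hG hG' φ

variable (EB F E) in
/-- The canonical isomorphism of the algebra of core operators with the algebra of polynomial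
functions on the dual bundle. -/
noncomputable def coreAlgEquiv : DOcore EB F E ≃ₐ[ℝ] PolyFunDual EB F E :=
  AlgEquiv.ofLinearEquiv (coreLinearEquiv EB F E) (by
    have h1 : (1 : DOcore EB F E) = ⟨_, mem_coreDO_of_mem_coreOrder
        (coreFun_mem_coreOrder (EB := EB) (F := F) (E := E) 1)⟩ :=
      Subtype.ext (LinearMap.ext fun g => (one_mul g).symm)
    rw [h1, coreLinearEquiv_apply (coreFun_mem_coreOrder (EB := EB) (F := F) (E := E) 1)]
    apply Subtype.ext
    ext φ
    exact symbolValue_coreFun 1 φ) coreLinearEquiv_mul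

theorem coreAlgEquiv_apply {q : ℕ} {G : Module.End ℝ (SmoothFun EB F E)}
    (hG : G ∈ coreOrder (scaleHom EB F E) q) :
    coreAlgEquiv EB F E ⟨G, mem_coreDO_of_mem_coreOrder hG⟩ =
      ⟨symbolMap EB F E q ⟨G, hG⟩, mem_polyFun (symbolMap EB F E q ⟨G, hG⟩).2⟩ :=
  coreLinearEquiv_apply hG

theorem coreAlgEquiv_coreFun (f : C^∞⟮𝓘(ℝ, EB), M; 𝓘(ℝ, ℝ), ℝ⟯) :
    coreAlgEquiv EB F E (coreFun EB F E f) = polyPull EB F E f := by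
  refine (coreAlgEquiv_apply (coreFun_mem_coreOrder f)).trans (Subtype.ext ?_)
  ext φ
  exact symbolValue_coreFun f φ

theorem coreAlgEquiv_coreField (e : Cₛ^∞⟮𝓘(ℝ, EB); F, E⟯) :
    coreAlgEquiv EB F E (coreField EB F e) = polyLin EB F e := by
  refine (coreAlgEquiv_apply (verticalLift_mem_coreOrder e)).trans (Subtype.ext ?_)
  ext φ
  exact symbolValue_verticalLift e φ

theorem coreAlgEquiv_symm_mem {q : ℕ} {P : PolyFunDual EB F E}
    (hP : (P : SmoothFun EB (F →L[ℝ] ℝ) (Dual E)) ∈ funDegree (scaleHom EB (F →L[ℝ] ℝ) (Dual E)) q) :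
    ((coreAlgEquiv EB F E).symm P : Module.End ℝ (SmoothFun EB F E)) ∈
      coreOrder (scaleHom EB F E) q := by
  obtain ⟨G, hG⟩ := symbolMap_surjective (EB := EB) q ⟨P.1, hP⟩
  have : (coreAlgEquiv EB F E).symm P = ⟨G.1, mem_coreDO_of_mem_coreOrder G.2⟩ := by
    rw [AlgEquiv.symm_apply_eq, coreAlgEquiv_apply G.2]
    apply Subtype.ext
    change _ = (symbolMap EB F E q G : SmoothFun EB (F →L[ℝ] ℝ) (Dual E))
    rw [hG]
  rw [this]
  exact G.2

/-- Composing Ψ with the inverse of the canonical isomorphism and evaluating at φ gives a character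
of the polynomial functions. It agrees with evaluation on base functions and fibre coordinates,
hence everywhere. -/
theorem eq_coreAlgEquiv (Ψ : DOcore EB F E →ₐ[ℝ] PolyFunDual EB F E)
    (h0 : ∀ f, Ψ (coreFun EB F E f) = polyPull EB F E f)
    (h1 : ∀ e : Cₛ^∞⟮𝓘(ℝ, EB); F, E⟯, Ψ (coreField EB F e) = polyLin EB F e) :
    Ψ = (coreAlgEquiv EB F E).toAlgHom := by
  ext G φ
  obtain ⟨U, hU, ⟨c⟩⟩ := exists_dualCoordinates EB F E φ.proj
  let δ : PolyFunDual EB F E →ₐ[ℝ] ℝ := ((evalHom φ).comp (PolyFunDual EB F E).val).comp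
    (Ψ.comp (coreAlgEquiv EB F E).symm.toAlgHom)
  have hδ : ∀ G, δ (coreAlgEquiv EB F E G) = (Ψ G : SmoothFun EB (F →L[ℝ] ℝ) (Dual E)) φ :=
    fun G => by
      change (Ψ ((coreAlgEquiv EB F E).symm (coreAlgEquiv EB F E G)) :
        SmoothFun EB (F →L[ℝ] ℝ) (Dual E)) φ = _
      rw [AlgEquiv.symm_apply_apply]
  rw [← hδ]
  refine c.dual.polyCharacter_eq hU δ (fun b => ?_) (fun a => ?_) _
  · have h2 := hδ (coreFun EB F E b)
    rw [coreAlgEquiv_coreFun, h0] at h2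
    exact h2
  · have h2 := hδ (coreField EB F (c.s a))
    rw [coreAlgEquiv_coreField, h1] at h2
    have h3 : (⟨c.dual.u a, mem_polyFun (c.dual.u_mem a)⟩ : PolyFunDual EB F E) =
        polyLin EB F (c.s a) := Subtype.ext (c.dual_u a)
    rw [h3, h2, c.dual_u]
    rfl

end Phi

section Extension

/-! ### Extension of derivations of polynomial functions -/

attribute [local instance] LieRing.ofAssociativeRing

variable {EB : Type*} [NormedAddCommGroup EB] [NormedSpace ℝ EB]
  {M : Type*} [TopologicalSpace M] [ChartedSpace EB M]
  {F : Type*} [NormedAddCommGroup F] [NormedSpace ℝ F]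
  {E : M → Type*} [∀ x, AddCommGroup (E x)] [∀ x, Module ℝ (E x)] [∀ x, TopologicalSpace (E x)]
  [TopologicalSpace (TotalSpace F E)] [FiberBundle F E] [VectorBundle ℝ F E]
  [IsManifold 𝓘(ℝ, EB) ∞ M] [ContMDiffVectorBundle ∞ F E 𝓘(ℝ, EB)]
  [FiniteDimensional ℝ EB] [FiniteDimensional ℝ F] [T2Space M] [SecondCountableTopology M]

theorem sum_derivation_apply {κ A : Type*} [CommRing A] [Algebra ℝ A] (s : Finset κ)
    (X : κ → Derivation ℝ A A) (f : A) : (∑ i ∈ s, X i) f = ∑ i ∈ s, X i f := by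
  induction s using Finset.cons_induction with
  | empty => rfl
  | cons a s ha ih => rw [Finset.sum_cons, Finset.sum_cons, ← ih]; rfl

theorem sum_mul_leibniz {κ : Type*} (s : Finset κ) (a b b' : κ → ℝ) (r r' : ℝ) :
    ∑ i ∈ s, a i * (r * b i + r' * b' i) = r * ∑ i ∈ s, a i * b i + r' * ∑ i ∈ s, a i * b' i := by
  rw [Finset.mul_sum, Finset.mul_sum, ← Finset.sum_add_distrib]
  exact Finset.sum_congr rfl fun i _ => by ring

namespace Coordinates

variable {U : Set M} {ι ι' : Type} [Fintype ι] [Fintype ι'] [DecidableEq ι] [DecidableEq ι']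
  (c : Coordinates EB F E U ι ι')

/-- The coordinate `u a` as a polynomial function. -/
def polyU (a : ι') : polyFun (scaleHom EB F E) := ⟨c.u a, mem_polyFun (c.u_mem a)⟩

/-- The difference of the two sides is again a point derivation and vanishes on the coordinates. -/
theorem polyPointDerivation_eq {p : TotalSpace F E} (hp : p.proj ∈ U)
    (δ : polyFun (scaleHom EB F E) →ₗ[ℝ] ℝ)
    (hδ : ∀ f g, δ (f * g) = (f : SmoothFun EB F E) p * δ g + (g : SmoothFun EB F E) p * δ f)
    (f : polyFun (scaleHom EB F E)) :
    δ f = ∑ i, δ (polyBase EB F E (c.x i)) * c.H i f p + ∑ a, δ (c.polyU a) * c.T a f p := by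
  let inc : SmoothFun EB F E →ₗ[ℝ] ℝ := (evalHom p).toLinearMap
  let sub := (polyFun (scaleHom EB F E)).val.toLinearMap
  let δ' : polyFun (scaleHom EB F E) →ₗ[ℝ] ℝ := δ -
    (∑ i, δ (polyBase EB F E (c.x i)) • inc ∘ₗ (c.H i : SmoothFun EB F E →ₗ[ℝ] _) ∘ₗ sub +
      ∑ a, δ (c.polyU a) • inc ∘ₗ (c.T a : SmoothFun EB F E →ₗ[ℝ] _) ∘ₗ sub)
  have hδ' : ∀ f, δ' f = δ f - (∑ i, δ (polyBase EB F E (c.x i)) * c.H i f p +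
      ∑ a, δ (c.polyU a) * c.T a f p) := fun f => by
    simp only [δ', LinearMap.sub_apply, LinearMap.add_apply, LinearMap.sum_apply]
    rfl
  have h0 : δ' = 0 := by
    refine c.polyPointDerivation_eq_zero hp δ' (fun f g => ?_) (fun i => ?_) fun a => ?_
    · have h1 : ∀ X : Derivation ℝ (SmoothFun EB F E) (SmoothFun EB F E),
          X ((f * g : polyFun (scaleHom EB F E)) : SmoothFun EB F E) p =
            (f : SmoothFun EB F E) p * X g p + (g : SmoothFun EB F E) p * X f p := fun X => by
        change X ((f : SmoothFun EB F E) * g) p = _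
        rw [Derivation.leibniz]
        rfl
      rw [hδ', hδ', hδ', hδ]
      simp only [h1, sum_mul_leibniz]
      ring
    · rw [hδ', sub_eq_zero]
      have h1 : ∀ a, c.T a (polyBase EB F E (c.x i) : SmoothFun EB F E) = 0 := fun a =>
        c.T_zero a _ (corePull_mem EB F E _)
      have h2 : ∀ j, c.H j (polyBase EB F E (c.x i) : SmoothFun EB F E) p = if j = i then 1 else 0 :=
        fun j => c.H_x j i p hp
      simp only [h1, h2, mul_ite, mul_one, mul_zero, Finset.sum_ite_eq', Finset.mem_univ, if_true]
      change _ = _ + ∑ a, δ (c.polyU a) * 0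
      simp
    · change δ' (c.polyU a) = 0
      rw [hδ', sub_eq_zero]
      have h1 : ∀ i, c.H i (c.polyU a : SmoothFun EB F E) p = 0 := fun i => c.H_u i a p hp
      have h2 : ∀ b, c.T b (c.polyU a : SmoothFun EB F E) p = if b = a then 1 else 0 :=
        fun b => c.T_u b a p hp
      simp only [h1, h2, mul_ite, mul_one, mul_zero, Finset.sum_ite_eq', Finset.mem_univ, if_true,
        Finset.sum_const_zero, zero_add]
  rw [← sub_eq_zero, ← hδ', h0, LinearMap.zero_apply]

end Coordinates

/-- A derivation of the algebra of polynomial functions with values in smooth functions extends to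
a vector field. -/
theorem exists_derivation_extending (D : polyFun (scaleHom EB F E) →ₗ[ℝ] SmoothFun EB F E)
    (hD : ∀ f g, D (f * g) = (f : SmoothFun EB F E) * D g + (g : SmoothFun EB F E) * D f) :
    ∃ X : Derivation ℝ (SmoothFun EB F E) (SmoothFun EB F E),
      ∀ f : polyFun (scaleHom EB F E), X f = D f := by
  obtain ⟨𝒜⟩ := exists_coordinateAtlas EB F E
  -- The coordinate expression of D makes sense on all smooth functions. Over each coordinate domain
  -- it reproduces D on polynomial functions, so every weighted average does too.
  refine ⟨glueDerivation 𝒜.locallyFinite fun i =>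
    ∑ j, D (polyBase EB F E ((𝒜.coord i).x j)) • (𝒜.coord i).H j +
    ∑ a, D ((𝒜.coord i).polyU a) • (𝒜.coord i).T a, fun f => ?_⟩
  ext p
  rw [glueDerivation_apply]
  have h1 : ∀ i ∈ indicesAt 𝒜.locallyFinite p.proj,
      (∑ j, D (polyBase EB F E ((𝒜.coord i).x j)) • (𝒜.coord i).H j +
        ∑ a, D ((𝒜.coord i).polyU a) • (𝒜.coord i).T a) (f : SmoothFun EB F E) p = D f p :=
    fun i hi => by
      have h2 := (𝒜.coord i).polyPointDerivation_eq (𝒜.mem_of_mem_indicesAt hi)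
        ((evalHom p).toLinearMap ∘ₗ D)
        (fun f g => congrArg (fun f : SmoothFun EB F E => f p) (hD f g)) f
      refine Eq.trans ?_ h2.symm
      rw [Derivation.add_apply, sum_derivation_apply, sum_derivation_apply]
      change (∑ j, _ : SmoothFun EB F E) p + (∑ a, _ : SmoothFun EB F E) p = _
      rw [sum_apply, sum_apply]
      rfl
  rw [Finset.sum_congr rfl fun i hi => by rw [h1 i hi], ← Finset.sum_mul, 𝒜.sum_eq_one, one_mul]

theorem derivation_ext {X Y : Derivation ℝ (SmoothFun EB F E) (SmoothFun EB F E)}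
    (h : ∀ f ∈ polyFun (scaleHom EB F E), X f = Y f) : X = Y := by
  rw [← sub_eq_zero]
  refine derivation_eq_zero (fun f hf => ?_) fun f hf => ?_ <;>
  · rw [Derivation.sub_apply, h f (mem_polyFun hf), sub_self]

end Extension

section Adjoint

/-! ### Lie-Rinehart structures and the adjoint action -/

attribute [local instance] LieRing.ofAssociativeRing

variable {A : Type*} [CommRing A] [Algebra ℝ A] {h : ℝ →* (A →ₐ[ℝ] A)}

theorem lie_core_mul (Δ : linDO h) (G G' : coreDO h) :
    ⁅Δ, G * G'⁆ = G * ⁅Δ, G'⁆ + ⁅Δ, G⁆ * G' := by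
  apply Subtype.ext
  change Δ.1 * (G.1 * G'.1) - (G.1 * G'.1) * Δ.1 =
    G.1 * (Δ.1 * G'.1 - G'.1 * Δ.1) + (Δ.1 * G.1 - G.1 * Δ.1) * G'.1
  rw [mul_sub, sub_mul, mul_assoc, mul_assoc, mul_assoc]
  abel

/-- Linearity of the anchor over the core algebra; this is the Lie-Rinehart axiom that needs core
operators to commute. -/
theorem IsFibrewise.core_smul_lie (H : IsFibrewise h) (G : coreDO h) (Δ : linDO h)
    (G' : coreDO h) : ⁅G • Δ, G'⁆ = G * ⁅Δ, G'⁆ := by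
  have hc : G.1 * G'.1 = G'.1 * G.1 := congrArg Subtype.val (H.core_mul_comm G G')
  apply Subtype.ext
  change G.1 * Δ.1 * G'.1 - G'.1 * (G.1 * Δ.1) = G.1 * (Δ.1 * G'.1 - G'.1 * Δ.1)
  rw [← mul_assoc G'.1, ← hc, mul_sub, mul_assoc, mul_assoc]

theorem lie_core_smul (Δ Δ' : linDO h) (G : coreDO h) :
    ⁅Δ, G • Δ'⁆ = G • ⁅Δ, Δ'⁆ + ⁅Δ, G⁆ • Δ' := by
  apply Subtype.ext
  change Δ.1 * (G.1 * Δ'.1) - (G.1 * Δ'.1) * Δ.1 =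
    G.1 * (Δ.1 * Δ'.1 - Δ'.1 * Δ.1) + (Δ.1 * G.1 - G.1 * Δ.1) * Δ'.1
  rw [mul_sub, sub_mul, mul_assoc, mul_assoc, mul_assoc]
  abel

theorem lie_real_smul (r : ℝ) (Δ : linDO h) (G : coreDO h) : ⁅Δ, r • G⁆ = r • ⁅Δ, G⁆ :=
  Subtype.ext (lie_smul r Δ.1 G.1)

theorem real_smul_lie (r : ℝ) (Δ : linDO h) (G : coreDO h) : ⁅r • Δ, G⁆ = r • ⁅Δ, G⁆ :=
  Subtype.ext (smul_lie r Δ.1 G.1)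

theorem IsFibrewise.lieRinehart_linDO (H : IsFibrewise h) :
    letI : CommRing (coreDO h) := coreCommRing h H.core_mul_comm
    ∃ _ : LieRinehartRing (coreDO h) (linDO h), LieRinehartAlgebra ℝ (coreDO h) (linDO h) := by
  let _ : CommRing (coreDO h) := coreCommRing h H.core_mul_comm
  have h1 : LieRinehartRing (coreDO h) (linDO h) :=
    { lie_smul_eq_mul' := fun G G' Δ => H.core_smul_lie G Δ G'
      leibniz_mul_right' := fun Δ G G' => lie_core_mul Δ G G'
      leibniz_smul_right' := fun Δ Δ' G => lie_core_smul Δ Δ' G }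
  exact ⟨h1,
    { smul_assoc := fun r G Δ => Subtype.ext (smul_mul_assoc r G.1 Δ.1)
      smul_lie := real_smul_lie
      lie_smul := lie_real_smul }⟩

theorem IsFibrewise.core_lie_eq_zero (H : IsFibrewise h) (G G' : coreDO h) : ⁅G, G'⁆ = 0 :=
  sub_eq_zero.2 (H.core_mul_comm G G')

theorem IsFibrewise.lieRinehart_coreDO (H : IsFibrewise h) :
    letI : CommRing (coreDO h) := coreCommRing h H.core_mul_comm
    ∃ _ : LieRinehartRing (coreDO h) (coreDO h), LieRinehartAlgebra ℝ (coreDO h) (coreDO h) := by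
  let _ : CommRing (coreDO h) := coreCommRing h H.core_mul_comm
  have h0 := H.core_lie_eq_zero
  have h1 : LieRinehartRing (coreDO h) (coreDO h) :=
    { lie_smul_eq_mul' := fun G G' Δ => (h0 _ _).trans ((congrArg (G * ·) (h0 _ _)).trans
        (mul_zero G)).symm
      leibniz_mul_right' := fun Δ G G' => by
        refine (h0 _ _).trans (Eq.symm ?_)
        have e1 := h0 Δ G
        have e2 := h0 Δ G'
        change G * ⁅Δ, G'⁆ + ⁅Δ, G⁆ * G' = 0
        rw [e1, e2, mul_zero, zero_mul, add_zero]
      leibniz_smul_right' := fun Δ Δ' G => by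
        refine (h0 _ _).trans (Eq.symm ?_)
        have e1 := h0 Δ G
        have e2 := h0 Δ Δ'
        change G * ⁅Δ, Δ'⁆ + ⁅Δ, G⁆ * Δ' = 0
        rw [e1, e2, mul_zero, zero_mul, add_zero] }
  exact ⟨h1,
    { smul_assoc := fun r G Δ => Subtype.ext (smul_mul_assoc r G.1 Δ.1)
      smul_lie := fun r G G' => Subtype.ext (smul_lie r G.1 G'.1)
      lie_smul := fun r G G' => Subtype.ext (lie_smul r G.1 G'.1) }⟩

variable {B : Type*} [CommRing B] [Algebra ℝ B] {h' : ℝ →* (B →ₐ[ℝ] B)}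

/-- Polynomial vector fields are determined by, and can be prescribed by, their action on
polynomial functions. -/
structure HasPolyExtension (h' : ℝ →* (B →ₐ[ℝ] B)) : Prop where
  exists_field : ∀ D : polyFun h' →ₗ[ℝ] polyFun h', (∀ f g, D (f * g) = f * D g + g * D f) →
    ∃ X : polyVF h', ∀ f : polyFun h', ⁅X, f⁆ = D f
  ext : ∀ X Y : polyVF h', (∀ f : polyFun h', ⁅X, f⁆ = ⁅Y, f⁆) → X = Y

namespace HasPolyExtension

variable (K : HasPolyExtension h') (Φ : coreDO h ≃ₐ[ℝ] polyFun h')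

include K in
-- The commutator with Δ is a derivation of the core algebra. Transported along Φ it is a derivation
-- of polynomial functions, which extends to a vector field.
theorem exists_adjoint (Δ : linDO h) : ∃ X : polyVF h', ∀ G : coreDO h, ⁅X, Φ G⁆ = Φ ⁅Δ, G⁆ := by
  let D : polyFun h' →ₗ[ℝ] polyFun h' :=
    { toFun := fun f => Φ ⁅Δ, Φ.symm f⁆
      map_add' := fun f g => by rw [map_add, lie_add, map_add]
      map_smul' := fun r f => by rw [map_smul, lie_real_smul, map_smul]; rfl }
  obtain ⟨X, hX⟩ := K.exists_field D fun f g => by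
    change Φ ⁅Δ, Φ.symm (f * g)⁆ = f * Φ ⁅Δ, Φ.symm g⁆ + g * Φ ⁅Δ, Φ.symm f⁆
    rw [map_mul, lie_core_mul, map_add, map_mul, map_mul, AlgEquiv.apply_symm_apply,
      AlgEquiv.apply_symm_apply, mul_comm g]
  refine ⟨X, fun G => ?_⟩
  rw [hX]
  change Φ ⁅Δ, Φ.symm (Φ G)⁆ = _
  rw [AlgEquiv.symm_apply_apply]

/-- The polynomial vector field that corresponds to the adjoint action of a fibrewise linear
operator on core operators. -/
noncomputable def adjoint (Δ : linDO h) : polyVF h' := (K.exists_adjoint Φ Δ).choose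

theorem adjoint_lie (Δ : linDO h) (G : coreDO h) : ⁅K.adjoint Φ Δ, Φ G⁆ = Φ ⁅Δ, G⁆ :=
  (K.exists_adjoint Φ Δ).choose_spec G

theorem eq_adjoint_iff {Δ : linDO h} {X : polyVF h'} :
    X = K.adjoint Φ Δ ↔ ∀ G : coreDO h, ⁅X, Φ G⁆ = Φ ⁅Δ, G⁆ := by
  refine ⟨fun e => e ▸ K.adjoint_lie Φ Δ, fun e => K.ext _ _ fun f => ?_⟩
  obtain ⟨G, rfl⟩ := Φ.surjective f
  rw [e, adjoint_lie]

theorem adjoint_add (Δ Δ' : linDO h) :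
    K.adjoint Φ (Δ + Δ') = K.adjoint Φ Δ + K.adjoint Φ Δ' :=
  ((K.eq_adjoint_iff Φ).2 fun G => by
    rw [add_lie, adjoint_lie, adjoint_lie, add_lie, map_add]).symm

theorem adjoint_smul (r : ℝ) (Δ : linDO h) : K.adjoint Φ (r • Δ) = r • K.adjoint Φ Δ :=
  ((K.eq_adjoint_iff Φ).2 fun G => by
    rw [real_smul_lie, map_smul, smul_lie, adjoint_lie]).symm

theorem adjoint_lie_lie (Δ Δ' : linDO h) :
    K.adjoint Φ ⁅Δ, Δ'⁆ = ⁅K.adjoint Φ Δ, K.adjoint Φ Δ'⁆ :=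
  ((K.eq_adjoint_iff Φ).2 fun G => by
    rw [lie_lie, adjoint_lie, adjoint_lie, adjoint_lie, adjoint_lie, ← map_sub, lie_lie]).symm

theorem adjoint_core_smul (H : IsFibrewise h) (G : coreDO h) (Δ : linDO h) :
    K.adjoint Φ (G • Δ) = Φ G • K.adjoint Φ Δ :=
  ((K.eq_adjoint_iff Φ).2 fun G' => by
    rw [H.core_smul_lie, map_mul, ← K.adjoint_lie Φ]
    rfl).symm

/-- Exactness in the middle is the statement that the core algebra is its own centralizer. -/
theorem adjoint_eq_zero_iff (H : IsFibrewise h) (Δ : linDO h) :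
    K.adjoint Φ Δ = 0 ↔ (Δ : Module.End ℝ A) ∈ coreDO h := by
  rw [H.mem_coreDO_iff, eq_comm, eq_adjoint_iff]
  constructor
  · refine fun e => ⟨((H.mem_linDO_iff _).1 Δ.2).1, fun G hG => ?_⟩
    have h1 := e ⟨G, hG⟩
    rw [zero_lie, eq_comm, map_eq_zero_iff Φ Φ.injective] at h1
    exact congrArg Subtype.val h1
  · intro e G
    have h1 : ⁅Δ, G⁆ = 0 := Subtype.ext (e.2 G G.2)
    rw [zero_lie, h1, map_zero]

include K in
/-- The exact sequence of Lie-Rinehart algebras given by the adjoint action, provided that every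
polynomial vector field comes from a fibrewise linear operator. -/
theorem exactSequence (H : IsFibrewise h)
    (hs : ∀ X : polyVF h', ∃ Δ : linDO h, ∀ G : coreDO h, ⁅X, Φ G⁆ = Φ ⁅Δ, G⁆) :
    letI : CommRing (coreDO h) := coreCommRing h H.core_mul_comm
    ∃ (ι : LieRinehartAlgebra.Hom (AlgHom.id ℝ (coreDO h)) (coreDO h) (linDO h))
      (ad : LieRinehartAlgebra.Hom Φ.toAlgHom (linDO h) (polyVF h')),
      (∀ G, (ι G : Module.End ℝ A) = G) ∧
      (∀ (Δ : linDO h) (X : polyVF h'),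
        X = ad Δ ↔ ∀ G : coreDO h, ⁅X, Φ G⁆ = Φ ⁅Δ, G⁆) ∧
      Function.Injective ι ∧ Function.Exact ι ad ∧ Function.Surjective ad := by
  let _ : CommRing (coreDO h) := coreCommRing h H.core_mul_comm
  let ι : LieRinehartAlgebra.Hom (AlgHom.id ℝ (coreDO h)) (coreDO h) (linDO h) :=
    { toFun := fun G => ⟨G.1, coreDO_le_linDO h G.2⟩
      map_add' := fun _ _ => rfl
      map_smul' := fun _ _ => rfl
      map_lie' := rfl
      map_smul_apply' := fun _ _ => rfl
      apply_lie' := fun _ _ => rfl }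
  let ad : LieRinehartAlgebra.Hom Φ.toAlgHom (linDO h) (polyVF h') :=
    { toFun := K.adjoint Φ
      map_add' := K.adjoint_add Φ
      map_smul' := K.adjoint_smul Φ
      map_lie' := K.adjoint_lie_lie Φ _ _
      map_smul_apply' := K.adjoint_core_smul Φ H
      apply_lie' := fun G Δ => (K.adjoint_lie Φ Δ G).symm }
  refine ⟨ι, ad, fun _ => rfl, fun Δ X => K.eq_adjoint_iff Φ, fun G G' e => Subtype.ext
    (congrArg (fun Δ : linDO h => (Δ : Module.End ℝ A)) e), fun Δ => ?_, fun X => ?_⟩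
  · refine (K.adjoint_eq_zero_iff Φ H Δ).trans ⟨fun hΔ => ⟨⟨Δ.1, hΔ⟩, rfl⟩, ?_⟩
    rintro ⟨G, rfl⟩
    exact G.2
  · obtain ⟨Δ, hΔ⟩ := hs X
    exact ⟨Δ, ((K.eq_adjoint_iff Φ).2 hΔ).symm⟩

end HasPolyExtension

end Adjoint

section Bound

/-! ### Polynomial vector fields raise the fibre degree by a bounded amount -/

variable {EB : Type*} [NormedAddCommGroup EB] [NormedSpace ℝ EB]
  {M : Type*} [TopologicalSpace M] [ChartedSpace EB M]
  {F : Type*} [NormedAddCommGroup F] [NormedSpace ℝ F]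
  {E : M → Type*} [∀ x, AddCommGroup (E x)] [∀ x, Module ℝ (E x)] [∀ x, TopologicalSpace (E x)]
  [TopologicalSpace (TotalSpace F E)] [FiberBundle F E] [VectorBundle ℝ F E]

/-- The restriction of `f` to the fibre over `y` is polynomial of degree at most `n` on each line
through the origin. -/
def HasFibreDegree (f : SmoothFun EB F E) (y : M) (n : ℕ) : Prop :=
  ∀ v : E y, ∃ q : Polynomial ℝ, q.natDegree ≤ n ∧ ∀ t : ℝ, f ⟨y, t • v⟩ = q.eval t

namespace HasFibreDegree

variable {f g : SmoothFun EB F E} {y : M} {n m : ℕ}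

theorem mono (hf : HasFibreDegree f y n) (hnm : n ≤ m) : HasFibreDegree f y m := fun v => by
  obtain ⟨q, hq, hq'⟩ := hf v
  exact ⟨q, hq.trans hnm, hq'⟩

theorem add (hf : HasFibreDegree f y n) (hg : HasFibreDegree g y n) :
    HasFibreDegree (f + g) y n := fun v => by
  obtain ⟨q, hq, hq'⟩ := hf v
  obtain ⟨r, hr, hr'⟩ := hg v
  refine ⟨q + r, Polynomial.natDegree_add_le_of_degree_le hq hr, fun t => ?_⟩
  rw [Polynomial.eval_add, ← hq', ← hr']
  rfl

theorem mul (hf : HasFibreDegree f y n) (hg : HasFibreDegree g y m) :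
    HasFibreDegree (f * g) y (n + m) := fun v => by
  obtain ⟨q, hq, hq'⟩ := hf v
  obtain ⟨r, hr, hr'⟩ := hg v
  refine ⟨q * r, Polynomial.natDegree_mul_le.trans (add_le_add hq hr), fun t => ?_⟩
  rw [Polynomial.eval_mul, ← hq', ← hr']
  rfl

theorem congr (hf : HasFibreDegree f y n) (hfg : ∀ v : E y, g ⟨y, v⟩ = f ⟨y, v⟩) :
    HasFibreDegree g y n := fun v => by
  obtain ⟨q, hq, hq'⟩ := hf v
  exact ⟨q, hq, fun t => (hfg _).trans (hq' t)⟩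

theorem of_mem {k : ℕ} (hf : f ∈ funDegree (scaleHom EB F E) k) (y : M) :
    HasFibreDegree f y k := fun v =>
  ⟨Polynomial.C (f ⟨y, v⟩) * Polynomial.X ^ k, Polynomial.natDegree_C_mul_X_pow_le _ _, fun t => by
    rw [Polynomial.eval_mul, Polynomial.eval_C, Polynomial.eval_pow, Polynomial.eval_X, mul_comm]
    exact mem_funDegree_iff.1 hf t ⟨y, v⟩⟩

theorem zero : HasFibreDegree (0 : SmoothFun EB F E) y n :=
  fun v => ⟨0, by simp, fun t => Polynomial.eval_zero.symm⟩

theorem sum {κ : Type*} {s : Finset κ} {f : κ → SmoothFun EB F E}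
    (hf : ∀ i ∈ s, HasFibreDegree (f i) y n) : HasFibreDegree (∑ i ∈ s, f i) y n :=
  Finset.sum_induction _ (HasFibreDegree · y n) (fun _ _ => add) zero hf

end HasFibreDegree

theorem exists_hasFibreDegree (f : polyFun (scaleHom EB F E)) :
    ∃ n, ∀ y, HasFibreDegree (f : SmoothFun EB F E) y n := by
  refine polyFun_induction (P := fun f => ∃ n, ∀ y, HasFibreDegree (f : SmoothFun EB F E) y n)
    (fun k f hf => ⟨k, .of_mem hf⟩) (fun f g hf hg => ?_) f
  obtain ⟨n, hn⟩ := hf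
  obtain ⟨m, hm⟩ := hg
  exact ⟨max n m, fun y => ((hn y).mono (le_max_left _ _)).add ((hm y).mono (le_max_right _ _))⟩

variable [IsManifold 𝓘(ℝ, EB) ∞ M] [ContMDiffVectorBundle ∞ F E 𝓘(ℝ, EB)]
  [FiniteDimensional ℝ EB] [FiniteDimensional ℝ F] [T2Space M] [SecondCountableTopology M]

theorem derivation_congr_of_eqOn (X : Derivation ℝ (SmoothFun EB F E) (SmoothFun EB F E))
    {f g : SmoothFun EB F E} {V : Set M} (hV : IsOpen V)
    (hfg : ∀ p : TotalSpace F E, p.proj ∈ V → f p = g p) {p : TotalSpace F E} (hp : p.proj ∈ V) :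
    X f p = X g p := by
  obtain ⟨χ, hχ, hχ1⟩ := exists_bump_near (EB := EB) hV hp
  have h0 : corePull EB F E χ * (f - g) = 0 := by
    ext q
    change χ q.proj * (f q - g q) = 0
    by_cases hq : q.proj ∈ V
    · rw [hfg q hq, sub_self, mul_zero]
    · rw [image_eq_zero_of_notMem_tsupport fun h => hq (hχ h), zero_mul]
  have h1 := congrArg (fun f : SmoothFun EB F E => f p) (congrArg X h0)
  rw [Derivation.leibniz, map_zero, map_sub] at h1
  change χ p.proj * (X f p - X g p) + (f p - g p) * X (corePull EB F E χ) p = 0 at h1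
  rw [hfg p hp, sub_self, zero_mul, add_zero, eq_one_of_mem_oneDom hχ1, one_mul] at h1
  exact sub_eq_zero.1 h1

/-- In coordinates X is a combination of the finitely many X(x_i) and X(u_a), each of some fibre
degree, with derivatives of f of degree at most j. The bound is independent of f. -/
theorem exists_local_degree_bound (X : polyVF (scaleHom EB F E)) (j : ℕ) (x : M) :
    ∃ n, ∀ᶠ y in nhds x, ∀ f ∈ funDegree (scaleHom EB F E) j, HasFibreDegree (X.1 f) y n := by
  obtain ⟨U, hU, ⟨c⟩⟩ := exists_dualCoordinates EB F E x
  choose n hn using fun i => exists_hasFibreDegree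
    (⟨X.1 (corePull EB F E (c.x i)), X.2 _ (mem_polyFun (corePull_mem EB F E _))⟩ :
      polyFun (scaleHom EB F E))
  choose m hm using fun a => exists_hasFibreDegree
    (⟨X.1 (c.u a), X.2 _ (mem_polyFun (c.u_mem a))⟩ : polyFun (scaleHom EB F E))
  refine ⟨(∑ i, n i + ∑ a, m a) + j, ?_⟩
  filter_upwards [c.isOpen.mem_nhds hU] with y hy f hf
  have h1 : HasFibreDegree (∑ i, X.1 (corePull EB F E (c.x i)) * c.H i f +
      ∑ a, X.1 (c.u a) * c.T a f) y ((∑ i, n i + ∑ a, m a) + j) := by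
    refine .add (.sum fun i _ => ?_) (.sum fun a _ => ?_)
    · refine ((hn i y).mul (.of_mem (c.H_mem i j f hf) y)).mono ?_
      have := Finset.single_le_sum (fun i _ => Nat.zero_le (n i)) (Finset.mem_univ i)
      omega
    · have h2 : HasFibreDegree (c.T a f) y j := by
        cases j with
        | zero => rw [c.T_zero a f hf]; exact .zero
        | succ j => exact (HasFibreDegree.of_mem (c.T_mem a j f hf) y).mono j.le_succ
      refine ((hm a y).mul h2).mono ?_
      have := Finset.single_le_sum (fun i _ => Nat.zero_le (m i)) (Finset.mem_univ a)
      omega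
  refine h1.congr fun v => ?_
  have h3 := c.polyPointDerivation_eq (p := ⟨y, v⟩) hy
    ((evalHom ⟨y, v⟩).toLinearMap ∘ₗ (X.1 : SmoothFun EB F E →ₗ[ℝ] SmoothFun EB F E) ∘ₗ
      (polyFun (scaleHom EB F E)).val.toLinearMap) (fun f g => by
        change X.1 ((f : SmoothFun EB F E) * g) ⟨y, v⟩ = _
        rw [Derivation.leibniz]
        rfl) ⟨f, mem_polyFun hf⟩
  refine h3.trans ?_
  change _ = (∑ i, X.1 (corePull EB F E (c.x i)) * c.H i f : SmoothFun EB F E) ⟨y, v⟩ +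
    (∑ a, X.1 (c.u a) * c.T a f : SmoothFun EB F E) ⟨y, v⟩
  rw [sum_apply, sum_apply]
  rfl

/-- A smooth function on the base that bounds the fibre degrees. -/
theorem exists_smooth_degree_bound (X : polyVF (scaleHom EB F E)) (j : ℕ) :
    ∃ g : C^∞⟮𝓘(ℝ, EB), M; 𝓘(ℝ, ℝ), ℝ⟯, ∀ y, ∀ f ∈ funDegree (scaleHom EB F E) j,
      ∀ n : ℕ, g y ≤ n → HasFibreDegree (X.1 f) y n := by
  have : LocallyCompactSpace M := ChartedSpace.locallyCompactSpace EB M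
  let t : M → Set ℝ := fun y => {r | ∀ f ∈ funDegree (scaleHom EB F E) j, ∀ n : ℕ, r ≤ n →
    HasFibreDegree (X.1 f) y n}
  -- The admissible bounds at y are upward closed, hence convex, so constant local bounds can be
  -- averaged by a partition of unity into one smooth function.
  have ht : ∀ y, Convex ℝ (t y) := fun y => by
    have hu : IsUpperSet (t y) := fun a b hab ha f hf n hn => ha f hf n (hab.trans hn)
    exact hu.ordConnected.convex
  obtain ⟨g, hg⟩ := exists_contMDiffMap_forall_mem_convex_of_local_const 𝓘(ℝ, EB) (n := ⊤) ht
    fun x => by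
      obtain ⟨n, hn⟩ := exists_local_degree_bound X j x
      refine ⟨n, hn.mono fun y hy f hf m hm => (hy f hf).mono (by exact_mod_cast hm)⟩
  exact ⟨g, hg⟩

/-- Each new index exceeds the previous value of g by at least 2, and g at the new point exceeds the
index. -/
theorem exists_spaced_sequence (y : ℕ → M) (g : M → ℝ) (hg : ∀ n : ℕ, n < g (y n)) :
    ∃ n : ℕ → ℕ, (∀ k, k ≤ n k) ∧ ∀ k l, k ≠ l → 2 ≤ |g (y (n k)) - g (y (n l))| := by
  let n : ℕ → ℕ := fun k => k.rec 0 fun k r => ⌈g (y r)⌉₊ + r + 2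
  have h1 : ∀ k, n (k + 1) = ⌈g (y (n k))⌉₊ + n k + 2 := fun k => rfl
  have h2 : ∀ k, g (y (n k)) + 2 ≤ g (y (n (k + 1))) := fun k => by
    have e1 := hg (n (k + 1))
    have e2 := Nat.le_ceil (g (y (n k)))
    have e3 : (n (k + 1) : ℝ) = ⌈g (y (n k))⌉₊ + n k + 2 := by rw [h1]; push_cast; ring
    have e4 : (0 : ℝ) ≤ n k := by positivity
    linarith
  have h3 : ∀ k m, g (y (n k)) + 2 ≤ g (y (n (k + m + 1))) := fun k m => by
    induction m with
    | zero => exact h2 k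
    | succ m ih =>
      have := h2 (k + m + 1)
      rw [← add_assoc]
      linarith
  refine ⟨n, fun k => ?_, fun k l hkl => ?_⟩
  · induction k with
    | zero => exact Nat.zero_le _
    | succ k ih => rw [h1]; omega
  · rcases lt_or_gt_of_ne hkl with h | h
    · obtain ⟨m, rfl⟩ := Nat.exists_eq_add_of_lt h
      rw [abs_sub_comm]
      exact le_trans (by linarith [h3 k m]) (le_abs_self _)
    · obtain ⟨m, rfl⟩ := Nat.exists_eq_add_of_lt h
      exact le_trans (by linarith [h3 l m]) (le_abs_self _)

/-- Otherwise there are f_n of degree j such that X f_n violates the degree bound n over some point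
y_n. The smooth bound g is unbounded along the y_n, so after thinning out, cut-offs depending on g
alone are locally finite. The sum of the cut-off f_n has degree j, but its image under X has no
bounded fibre degree. -/
theorem exists_degree_bound (X : polyVF (scaleHom EB F E)) (j : ℕ) :
    ∃ n, ∀ f ∈ funDegree (scaleHom EB F E) j, ∀ y, HasFibreDegree (X.1 f) y n := by
  by_contra! hX
  choose f hf y hy using hX
  obtain ⟨g, hg⟩ := exists_smooth_degree_bound X j
  obtain ⟨n, hn, hspace⟩ := exists_spaced_sequence y g fun n => by
    by_contra! h
    exact hy n (hg _ _ (hf n) n h)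
  -- The values of g at the chosen points are at least 2 apart, so a set on which g varies by less
  -- than 1/4 from one value meets at most one support: two would force a gap below 3/2.
  let β : ContDiffBump (0 : ℝ) := ⟨1 / 4, 1 / 2, by norm_num, by norm_num⟩
  let ρ : ℕ → C^∞⟮𝓘(ℝ, EB), M; 𝓘(ℝ, ℝ), ℝ⟯ := fun k =>
    ⟨fun x => β (g x - g (y (n k))),
      (β.contDiff (n := ⊤)).contMDiff.comp (g.contMDiff.sub contMDiff_const)⟩
  have hρ0 : ∀ k x, ρ k x ≠ 0 → |g x - g (y (n k))| < 1 / 2 := fun k x hk => by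
    by_contra! h
    refine hk (β.zero_of_le_dist ?_)
    rw [Real.dist_eq, sub_zero]
    exact h
  have hρ1 : ∀ k x, |g x - g (y (n k))| ≤ 1 / 4 → ρ k x = 1 := fun k x hk => by
    refine β.one_of_mem_closedBall ?_
    rw [Metric.mem_closedBall, Real.dist_eq, sub_zero]
    exact hk
  have hcont : Continuous g := g.contMDiff.continuous
  have hρ : LocallyFinite fun k => Function.support (ρ k) := fun x => by
    refine ⟨{z | |g z - g x| < 1 / 4},
      (isOpen_lt (hcont.sub continuous_const).abs continuous_const).mem_nhds (by simp), ?_⟩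
    refine Set.Subsingleton.finite ?_
    rintro k ⟨z, hz, hz'⟩ l ⟨w, hw, hw'⟩
    by_contra hkl
    have e1 := hρ0 k z hz
    have e2 := hρ0 l w hw
    have e3 := hspace k l hkl
    have e4 : |g z - g x| < 1 / 4 := hz'
    have e5 : |g w - g x| < 1 / 4 := hw'
    rw [abs_lt] at e1 e2 e4 e5
    rcases le_abs.1 e3 with e3 | e3 <;> linarith
  let f' := locSum hρ fun k => f (n k)
  have hf' : f' ∈ funDegree (scaleHom EB F E) j := locSum_mem hρ fun k => hf (n k)
  obtain ⟨N, hN⟩ := exists_hasFibreDegree (⟨X.1 f', X.2 _ (mem_polyFun hf')⟩ :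
    polyFun (scaleHom EB F E))
  -- Over y (n N) only the N-th summand is present, with coefficient locally 1, so X has the same
  -- values there on the sum and on f (n N). The bound N ≤ n N contradicts the choice of the latter.
  refine hy (n N) (((hN (y (n N))).mono (hn N)).congr fun v => ?_)
  refine derivation_congr_of_eqOn X.1 (V := {z | |g z - g (y (n N))| < 1 / 4})
    (isOpen_lt (hcont.sub continuous_const).abs continuous_const) (fun p hp => ?_)
    (show |g (y (n N)) - g (y (n N))| < 1 / 4 by simp)
  have h1 : |g p.proj - g (y (n N))| < 1 / 4 := hp
  have h2 : ρ N p.proj = 1 := hρ1 N _ h1.le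
  rw [locSum_apply, Finset.sum_eq_single N, h2, one_mul]
  · intro k hk hkN
    exfalso
    have e1 := hρ0 k _ (ne_zero_of_mem_indicesAt hk)
    have e2 := hspace k N hkN
    have e3 := abs_sub_le (g (y (n k))) (g p.proj) (g (y (n N)))
    rw [abs_sub_comm (g (y (n k))) (g p.proj)] at e3
    linarith
  · intro h
    exact absurd (mem_indicesAt (by rw [h2]; exact one_ne_zero)) h

end Bound

/-! ### Polynomial vector fields as derivations of polynomial functions -/

section PolyExtension

attribute [local instance] LieRing.ofAssociativeRing

variable {EB : Type*} [NormedAddCommGroup EB] [NormedSpace ℝ EB]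
  {M : Type*} [TopologicalSpace M] [ChartedSpace EB M]
  {F : Type*} [NormedAddCommGroup F] [NormedSpace ℝ F]
  {E : M → Type*} [∀ x, AddCommGroup (E x)] [∀ x, Module ℝ (E x)] [∀ x, TopologicalSpace (E x)]
  [TopologicalSpace (TotalSpace F E)] [FiberBundle F E] [VectorBundle ℝ F E]
  [IsManifold 𝓘(ℝ, EB) ∞ M] [ContMDiffVectorBundle ∞ F E 𝓘(ℝ, EB)]
  [FiniteDimensional ℝ EB] [FiniteDimensional ℝ F] [T2Space M] [SecondCountableTopology M]

theorem hasPolyExtension : HasPolyExtension (scaleHom EB F E) where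
  exists_field D hD := by
    obtain ⟨X, hX⟩ := exists_derivation_extending ((polyFun (scaleHom EB F E)).val.toLinearMap ∘ₗ D)
      fun f g => congrArg Subtype.val (hD f g)
    refine ⟨⟨X, fun f hf => ?_⟩, fun f => Subtype.ext (hX f)⟩
    rw [hX ⟨f, hf⟩]
    exact (D ⟨f, hf⟩).2
  ext X Y h := Subtype.ext (derivation_ext fun f hf => congrArg Subtype.val (h ⟨f, hf⟩))

end PolyExtension

section UpTo

/-! ### Core and fibrewise linear operators of bounded order -/

attribute [local instance] LieRing.ofAssociativeRing

variable {A : Type*} [CommRing A] [Algebra ℝ A] {h : ℝ →* (A →ₐ[ℝ] A)}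

/-- A derivation that preserves functions of degree zero and functions of degree one has degree
zero. -/
theorem IsFibrewise.derivation_mem_opDegree_zero (H : IsFibrewise h) {X : Derivation ℝ A A}
    (h0 : ∀ f ∈ funDegree h 0, X f ∈ funDegree h 0) (h1 : ∀ f ∈ funDegree h 1, X f ∈ funDegree h 1) :
    (X : Module.End ℝ A) ∈ opDegree h 0 := by
  refine (mem_opDegree h).2 fun t ht => ?_
  -- Conjugation by an algebra automorphism preserves derivations, so X can be compared with its
  -- conjugate on functions of degree 0 and 1 alone.
  let Y : Derivation ℝ A A := Derivation.mk' (pull h t (X : Module.End ℝ A)) fun f g => by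
    rw [pull_apply_apply, pull_apply_apply, pull_apply_apply, map_mul, Derivation.coeFn_coe,
      Derivation.leibniz, map_add, smul_eq_mul, smul_eq_mul, map_mul, map_mul,
      scale_scale_inv h ht, scale_scale_inv h ht]
    rfl
  have hY : ∀ f, Y f = h t (X (h t⁻¹ f)) := fun f => rfl
  have key : ∀ k f, f ∈ funDegree h k → X f ∈ funDegree h k → (Y - X) f = 0 := fun k f hf hXf => by
    rw [Derivation.sub_apply, hY, hf t⁻¹, X.map_smul, map_smul, hXf t, smul_smul, ← mul_pow,
      inv_mul_cancel₀ ht, one_pow, one_smul, sub_self]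
  have h2 := H.derivation_eq_zero (Y - X) (fun f hf => key 0 f hf (h0 f hf)) fun f hf =>
    key 1 f hf (h1 f hf)
  ext f
  have h3 : Y f = X f := congrArg (fun Z : Derivation ℝ A A => Z f) (sub_eq_zero.1 h2)
  rw [zpow_zero, one_smul]
  exact h3

variable (h) in
/-- Sums of core operators of orders less than `n`. -/
def coreUpTo (n : ℕ) : Submodule ℝ (Module.End ℝ A) := ⨆ k ∈ Finset.range n, coreOrder h k

variable (h) in
/-- Sums of fibrewise linear operators of orders less than `n`. -/
def linUpTo (n : ℕ) : Submodule ℝ (Module.End ℝ A) := ⨆ k ∈ Finset.range n, linOrder h k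

theorem mem_linUpTo {n k : ℕ} (hk : k < n) {Δ : Module.End ℝ A} (hΔ : Δ ∈ linOrder h k) :
    Δ ∈ linUpTo h n :=
  Submodule.mem_iSup_of_mem k (Submodule.mem_iSup_of_mem (Finset.mem_range.2 hk) hΔ)

theorem mem_coreUpTo {n k : ℕ} (hk : k < n) {Δ : Module.End ℝ A} (hΔ : Δ ∈ coreOrder h k) :
    Δ ∈ coreUpTo h n :=
  Submodule.mem_iSup_of_mem k (Submodule.mem_iSup_of_mem (Finset.mem_range.2 hk) hΔ)

theorem mul_mem_linUpTo {n : ℕ} {G Δ : Module.End ℝ A} (hG : G ∈ coreUpTo h n)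
    (hΔ : Δ ∈ linOrder h 1) : G * Δ ∈ linUpTo h (n + 1) := by
  have : coreUpTo h n ≤ (linUpTo h (n + 1)).comap (LinearMap.mulRight ℝ Δ) := by
    refine iSup₂_le fun k hk G hG => mem_linUpTo (k := k + 1) ?_ ⟨order_mul hG.1 hΔ.1, ?_⟩
    · exact Nat.succ_lt_succ (Finset.mem_range.1 hk)
    · have := opDegree_mul h hG.2 hΔ.2
      rwa [show -(k : ℤ) + (-((1 : ℕ) : ℤ) + 1) = -((k + 1 : ℕ) : ℤ) + 1 by push_cast; ring] at this
  exact this hG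

theorem mulOp_mul_mem_linUpTo {n : ℕ} {G : Module.End ℝ A} (hG : G ∈ coreUpTo h n) {u : A}
    (hu : u ∈ funDegree h 1) : mulOp u * G ∈ linUpTo h (n + 1) := by
  have : coreUpTo h n ≤ (linUpTo h (n + 1)).comap (LinearMap.mulLeft ℝ (mulOp u)) := by
    refine iSup₂_le fun k hk G hG => mem_linUpTo (k := k) ?_ ⟨?_, ?_⟩
    · exact Nat.lt_succ_of_lt (Finset.mem_range.1 hk)
    · have := order_mul (q := 0) (mulOp_mem_order u) hG.1
      rwa [zero_add] at this
    · have := opDegree_mul h (mulOp_mem_opDegree h hu) hG.2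
      rwa [show ((1 : ℕ) : ℤ) + -(k : ℤ) = -(k : ℤ) + 1 by push_cast; ring] at this
  exact this hG

section Transport

variable {B : Type*} [CommRing B] [Algebra ℝ B] {h' : ℝ →* (B →ₐ[ℝ] B)}
  (Φ : coreDO h ≃ₐ[ℝ] polyFun h') (X : polyVF h')

/-- The derivation of the algebra of core operators that corresponds to a polynomial vector
field. -/
noncomputable def coreDerivation : coreDO h →ₗ[ℝ] coreDO h where
  toFun G := Φ.symm ⁅X, Φ G⁆
  map_add' G G' := by rw [map_add, lie_add, map_add]
  map_smul' r G := by rw [map_smul, lie_smul, map_smul]; rfl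

theorem apply_coreDerivation (G : coreDO h) : Φ (coreDerivation Φ X G) = ⁅X, Φ G⁆ :=
  Φ.apply_symm_apply _

theorem coreDerivation_mul (G G' : coreDO h) : coreDerivation Φ X (G * G') =
    G * coreDerivation Φ X G' + coreDerivation Φ X G * G' := by
  apply Φ.injective
  rw [apply_coreDerivation, map_add, map_mul, map_mul, map_mul, apply_coreDerivation,
    apply_coreDerivation]
  exact LieRinehartRing.leibniz_mul_right X _ _

end Transport

end UpTo

/-! ### Gluing operators of uniformly bounded order -/

section BoundedOrder

attribute [local instance] LieRing.ofAssociativeRing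

variable {EB : Type*} [NormedAddCommGroup EB] [NormedSpace ℝ EB]
  {M : Type*} [TopologicalSpace M] [ChartedSpace EB M]
  {F : Type*} [NormedAddCommGroup F] [NormedSpace ℝ F]
  {E : M → Type*} [∀ x, AddCommGroup (E x)] [∀ x, Module ℝ (E x)] [∀ x, TopologicalSpace (E x)]
  [TopologicalSpace (TotalSpace F E)] [FiberBundle F E] [VectorBundle ℝ F E]

/-- The homogeneous components are glued order by order. The common bound n keeps the number of
resulting summands finite. -/
theorem glue_mem_linDO {κ : Type*} {ρ : κ → C^∞⟮𝓘(ℝ, EB), M; 𝓘(ℝ, ℝ), ℝ⟯}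
    (hρ : LocallyFinite fun i => Function.support (ρ i)) {n : ℕ}
    {Δ : κ → Module.End ℝ (SmoothFun EB F E)} (hΔ : ∀ i, Δ i ∈ linUpTo (scaleHom EB F E) n) :
    glue hρ Δ ∈ linDO (scaleHom EB F E) := by
  choose μ hμ using fun i => (Submodule.mem_iSup_finset_iff_exists_sum _ _).1 (hΔ i)
  have h1 : glue hρ Δ = ∑ k ∈ Finset.range n, glue hρ fun i => (μ i k).1 := by
    ext f p
    rw [LinearMap.sum_apply, sum_apply, glue_apply]
    simp only [glue_apply]
    rw [Finset.sum_comm]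
    refine Finset.sum_congr rfl fun i _ => ?_
    rw [← hμ i, LinearMap.sum_apply, sum_apply, Finset.mul_sum]
  rw [h1]
  refine sum_mem fun k _ => ⟨Submodule.mem_iSup_of_mem k ⟨?_, ?_⟩⟩
  · exact glue_mem_order hρ fun i => (μ i k).2.1
  · exact glue_mem_opDegree hρ fun i => (μ i k).2.2

/-- On each line through the origin the homogeneous components are the coefficients of the
polynomial, so those above n vanish. -/
theorem mem_iSup_funDegree_of_hasFibreDegree {n : ℕ} {f : SmoothFun EB F E}
    (hf : f ∈ polyFun (scaleHom EB F E)) (hn : ∀ y, HasFibreDegree f y n) :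
    f ∈ ⨆ k ∈ Finset.range (n + 1), funDegree (scaleHom EB F E) k := by
  obtain ⟨w, hw, rfl⟩ := (Submodule.mem_iSup_iff_exists_finsupp _ _).1
    (show f ∈ ⨆ k, funDegree (scaleHom EB F E) k from hf)
  refine Submodule.sum_mem _ fun k hk => Submodule.mem_iSup_of_mem k
    (Submodule.mem_iSup_of_mem (Finset.mem_range.2 ?_) (hw k))
  by_contra hkn
  refine Finsupp.mem_support_iff.1 hk ?_
  ext p
  obtain ⟨q, hq, hq'⟩ := hn p.proj p.2
  have h1 : q = ∑ i ∈ w.support, Polynomial.C (w i p) * Polynomial.X ^ i := by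
    refine Polynomial.funext fun t => ?_
    rw [← hq', Polynomial.eval_finsetSum, Finsupp.sum, sum_apply]
    refine Finset.sum_congr rfl fun i _ => ?_
    rw [Polynomial.eval_mul, Polynomial.eval_C, Polynomial.eval_pow, Polynomial.eval_X, mul_comm]
    exact apply_smul_of_mem_funDegree (hw i) t p
  have h2 : q.coeff k = w k p := by
    rw [h1, Polynomial.finsetSum_coeff, Finset.sum_eq_single k]
    · simp
    · intro i _ hik
      rw [Polynomial.coeff_C_mul_X_pow, if_neg (Ne.symm hik)]
    · exact fun h => absurd hk h
  rw [← h2, Polynomial.coeff_eq_zero_of_natDegree_lt (by omega)]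
  rfl

variable [IsManifold 𝓘(ℝ, EB) ∞ M] [ContMDiffVectorBundle ∞ F E 𝓘(ℝ, EB)]
  [FiniteDimensional ℝ EB] [FiniteDimensional ℝ F] [T2Space M] [SecondCountableTopology M]

theorem coreAlgEquiv_symm_mem_coreUpTo {n : ℕ} {P : PolyFunDual EB F E}
    (hP : ∀ y, HasFibreDegree (P : SmoothFun EB (F →L[ℝ] ℝ) (Dual E)) y n) :
    ((coreAlgEquiv EB F E).symm P : Module.End ℝ (SmoothFun EB F E)) ∈
      coreUpTo (scaleHom EB F E) (n + 1) := by
  obtain ⟨μ, hμ⟩ := (Submodule.mem_iSup_finset_iff_exists_sum _ _).1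
    (mem_iSup_funDegree_of_hasFibreDegree P.2 hP)
  have h1 : P = ∑ k ∈ Finset.range (n + 1), (⟨(μ k).1, mem_polyFun (μ k).2⟩ : PolyFunDual EB F E) := by
    apply Subtype.ext
    rw [AddSubmonoidClass.coe_finsetSum]
    exact hμ.symm
  rw [h1, map_sum, AddSubmonoidClass.coe_finsetSum]
  exact Submodule.sum_mem _ fun k hk =>
    mem_coreUpTo (Finset.mem_range.1 hk) (coreAlgEquiv_symm_mem (μ k).2)

/-- Under Φ these operators have symbols of degree 0 and 1, so the two cases j = 0 and j = 1 of the
degree bound suffice. -/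
theorem exists_coreDerivation_bound (X : PolyVFDual EB F E) : ∃ n,
    (∀ b, (coreDerivation (coreAlgEquiv EB F E) X (coreFun EB F E b) : Module.End ℝ (SmoothFun EB F E)) ∈
      coreUpTo (scaleHom EB F E) n) ∧
    ∀ e : Cₛ^∞⟮𝓘(ℝ, EB); F, E⟯,
      (coreDerivation (coreAlgEquiv EB F E) X (coreField EB F e) : Module.End ℝ (SmoothFun EB F E)) ∈
        coreUpTo (scaleHom EB F E) n := by
  obtain ⟨n₀, h0⟩ := exists_degree_bound X 0
  obtain ⟨n₁, h1⟩ := exists_degree_bound X 1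
  refine ⟨max n₀ n₁ + 1, fun b => coreAlgEquiv_symm_mem_coreUpTo fun y => ?_,
    fun e => coreAlgEquiv_symm_mem_coreUpTo fun y => ?_⟩
  · rw [coreAlgEquiv_coreFun]
    exact (h0 _ (corePull_mem EB _ _ b) y).mono (le_max_left _ _)
  · rw [coreAlgEquiv_coreField]
    refine (h1 _ (mem_funDegree_iff.2 fun t φ => ?_) y).mono (le_max_right _ _)
    rw [pow_one]
    rfl

end BoundedOrder

section Surjectivity

/-! ### Derivations of the algebra of core operators are inner -/

attribute [local instance] LieRing.ofAssociativeRing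

variable {EB : Type*} [NormedAddCommGroup EB] [NormedSpace ℝ EB]
  {M : Type*} [TopologicalSpace M] [ChartedSpace EB M]
  {F : Type*} [NormedAddCommGroup F] [NormedSpace ℝ F]
  {E : M → Type*} [∀ x, AddCommGroup (E x)] [∀ x, Module ℝ (E x)] [∀ x, TopologicalSpace (E x)]
  [TopologicalSpace (TotalSpace F E)] [FiberBundle F E] [VectorBundle ℝ F E]
  [IsManifold 𝓘(ℝ, EB) ∞ M] [ContMDiffVectorBundle ∞ F E 𝓘(ℝ, EB)]
  [FiniteDimensional ℝ EB] [FiniteDimensional ℝ F] [T2Space M] [SecondCountableTopology M]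

theorem core_apply_corePull_mul {G : Module.End ℝ (SmoothFun EB F E)} (hG : G ∈ DOcore EB F E)
    (b : C^∞⟮𝓘(ℝ, EB), M; 𝓘(ℝ, ℝ), ℝ⟯) (g : SmoothFun EB F E) :
    G (corePull EB F E b * g) = corePull EB F E b * G g :=
  apply_mul_of_mem_funDegree_zero isFibrewise hG (corePull_mem EB F E b) g

/-- Core operators are local in the base. -/
theorem core_apply_eq_zero_of_eqOn {G : Module.End ℝ (SmoothFun EB F E)} (hG : G ∈ DOcore EB F E)
    {f : SmoothFun EB F E} {V : Set M} (hV : IsOpen V)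
    (hf : ∀ p : TotalSpace F E, p.proj ∈ V → f p = 0) {p : TotalSpace F E} (hp : p.proj ∈ V) :
    G f p = 0 := by
  obtain ⟨χ, hχ, hχ1⟩ := exists_bump_near (EB := EB) hV hp
  have h0 : corePull EB F E χ * f = 0 := by
    ext q
    change χ q.proj * f q = 0
    by_cases hq : q.proj ∈ V
    · rw [hf q hq, mul_zero]
    · rw [image_eq_zero_of_notMem_tsupport fun h => hq (hχ h), zero_mul]
  have h1 := core_apply_corePull_mul hG χ f
  rw [h0, map_zero] at h1
  have h2 : χ p.proj * G f p = 0 := (congrArg (fun f : SmoothFun EB F E => f p) h1).symm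
  rwa [eq_one_of_mem_oneDom hχ1, one_mul] at h2

namespace DualCoordinates

variable {U : Set M} {ι ι' : Type} [Fintype ι] [Fintype ι'] [DecidableEq ι] [DecidableEq ι']
  (c : DualCoordinates EB F E U ι ι')

/-- Over the domain of the coordinates, the coordinate derivations commute. -/
theorem H_T_comm (j : ι) (a : ι') (g : SmoothFun EB F E) {p : TotalSpace F E} (hp : p.proj ∈ U) :
    c.H j (c.T a g) p = c.T a (c.H j g) p := by
  have h1 := c.pointDerivation_eq_zero hp
    ((evalHom p).toLinearMap ∘ₗ (⁅c.H j, c.T a⁆ : Derivation ℝ (SmoothFun EB F E) _).toLinearMap)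
    (fun f g => by
      change ⁅c.H j, c.T a⁆ (f * g) p = f p * ⁅c.H j, c.T a⁆ g p + g p * ⁅c.H j, c.T a⁆ f p
      rw [Derivation.leibniz]
      rfl)
    (fun i => by
      change ⁅c.H j, c.T a⁆ (corePull EB F E (c.x i)) p = 0
      rw [Derivation.commutator_apply, c.T_zero a _ (corePull_mem EB F E _),
        c.T_zero a _ (c.H_mem j 0 _ (corePull_mem EB F E _)), map_zero, sub_zero]
      rfl)
    (fun b => by
      change c.H j (c.T a (c.u b)) p - c.T a (c.H j (c.u b)) p = 0
      -- Derivations are local over the base, so it is enough that the inner derivatives are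
      -- constant over `U`.
      have e1 : c.H j (c.T a (c.u b)) p =
          c.H j (algebraMap ℝ (SmoothFun EB F E) (if a = b then 1 else 0)) p :=
        derivation_congr_of_eqOn _ c.isOpen (fun q hq => c.T_u a b q hq) hp
      have e2 : c.T a (c.H j (c.u b)) p = c.T a 0 p :=
        derivation_congr_of_eqOn _ c.isOpen (fun q hq => c.H_u j b q hq) hp
      rw [e1, e2, Derivation.map_algebraMap, map_zero, sub_self])
  exact sub_eq_zero.1 (LinearMap.congr_fun h1 g)

/-- The vertical lift of a section in coordinates. -/
theorem verticalLift_apply_eq (e : Cₛ^∞⟮𝓘(ℝ, EB); F, E⟯) (g : SmoothFun EB F E)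
    {p : TotalSpace F E} (hp : p.proj ∈ U) : verticalLift EB F e g p =
      ∑ a, restrict (verticalLift EB F e (c.u a)) p.proj * c.T a g p := by
  have hr : ∀ a, restrict (verticalLift EB F e (c.u a)) p.proj = verticalLift EB F e (c.u a) p :=
    fun a => by
      have h1 := coreOrder_apply_mem isFibrewise (k := 0)
        (verticalLift_mem_coreOrder (EB := EB) (F := F) e) (c.u_mem a)
      exact DFunLike.congr_fun (corePull_restrict h1) p
  let δ : SmoothFun EB F E →ₗ[ℝ] ℝ := (evalHom p).toLinearMap ∘ₗ
    (verticalLift EB F e - ∑ a, algebraMap ℝ (SmoothFun EB F E) (verticalLift EB F e (c.u a) p) •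
      c.T a : Derivation ℝ (SmoothFun EB F E) _).toLinearMap
  have hδ : ∀ g, δ g = verticalLift EB F e g p -
      ∑ a, verticalLift EB F e (c.u a) p * c.T a g p := fun g => by
    change (verticalLift EB F e - ∑ a, algebraMap ℝ (SmoothFun EB F E)
      (verticalLift EB F e (c.u a) p) • c.T a : Derivation ℝ (SmoothFun EB F E) _) g p = _
    rw [Derivation.sub_apply, sum_derivation_apply]
    change _ - (∑ a, _ : SmoothFun EB F E) p = _
    rw [sum_apply]
    rfl
  have h0 : δ = 0 := by
    refine c.pointDerivation_eq_zero hp δ (fun f g => ?_) (fun i => ?_) fun b => ?_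
    · change (verticalLift EB F e - ∑ a, algebraMap ℝ (SmoothFun EB F E)
        (verticalLift EB F e (c.u a) p) • c.T a : Derivation ℝ (SmoothFun EB F E) _) (f * g) p = _
      rw [Derivation.leibniz]
      rfl
    · rw [hδ]
      have e1 : verticalLift EB F e (corePull EB F E (c.x i)) = 0 :=
        coreOrder_apply_eq_zero isFibrewise one_pos
          (verticalLift_mem_coreOrder (EB := EB) (F := F) e) (corePull_mem EB F E _)
      have e2 : ∀ a, c.T a (corePull EB F E (c.x i)) p = 0 := fun a => by
        rw [c.T_zero a _ (corePull_mem EB F E _)]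
        rfl
      simp only [e1, e2, mul_zero, Finset.sum_const_zero, sub_zero]
      rfl
    · rw [hδ]
      simp only [fun a => c.T_u a b p hp, mul_ite, mul_one, mul_zero, Finset.sum_ite_eq',
        Finset.mem_univ, if_true, sub_self]
  simp only [hr]
  rw [← sub_eq_zero, ← hδ, h0, LinearMap.zero_apply]

theorem coreFun_mul_coreField {χ : C^∞⟮𝓘(ℝ, EB), M; 𝓘(ℝ, ℝ), ℝ⟯} (hχ : tsupport χ ⊆ U)
    (e : Cₛ^∞⟮𝓘(ℝ, EB); F, E⟯) : coreFun EB F E χ * coreField EB F e =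
      ∑ a, coreFun EB F E (χ * restrict (verticalLift EB F e (c.u a))) *
        coreField EB F (c.s a) := by
  apply Subtype.ext
  rw [AddSubmonoidClass.coe_finsetSum]
  ext g p
  rw [LinearMap.sum_apply, sum_apply]
  change χ p.proj * verticalLift EB F e g p = ∑ a, χ p.proj *
    restrict (verticalLift EB F e (c.u a)) p.proj * verticalLift EB F (c.s a) g p
  by_cases hp : χ p.proj = 0
  · simp [hp]
  · rw [c.verticalLift_apply_eq e g (hχ (subset_closure hp)), Finset.mul_sum]
    refine Finset.sum_congr rfl fun a _ => ?_
    rw [← c.T_eq, mul_assoc]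

variable (D : DOcore EB F E →ₗ[ℝ] DOcore EB F E)

/-- An operator whose commutator with core operators is, over the domain of the coordinates, a
given derivation of the algebra of core operators. -/
noncomputable def innerOp : Module.End ℝ (SmoothFun EB F E) :=
  ∑ j, (D (coreFun EB F E (c.x j))).1 * (c.H j : Module.End ℝ (SmoothFun EB F E)) -
    ∑ a, mulOp (c.u a) * (D (coreField EB F (c.s a))).1

theorem innerOp_apply (g : SmoothFun EB F E) (p : TotalSpace F E) : c.innerOp D g p =
    ∑ j, (D (coreFun EB F E (c.x j))).1 (c.H j g) p -
      ∑ a, c.u a p * (D (coreField EB F (c.s a))).1 g p := by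
  rw [innerOp, LinearMap.sub_apply, LinearMap.sum_apply, LinearMap.sum_apply]
  change (∑ j, _ : SmoothFun EB F E) p - (∑ a, _ : SmoothFun EB F E) p = _
  rw [sum_apply, sum_apply]
  rfl

theorem innerOp_mem_linUpTo {n : ℕ}
    (h0 : ∀ b, (D (coreFun EB F E b)).1 ∈ coreUpTo (scaleHom EB F E) n)
    (h1 : ∀ e : Cₛ^∞⟮𝓘(ℝ, EB); F, E⟯, (D (coreField EB F e)).1 ∈ coreUpTo (scaleHom EB F E) n) :
    c.innerOp D ∈ linUpTo (scaleHom EB F E) (n + 1) := by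
  refine Submodule.sub_mem _ (Submodule.sum_mem _ fun j _ => mul_mem_linUpTo (h0 _) ?_)
    (Submodule.sum_mem _ fun a _ => mulOp_mul_mem_linUpTo (h1 _) (c.u_mem a))
  refine ⟨derivation_mem_order _, ?_⟩
  rw [show -((1 : ℕ) : ℤ) + 1 = 0 by norm_num]
  exact isFibrewise.derivation_mem_opDegree_zero (c.H_mem j 0) (c.H_mem j 1)

variable {D} (hD : ∀ G G' : DOcore EB F E, D (G * G') = G * D G' + D G * G')

include hD in
-- Only the terms with H_j contribute, giving Σ H_j(b) D(x_j). This equals D(b), since b ↦ D(b) g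
-- (p) is a derivation at the base point of p.
theorem innerOp_lie_coreFun (b : C^∞⟮𝓘(ℝ, EB), M; 𝓘(ℝ, ℝ), ℝ⟯) (g : SmoothFun EB F E)
    {p : TotalSpace F E} (hp : p.proj ∈ U) :
    ⁅c.innerOp D, (coreFun EB F E b).1⁆ g p = (D (coreFun EB F E b)).1 g p := by
  let δ : C^∞⟮𝓘(ℝ, EB), M; 𝓘(ℝ, ℝ), ℝ⟯ →ₗ[ℝ] ℝ :=
    { toFun := fun b => (D (coreFun EB F E b)).1 g p
      map_add' := fun b b' => by
        have e1 : coreFun EB F E (b + b') = coreFun EB F E b + coreFun EB F E b' :=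
          Subtype.ext (LinearMap.ext fun g => add_mul (corePull EB F E b) (corePull EB F E b') g)
        rw [e1, map_add]
        rfl
      map_smul' := fun r b => by
        have e1 : coreFun EB F E (r • b) = r • coreFun EB F E b :=
          Subtype.ext (LinearMap.ext fun g => smul_mul_assoc r (corePull EB F E b) g)
        rw [e1, map_smul]
        rfl }
  have h1 := c.basePointDerivation hp δ (fun b b' => by
    have e1 : coreFun EB F E (b * b') = coreFun EB F E b * coreFun EB F E b' :=
      Subtype.ext (LinearMap.ext fun g => mul_assoc (corePull EB F E b) (corePull EB F E b') g)
    change (D (coreFun EB F E (b * b'))).1 g p = _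
    rw [e1, hD]
    change b p.proj * (D (coreFun EB F E b')).1 g p +
      (D (coreFun EB F E b)).1 (corePull EB F E b' * g) p = _
    rw [core_apply_corePull_mul (D (coreFun EB F E b)).2]
    rfl) b
  refine Eq.trans ?_ h1.symm
  change c.innerOp D (corePull EB F E b * g) p - b p.proj * c.innerOp D g p = _
  rw [innerOp_apply, innerOp_apply]
  have e2 : ∀ a, (D (coreField EB F (c.s a))).1 (corePull EB F E b * g) p =
      b p.proj * (D (coreField EB F (c.s a))).1 g p := fun a => by
    rw [core_apply_corePull_mul (D (coreField EB F (c.s a))).2]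
    rfl
  have e3 : ∀ j, (D (coreFun EB F E (c.x j))).1 (c.H j (corePull EB F E b * g)) p =
      b p.proj * (D (coreFun EB F E (c.x j))).1 (c.H j g) p +
        c.H j (corePull EB F E b) (zeroSection F E p.proj) *
          (D (coreFun EB F E (c.x j))).1 g p := fun j => by
    have hH := c.H_mem j 0 _ (corePull_mem EB F E b)
    rw [Derivation.leibniz, map_add, smul_eq_mul, smul_eq_mul,
      core_apply_corePull_mul (D (coreFun EB F E (c.x j))).2, mul_comm g,
      apply_mul_of_mem_funDegree_zero isFibrewise (D (coreFun EB F E (c.x j))).2 hH,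
      ← apply_eq_of_mem_funDegree_zero hH (p := p) (q := zeroSection F E p.proj) rfl]
    rfl
  simp only [e2, e3, Finset.sum_add_distrib, mul_left_comm (c.u _ p), mul_sub, Finset.mul_sum]
  change _ = ∑ j, _ * (D (coreFun EB F E (c.x j))).1 g p
  ring

/-- T_a commutes with the H_j over `U` and with all values of D, as these are core. What remains is
the commutator of T_a with the coordinates u_b, which is 1 for b = a and 0 otherwise; the minus sign
in `innerOp` makes the result +D. -/
theorem innerOp_lie_frame (a : ι') (g : SmoothFun EB F E)
    {p : TotalSpace F E} (hp : p.proj ∈ U) :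
    ⁅c.innerOp D, (coreField EB F (c.s a)).1⁆ g p = (D (coreField EB F (c.s a))).1 g p := by
  change c.innerOp D (verticalLift EB F (c.s a) g) p - verticalLift EB F (c.s a) (c.innerOp D g) p = _
  rw [← c.T_eq, innerOp_apply, innerOp, LinearMap.sub_apply, LinearMap.sum_apply,
    LinearMap.sum_apply, map_sub, map_sum, map_sum]
  change _ - ((∑ j, _ : SmoothFun EB F E) p - (∑ b, _ : SmoothFun EB F E) p) = _
  rw [sum_apply, sum_apply]
  have hcomm : ∀ G : DOcore EB F E, ∀ f, c.T a (G.1 f) = G.1 (c.T a f) := fun G f => by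
    rw [c.T_eq]
    exact LinearMap.congr_fun (congrArg Subtype.val
      (isFibrewise.core_mul_comm (coreField EB F (c.s a)) G)) f
  have e1 : ∀ j, c.T a (((D (coreFun EB F E (c.x j))).1 *
      (c.H j : Module.End ℝ (SmoothFun EB F E))) g) p =
      (D (coreFun EB F E (c.x j))).1 (c.H j (c.T a g)) p := fun j => by
    change c.T a ((D (coreFun EB F E (c.x j))).1 (c.H j g)) p = _
    rw [hcomm, ← sub_eq_zero]
    have := core_apply_eq_zero_of_eqOn (D (coreFun EB F E (c.x j))).2 c.isOpen
      (f := c.T a (c.H j g) - c.H j (c.T a g))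
      (fun q hq => sub_eq_zero.2 (c.H_T_comm j a g hq).symm) hp
    rwa [map_sub] at this
  have e2 : ∀ b, c.T a ((mulOp (c.u b) * (D (coreField EB F (c.s b))).1) g) p =
      c.u b p * (D (coreField EB F (c.s b))).1 (c.T a g) p +
        (D (coreField EB F (c.s b))).1 g p * (if a = b then 1 else 0) := fun b => by
    change c.T a (c.u b * (D (coreField EB F (c.s b))).1 g) p = _
    rw [Derivation.leibniz, hcomm, ← c.T_u a b p hp]
    rfl
  simp only [e1, e2, Finset.sum_add_distrib, mul_ite, mul_one, mul_zero, Finset.sum_ite_eq,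
    Finset.mem_univ, if_true]
  ring

include hD in
-- The defect G ↦ [Δ, G] - D(G), evaluated at g and p, is linear over base functions by the previous
-- case for such functions. After a cut-off, the vertical lift of e is a combination of the frame
-- lifts, on which the defect is zero.
theorem innerOp_lie_coreField (e : Cₛ^∞⟮𝓘(ℝ, EB); F, E⟯) (g : SmoothFun EB F E)
    {p : TotalSpace F E} (hp : p.proj ∈ U) :
    ⁅c.innerOp D, (coreField EB F e).1⁆ g p = (D (coreField EB F e)).1 g p := by
  obtain ⟨χ, hχ, hχ1⟩ := exists_bump_near (EB := EB) c.isOpen hp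
  have key : ∀ (b : C^∞⟮𝓘(ℝ, EB), M; 𝓘(ℝ, ℝ), ℝ⟯) (G : DOcore EB F E),
      ⁅c.innerOp D, (coreFun EB F E b * G).1⁆ g p - (D (coreFun EB F E b * G)).1 g p =
        b p.proj * (⁅c.innerOp D, G.1⁆ g p - (D G).1 g p) := fun b G => by
    have h1 := c.innerOp_lie_coreFun hD b (G.1 g) hp
    rw [hD]
    change c.innerOp D (corePull EB F E b * G.1 g) p - b p.proj * c.innerOp D (G.1 g) p =
      (D (coreFun EB F E b)).1 (G.1 g) p at h1
    change c.innerOp D (corePull EB F E b * G.1 g) p - b p.proj * G.1 (c.innerOp D g) p -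
      (b p.proj * (D G).1 g p + (D (coreFun EB F E b)).1 (G.1 g) p) =
      b p.proj * (c.innerOp D (G.1 g) p - G.1 (c.innerOp D g) p - (D G).1 g p)
    linear_combination h1
  let L : DOcore EB F E →ₗ[ℝ] ℝ :=
    { toFun := fun G => ⁅c.innerOp D, G.1⁆ g p - (D G).1 g p
      map_add' := fun G G' => by
        rw [map_add]
        change c.innerOp D (G.1 g + G'.1 g) p - (G.1 (c.innerOp D g) p + G'.1 (c.innerOp D g) p) -
          ((D G).1 g p + (D G').1 g p) =
          (c.innerOp D (G.1 g) p - G.1 (c.innerOp D g) p - (D G).1 g p) +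
          (c.innerOp D (G'.1 g) p - G'.1 (c.innerOp D g) p - (D G').1 g p)
        rw [map_add]
        change c.innerOp D (G.1 g) p + c.innerOp D (G'.1 g) p - _ - _ = _
        ring
      map_smul' := fun r G => by
        rw [map_smul]
        change c.innerOp D (r • G.1 g) p - r * G.1 (c.innerOp D g) p - r * (D G).1 g p =
          r * (c.innerOp D (G.1 g) p - G.1 (c.innerOp D g) p - (D G).1 g p)
        rw [map_smul]
        change r * c.innerOp D (G.1 g) p - _ - _ = _
        ring }
  have h1 : L (coreFun EB F E χ * coreField EB F e) = 0 := by
    rw [c.coreFun_mul_coreField hχ e, map_sum]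
    refine Finset.sum_eq_zero fun a _ => (key _ _).trans ?_
    rw [c.innerOp_lie_frame a g hp, sub_self, mul_zero]
  have h2 := (key χ (coreField EB F e)).symm.trans h1
  rw [eq_one_of_mem_oneDom hχ1, one_mul] at h2
  exact sub_eq_zero.1 h2

end DualCoordinates

/-- A derivation of the algebra of core operators of bounded order is the commutator with a
fibrewise linear operator on functions on the base and on vertical lifts. -/
theorem exists_linDO_of_derivation (D : DOcore EB F E →ₗ[ℝ] DOcore EB F E)
    (hD : ∀ G G' : DOcore EB F E, D (G * G') = G * D G' + D G * G') {n : ℕ}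
    (h0 : ∀ b, (D (coreFun EB F E b)).1 ∈ coreUpTo (scaleHom EB F E) n)
    (h1 : ∀ e : Cₛ^∞⟮𝓘(ℝ, EB); F, E⟯, (D (coreField EB F e)).1 ∈ coreUpTo (scaleHom EB F E) n) :
    ∃ Δ : DOlin EB F E, (∀ b, ⁅Δ, coreFun EB F E b⁆ = D (coreFun EB F E b)) ∧
      ∀ e : Cₛ^∞⟮𝓘(ℝ, EB); F, E⟯, ⁅Δ, coreField EB F e⁆ = D (coreField EB F e) := by
  obtain ⟨𝒜⟩ := exists_coordinateAtlas EB F E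
  refine ⟨⟨glue 𝒜.locallyFinite fun i => (𝒜.coord i).innerOp D,
    glue_mem_linDO _ fun i => (𝒜.coord i).innerOp_mem_linUpTo D h0 h1⟩, fun b => ?_, fun e => ?_⟩
  · apply Subtype.ext
    refine (glue_lie_mulOp 𝒜.locallyFinite _ (corePull EB F E b)).trans ?_
    ext g p
    rw [glue_apply]
    refine (Finset.sum_congr rfl fun i hi => congrArg (𝒜.ρ i p.proj * ·)
      ((𝒜.coord i).innerOp_lie_coreFun hD b g (𝒜.mem_of_mem_indicesAt hi))).trans ?_
    rw [← Finset.sum_mul, 𝒜.sum_eq_one, one_mul]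
  · apply Subtype.ext
    refine (glue_lie_verticalLift 𝒜.locallyFinite _ e).trans ?_
    ext g p
    rw [glue_apply]
    refine (Finset.sum_congr rfl fun i hi => congrArg (𝒜.ρ i p.proj * ·)
      ((𝒜.coord i).innerOp_lie_coreField hD e g (𝒜.mem_of_mem_indicesAt hi))).trans ?_
    rw [← Finset.sum_mul, 𝒜.sum_eq_one, one_mul]

/-- Vector fields on the dual bundle are determined by their action on functions on the base and on
fibrewise linear functions of sections. -/
theorem dual_derivation_ext {X Y : Derivation ℝ (SmoothFun EB (F →L[ℝ] ℝ) (Dual E))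
    (SmoothFun EB (F →L[ℝ] ℝ) (Dual E))}
    (h0 : ∀ b, X (corePull EB (F →L[ℝ] ℝ) (Dual E) b) = Y (corePull EB (F →L[ℝ] ℝ) (Dual E) b))
    (h1 : ∀ e : Cₛ^∞⟮𝓘(ℝ, EB); F, E⟯, X (linFun EB F e) = Y (linFun EB F e)) : X = Y := by
  ext f φ
  obtain ⟨U, hU, ⟨c⟩⟩ := exists_dualCoordinates EB F E φ.proj
  have h2 := c.dual.pointDerivation_eq_zero hU ((evalHom φ).toLinearMap ∘ₗ (X - Y).toLinearMap)
    (fun f g => by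
      change (X - Y) (f * g) φ = f φ * (X - Y) g φ + g φ * (X - Y) f φ
      rw [Derivation.leibniz]
      rfl)
    (fun i => by
      change X _ φ - Y _ φ = 0
      rw [h0, sub_self])
    (fun a => by
      change X _ φ - Y _ φ = 0
      rw [c.dual_u, h1, sub_self])
  exact sub_eq_zero.1 (LinearMap.congr_fun h2 f)

/-- The constructed operator induces the right derivation only on base functions and vertical lifts.
This is enough, since its adjoint vector field and X then agree on base functions and on all ℓ_e,
hence are equal. -/
theorem exists_linDO_of_polyVF (X : PolyVFDual EB F E) : ∃ Δ : DOlin EB F E,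
    ∀ G : DOcore EB F E, ⁅X, coreAlgEquiv EB F E G⁆ = coreAlgEquiv EB F E ⁅Δ, G⁆ := by
  obtain ⟨n, h0, h1⟩ := exists_coreDerivation_bound X
  obtain ⟨Δ, hΔ0, hΔ1⟩ := exists_linDO_of_derivation (coreDerivation (coreAlgEquiv EB F E) X)
    (coreDerivation_mul _ X) h0 h1
  refine ⟨Δ, (hasPolyExtension.eq_adjoint_iff (coreAlgEquiv EB F E)).1 (Subtype.ext ?_)⟩
  refine dual_derivation_ext (fun b => ?_) fun e => ?_
  · have h2 := hasPolyExtension.adjoint_lie (coreAlgEquiv EB F E) Δ (coreFun EB F E b)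
    rw [hΔ0, apply_coreDerivation, coreAlgEquiv_coreFun] at h2
    exact (congrArg Subtype.val h2).symm
  · have h2 := hasPolyExtension.adjoint_lie (coreAlgEquiv EB F E) Δ (coreField EB F e)
    rw [hΔ1, apply_coreDerivation, coreAlgEquiv_coreField] at h2
    exact (congrArg Subtype.val h2).symm

end Surjectivity

end FWL

theorem mainTheorem2
    {EB : Type*} [NormedAddCommGroup EB] [NormedSpace ℝ EB] [FiniteDimensional ℝ EB]
    {M : Type*} [TopologicalSpace M] [ChartedSpace EB M] [IsManifold 𝓘(ℝ, EB) ∞ M]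
    [T2Space M] [SecondCountableTopology M]
    {F : Type*} [NormedAddCommGroup F] [NormedSpace ℝ F] [FiniteDimensional ℝ F]
    {E : M → Type*} [∀ x, AddCommGroup (E x)] [∀ x, Module ℝ (E x)]
    [∀ x, TopologicalSpace (E x)] [TopologicalSpace (TotalSpace F E)]
    [FiberBundle F E] [VectorBundle ℝ F E] [ContMDiffVectorBundle ∞ F E 𝓘(ℝ, EB)] :
    -- fibre-wise linear operators are exactly the stabilizer of the core operators
    (∀ Δ : Module.End ℝ (FWL.SmoothFun EB F E),
      Δ ∈ FWL.DOlin EB F E ↔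
        Δ ∈ FWL.DO EB F E ∧ ∀ G ∈ FWL.DOcore EB F E, ⁅Δ, G⁆ ∈ FWL.DOcore EB F E) ∧
    -- the algebra of core operators is its own centralizer
    (∀ Δ : Module.End ℝ (FWL.SmoothFun EB F E),
      Δ ∈ FWL.DOcore EB F E ↔
        Δ ∈ FWL.DO EB F E ∧ ∀ G ∈ FWL.DOcore EB F E, ⁅Δ, G⁆ = 0) ∧
    -- core operators form a commutative algebra
    ∃ hc : ∀ G G' : FWL.DOcore EB F E, G * G' = G' * G,
      letI : CommRing (FWL.DOcore EB F E) := FWL.coreCommRing (FWL.scaleHom EB F E) hc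
      -- over this algebra, the fibre-wise linear operators (with anchor `ad`) are a
      -- Lie-Rinehart algebra, and so are the core operators (with zero bracket and anchor)
      (∃ _ : LieRinehartRing (FWL.DOcore EB F E) (FWL.DOlin EB F E),
        LieRinehartAlgebra ℝ (FWL.DOcore EB F E) (FWL.DOlin EB F E)) ∧
      (∃ _ : LieRinehartRing (FWL.DOcore EB F E) (FWL.DOcore EB F E),
        LieRinehartAlgebra ℝ (FWL.DOcore EB F E) (FWL.DOcore EB F E)) ∧
      -- the canonical algebra isomorphism onto the polynomial functions on the dual bundle
      ∃ Φ : FWL.DOcore EB F E ≃ₐ[ℝ] FWL.PolyFunDual EB F E,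
        (∀ f, Φ (FWL.coreFun EB F E f) = FWL.polyPull EB F E f) ∧
        (∀ e : Cₛ^∞⟮𝓘(ℝ, EB); F, E⟯, Φ (FWL.coreField EB F e) = FWL.polyLin EB F e) ∧
        (∀ Ψ : FWL.DOcore EB F E →ₐ[ℝ] FWL.PolyFunDual EB F E,
          (∀ f, Ψ (FWL.coreFun EB F E f) = FWL.polyPull EB F E f) →
          (∀ e : Cₛ^∞⟮𝓘(ℝ, EB); F, E⟯, Ψ (FWL.coreField EB F e) = FWL.polyLin EB F e) →
          Ψ = Φ.toAlgHom) ∧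
        -- the exact sequence of Lie-Rinehart algebras
        ∃ (ι : LieRinehartAlgebra.Hom (AlgHom.id ℝ (FWL.DOcore EB F E))
              (FWL.DOcore EB F E) (FWL.DOlin EB F E))
          (ad : LieRinehartAlgebra.Hom Φ.toAlgHom (FWL.DOlin EB F E) (FWL.PolyVFDual EB F E)),
          (∀ G, (ι G : Module.End ℝ (FWL.SmoothFun EB F E)) = G) ∧
          (∀ (Δ : FWL.DOlin EB F E) (X : FWL.PolyVFDual EB F E),
            X = ad Δ ↔ ∀ G : FWL.DOcore EB F E, ⁅X, Φ G⁆ = Φ ⁅Δ, G⁆) ∧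
          Function.Injective ι ∧ Function.Exact ι ad ∧ Function.Surjective ad := by
  have H := FWL.isFibrewise (EB := EB) (F := F) (E := E)
  refine ⟨H.mem_linDO_iff, H.mem_coreDO_iff, H.core_mul_comm, H.lieRinehart_linDO,
    H.lieRinehart_coreDO, FWL.coreAlgEquiv EB F E, FWL.coreAlgEquiv_coreFun,
    FWL.coreAlgEquiv_coreField, FWL.eq_coreAlgEquiv, ?_⟩
  exact FWL.hasPolyExtension.exactSequence (FWL.coreAlgEquiv EB F E) H
    FWL.exists_linDO_of_polyVF
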